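/- All graphs are finite and simple. For a connected graph $G$ and a path $P$ of $G$ (a single vertex is a path), let $\mathrm{ecc}_G(P)=\max_{u\in V(G)}\min_{v\in V(P)}d_G(u,v)$. The path $P$ is *dominating* if $\mathrm{ecc}_G(P)\le 1$, and $\mathrm{pe}(G)$ is the minimum of $\mathrm{ecc}_G(P)$ over all paths $P$ of $G$. A *bipartite permutation graph* is a bipartite graph that is the inversion graph of a permutation. Let $G$ be bipartite with parts $X=\{x_1<\dots<x_n\}$ and $Y=\{y_1<\dots<y_m\}$. The ordering is *strong* if, whenever $x_i\le x_k$, $y_a\le y_c$ and $x_iy_c,\,x_ky_a\in E(G)$, also $x_iy_a,\,x_ky_c\in E(G)$. The *complete bipartite decomposition* $(K_1,J_1),\dots,(K_k,J_k)$ of $G$ with respect to a strong ordering is obtained as follows. Let $K_1=N(x)\cup N(y)$, where $x$ and $y$ are the first vertices of $X$ and $Y$; let $J_1$ be the set of isolated vertices of $G-K_1$; replace $G$ by $G-(K_1\cup J_1)$ and repeat with the first remaining vertices of $X$ and $Y$, until no vertex is left. For a set $K$ of vertices let $\ell_X(K),r_X(K)$ be the first and the last vertex of $K\cap X$, and define $\ell_Y(K),r_Y(K)$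 similarly. An *$XY$-edge* from $K_i$ to $K_{i+1}$ is an edge between $K_i\cap X$ and $K_{i+1}\cap Y$. **Algorithm Dom-Path-BPG.** Input: a connected bipartite permutation graph $G$ with at least two vertices. (1) Choose a strong ordering of $V(G)$ and (2) compute its complete bipartite decomposition $(K_1,J_1),\dots,(K_k,J_k)$. Let $P$ be empty and $v=\ell_X(K_1)$. (3) For $i=1,\dots,k-1$: if there is an $XY$-edge from $K_i$ to $K_{i+1}$, append to $P$ a path in $G[K_i]$ between $v$ and $r_X(K_i)$ and set $v\leftarrow\ell_Y(K_{i+1})$; otherwise append to $P$ a path in $G[K_i]$ between $v$ and $r_Y(K_i)$ and set $v\leftarrow \ell_X(K_{i+1})$. (4) If $J_k\subseteq Y$, append a path in $G[K_k]$ between $v$ and $r_X(K_k)$; otherwise append a path in $G[K_k]$ between $v$ and $r_Y(K_k)$. Return $P$. **Theorem.** 1. (Correctness) Let $G$ be a connected bipartite permutation graph with at least two vertices. Then $G$ has a strong ordering. For every strong ordering of $V(G)$ the complete bipartite decomposition exists, and the algorithm can be carried out; and whatever paths it chooses in steps (3) and (4), it returns a dominating path of $G$. 2. (Running time) The algorithm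 can be carried out in $\mathcal O(|V(G)|+|E(G)|)$ time. That is, there are a program for the uniform-cost random access machine (with addition, truncated subtraction and comparisons as its arithmetic operations) and a constant $C$ such that, on every connected bipartite permutation graph $G$ given by adjacency lists, the program halts after at most $C(|V(G)|+|E(G)|)$ steps and outputs a dominating path $P$ of $G$; and if $|V(G)|\ge 2$, it also outputs a strong ordering of $V(G)$ and the corresponding complete bipartite decomposition for which $P$ is a possible result of the algorithm. 3. Consequently, $\mathrm{pe}(G)\le 1$ for every connected bipartite permutation graph $G$. -/

import Mathlib

/-! ### Path eccentricity -/

namespace PathEcc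

/-- `d_G(u, S) = min {d_G(u, v) : v ∈ S}` (used for nonempty `S` in connected graphs). -/
noncomputable def distSet {V : Type*} (G : SimpleGraph V) (u : V) (S : Set V) : ℕ :=
  sInf ((fun v => G.dist u v) '' S)

/-- `max {d_G(u, S) : u ∈ V(G)}` (used for finite graphs). -/
noncomputable def ecc {V : Type*} (G : SimpleGraph V) (S : Set V) : ℕ :=
  ⨆ u : V, distSet G u S

/-- The path eccentricity `pe(G)`: the minimum of `ecc_G(P)` over all paths `P` of `G`. -/
noncomputable def pe {V : Type*} (G : SimpleGraph V) : ℕ :=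
  sInf {e : ℕ | ∃ (u w : V) (p : G.Walk u w), p.IsPath ∧ e = ecc G {v | v ∈ p.support}}

/-- The sequence `P` of vertices is a path of `G`, and its eccentricity is at most one. -/
def IsDominatingPath {V : Type*} (G : SimpleGraph V) (P : List V) : Prop :=
  ∃ (u w : V) (p : G.Walk u w), p.IsPath ∧ p.support = P ∧ ecc G {v | v ∈ P} ≤ 1

/-! ### Bipartite permutation graphs and strong orderings -/

/-- `G` is a permutation graph: its vertices can be numbered so that two of them are adjacent
exactly if they form an inversion of some fixed permutation. -/
def IsPermutationGraph {V : Type*} (G : SimpleGraph V) : Prop :=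
  ∃ (n : ℕ) (e : V ≃ Fin n) (σ : Equiv.Perm (Fin n)), ∀ u v : V,
    G.Adj u v ↔ (e u < e v ∧ σ (e v) < σ (e u)) ∨ (e v < e u ∧ σ (e u) < σ (e v))

def IsBipartitePermutationGraph {V : Type*} (G : SimpleGraph V) : Prop :=
  G.IsBipartite ∧ IsPermutationGraph G

/-- A bipartition `V(G) = X ∪ Y` of `G` together with a linear ordering of each part:
`X = {x 0, …, x (p - 1)}` and `Y = {y 0, …, y (q - 1)}`. -/
structure Ordering {V : Type*} (G : SimpleGraph V) where
  p : ℕ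
  q : ℕ
  x : Fin p → V
  y : Fin q → V
  bij : Function.Bijective (Sum.elim x y)
  not_adj_x : ∀ i k, ¬ G.Adj (x i) (x k)
  not_adj_y : ∀ j l, ¬ G.Adj (y j) (y l)

namespace Ordering

variable {V : Type*} {G : SimpleGraph V}

/-- The ordering is strong: if `i ≤ k`, `a ≤ c` and `x i y c`, `x k y a` are edges,
then so are `x i y a` and `x k y c`. -/
def IsStrong (O : Ordering G) : Prop :=
  ∀ (i k : Fin O.p) (a c : Fin O.q), i ≤ k → a ≤ c →
    G.Adj (O.x i) (O.y c) → G.Adj (O.x k) (O.y a) →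
      G.Adj (O.x i) (O.y a) ∧ G.Adj (O.x k) (O.y c)

/-- `i` is the index of the least (leftmost) vertex of `S ∩ X`, i.e. `x i = ℓ_X(S)`. -/
def IsLX (O : Ordering G) (S : Set V) (i : Fin O.p) : Prop := IsLeast {k | O.x k ∈ S} i

/-- `x i = r_X(S)`. -/
def IsRX (O : Ordering G) (S : Set V) (i : Fin O.p) : Prop := IsGreatest {k | O.x k ∈ S} i

/-- `y j = ℓ_Y(S)`. -/
def IsLY (O : Ordering G) (S : Set V) (j : Fin O.q) : Prop := IsLeast {l | O.y l ∈ S} j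

/-- `y j = r_Y(S)`. -/
def IsRY (O : Ordering G) (S : Set V) (j : Fin O.q) : Prop := IsGreatest {l | O.y l ∈ S} j

end Ordering

/-! ### The complete bipartite decomposition -/

/-- A pair `(K_i, J_i)` of vertex sets. -/
structure Block (V : Type*) where
  K : Set V
  J : Set V

/-- The vertices of `N(u) ∪ N(v)`, the neighbourhoods being taken in the subgraph `G[R]`. -/
def kPart {V : Type*} (G : SimpleGraph V) (R : Set V) (u v : V) : Set V :=
  {w | w ∈ R ∧ (G.Adj u w ∨ G.Adj v w)}

/-- The isolated vertices of the graph `G[R]`. -/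
def isolated {V : Type*} (G : SimpleGraph V) (R : Set V) : Set V :=
  {w | w ∈ R ∧ ∀ z ∈ R, ¬ G.Adj w z}

/-- `Decomposes O R L`: the list `L = [(K_1, J_1), …, (K_k, J_k)]` is what one obtains from `G[R]`
by repeating the following step until no vertex is left. Let `K` be `N(x) ∪ N(y)`, where `x` and
`y` are the first remaining vertices of `X` and of `Y`, let `J` be the set of isolated vertices
left after deleting `K`, and delete `K ∪ J`. -/
inductive Decomposes {V : Type*} {G : SimpleGraph V} (O : Ordering G) :
    Set V → List (Block V) → Prop
  | nil : Decomposes O ∅ []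
  | cons {R K J : Set V} {i : Fin O.p} {j : Fin O.q} {L : List (Block V)}
      (hi : O.IsLX R i) (hj : O.IsLY R j)
      (hK : K = kPart G R (O.x i) (O.y j))
      (hJ : J = isolated G (R \ K))
      (hL : Decomposes O (R \ (K ∪ J)) L) :
      Decomposes O R (⟨K, J⟩ :: L)

/-- `L` is the complete bipartite decomposition of `G` with respect to the ordering `O`. -/
def IsCompleteBipartiteDecomposition {V : Type*} {G : SimpleGraph V} (O : Ordering G)
    (L : List (Block V)) : Prop :=
  Decomposes O Set.univ L

/-! ### The algorithm -/

/-- `P` is (the vertex sequence of) a path between `u` and `w` in the graph induced by `K`. -/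
def IsPathIn {V : Type*} (G : SimpleGraph V) (K : Set V) (u w : V) (P : List V) : Prop :=
  ∃ p : G.Walk u w, p.IsPath ∧ p.support = P ∧ ∀ z ∈ P, z ∈ K

/-- There is an `XY`-edge from `K` to `K'`: an edge whose end in `K` is in `X`
and whose end in `K'` is in `Y`. -/
def LinkedXY {V : Type*} {G : SimpleGraph V} (O : Ordering G) (K K' : Set V) : Prop :=
  ∃ (i : Fin O.p) (j : Fin O.q), O.x i ∈ K ∧ O.y j ∈ K' ∧ G.Adj (O.x i) (O.y j)

/-- `DomPathLoop O L v P`: with the blocks `L` still to be processed and with current vertex `v`,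
the algorithm can append the sequence `P` to its path before it returns. The constructors are the
two branches of the final conditional and the two branches of the body of the loop. -/
inductive DomPathLoop {V : Type*} {G : SimpleGraph V} (O : Ordering G) :
    List (Block V) → V → List V → Prop
  | lastX {B : Block V} {v : V} {i : Fin O.p} {P : List V}
      (hJ : B.J ⊆ Set.range O.y) (hi : O.IsRX B.K i) (hP : IsPathIn G B.K v (O.x i) P) :
      DomPathLoop O [B] v P
  | lastY {B : Block V} {v : V} {j : Fin O.q} {P : List V}
      (hJ : ¬ B.J ⊆ Set.range O.y) (hj : O.IsRY B.K j) (hP : IsPathIn G B.K v (O.y j) P) :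
      DomPathLoop O [B] v P
  | stepXY {B B' : Block V} {L : List (Block V)} {v : V} {i : Fin O.p} {j : Fin O.q}
      {P Q : List V}
      (hlink : LinkedXY O B.K B'.K) (hi : O.IsRX B.K i) (hP : IsPathIn G B.K v (O.x i) P)
      (hj : O.IsLY B'.K j) (hQ : DomPathLoop O (B' :: L) (O.y j) Q) :
      DomPathLoop O (B :: B' :: L) v (P ++ Q)
  | stepYX {B B' : Block V} {L : List (Block V)} {v : V} {i : Fin O.p} {j : Fin O.q}
      {P Q : List V}
      (hlink : ¬ LinkedXY O B.K B'.K) (hj : O.IsRY B.K j) (hP : IsPathIn G B.K v (O.y j) P)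
      (hi : O.IsLX B'.K i) (hQ : DomPathLoop O (B' :: L) (O.x i) Q) :
      DomPathLoop O (B :: B' :: L) v (P ++ Q)

/-- With the ordering `O` and the decomposition `L`, the algorithm can return the sequence `P`.
It starts with `v = ℓ_X(K_1)`. -/
def DomPathReturns {V : Type*} {G : SimpleGraph V} (O : Ordering G) (L : List (Block V))
    (P : List V) : Prop :=
  ∃ (B : Block V) (L' : List (Block V)) (i : Fin O.p),
    L = B :: L' ∧ O.IsLX B.K i ∧ DomPathLoop O L (O.x i) P

end PathEcc

/-! ### Random access machines

A small structured language for the random access machine with uniform costs. A program refers to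
finitely many registers and finitely many arrays, all of them holding natural numbers. The only
arithmetic operations are addition and truncated subtraction. -/

namespace RAM

structure State where
  reg : ℕ → ℕ
  arr : ℕ → ℕ → ℕ

inductive Expr where
  | const (k : ℕ)
  | reg (r : ℕ)
  | read (a : ℕ) (i : Expr)
  | add (e f : Expr)
  | sub (e f : Expr)
  | lt (e f : Expr)
  | eq (e f : Expr)

def Expr.eval (s : State) : Expr → ℕ
  | .const k => k
  | .reg r => s.reg r
  | .read a i => s.arr a (i.eval s)
  | .add e f => e.eval s + f.eval s
  | .sub e f => e.eval s - f.eval s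
  | .lt e f => if e.eval s < f.eval s then 1 else 0
  | .eq e f => if e.eval s = f.eval s then 1 else 0

/-- The number of elementary operations in the evaluation of an expression. -/
def Expr.cost : Expr → ℕ
  | .const _ => 1
  | .reg _ => 1
  | .read _ i => i.cost + 1
  | .add e f => e.cost + f.cost + 1
  | .sub e f => e.cost + f.cost + 1
  | .lt e f => e.cost + f.cost + 1
  | .eq e f => e.cost + f.cost + 1

inductive Program where
  | skip
  | set (r : ℕ) (e : Expr)
  | write (a : ℕ) (i e : Expr)
  | seq (c d : Program)
  | ite (e : Expr) (c d : Program)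
  | loop (e : Expr) (c : Program)

def State.setReg (s : State) (r k : ℕ) : State :=
  { s with reg := Function.update s.reg r k }

def State.setArr (s : State) (a i k : ℕ) : State :=
  { s with arr := Function.update s.arr a (Function.update (s.arr a) i k) }

/-- `Runs c s s' t`: started in state `s`, the program `c` halts in state `s'`
after exactly `t` steps. -/
inductive Runs : Program → State → State → ℕ → Prop
  | skip (s : State) : Runs .skip s s 1
  | set (s : State) (r : ℕ) (e : Expr) :
      Runs (.set r e) s (s.setReg r (e.eval s)) (e.cost + 1)
  | write (s : State) (a : ℕ) (i e : Expr) :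
      Runs (.write a i e) s (s.setArr a (i.eval s) (e.eval s)) (i.cost + e.cost + 1)
  | seq {c d : Program} {s s' s'' : State} {t t' : ℕ} :
      Runs c s s' t → Runs d s' s'' t' → Runs (.seq c d) s s'' (t + t')
  | iteTrue {e : Expr} {c d : Program} {s s' : State} {t : ℕ} :
      e.eval s ≠ 0 → Runs c s s' t → Runs (.ite e c d) s s' (e.cost + 1 + t)
  | iteFalse {e : Expr} {c d : Program} {s s' : State} {t : ℕ} :
      e.eval s = 0 → Runs d s s' t → Runs (.ite e c d) s s' (e.cost + 1 + t)
  | loopDone {e : Expr} {c : Program} {s : State} :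
      e.eval s = 0 → Runs (.loop e c) s s (e.cost + 1)
  | loopStep {e : Expr} {c : Program} {s s' s'' : State} {t t' : ℕ} :
      e.eval s ≠ 0 → Runs c s s' t → Runs (.loop e c) s' s'' t' →
        Runs (.loop e c) s s'' (e.cost + 1 + t + t')

/-- `adj` lists, in an arbitrary order and without repetition, the neighbours of each vertex. -/
def IsAdjacencyLists {n : ℕ} (G : SimpleGraph (Fin n)) (adj : Fin n → List (Fin n)) : Prop :=
  ∀ v, (adj v).Nodup ∧ ∀ w, w ∈ adj v ↔ G.Adj v w

/-- The input of a graph given by adjacency lists. Register `0` holds the number `n` of vertices,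
array `1` holds the concatenation of the lists of the vertices `0, …, n - 1`, and the list of `v`
occupies the cells from `arr 0 v` up to, and not including, `arr 0 (v + 1)` of array `1`.
Everything else is zero. -/
def inputState {n : ℕ} (adj : Fin n → List (Fin n)) : State where
  reg r := if r = 0 then n else 0
  arr a i :=
    if a = 0 then (if i ≤ n then ((List.ofFn adj).take i).flatten.length else 0)
    else if a = 1 then ((((List.ofFn adj).flatten)[i]?).map Fin.val).getD 0
    else 0

/-- Register `r` holds the length, and array `a` the entries, of a list of vertices. -/
def HoldsList {n : ℕ} (s : State) (r a : ℕ) (P : List (Fin n)) : Prop :=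
  s.reg r = P.length ∧ ∀ (i : ℕ) (h : i < P.length), s.arr a i = (P[i] : ℕ)

/-- Register `2` and array `3` hold the ordering of `X`, register `3` and array `4` that of `Y`. -/
def HoldsOrdering {n : ℕ} {G : SimpleGraph (Fin n)} (s : State) (O : PathEcc.Ordering G) : Prop :=
  HoldsList s 2 3 (List.ofFn O.x) ∧ HoldsList s 3 4 (List.ofFn O.y)

/-- Register `4` holds the number of blocks. For each vertex `v`, cell `v` of array `5` holds the
number `i` (counted from `0`) of the block `(K_i, J_i)` with `v ∈ K_i ∪ J_i`, and cell `v` of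
array `6` is `0` if `v ∈ K_i`, and `1` if `v ∈ J_i`. -/
def HoldsBlocks {n : ℕ} (s : State) (L : List (PathEcc.Block (Fin n))) : Prop :=
  s.reg 4 = L.length ∧ ∀ (i : ℕ) (h : i < L.length) (v : Fin n),
    (v ∈ L[i].K ↔ s.arr 5 v = i ∧ s.arr 6 v = 0) ∧
    (v ∈ L[i].J ↔ s.arr 5 v = i ∧ s.arr 6 v = 1)

end RAM

/-! Existence of a strong ordering. Orient each edge of an inversion graph from left to right. Two
consecutive oriented edges compose to a third inversion, that is, to a triangle; so in a bipartite
graph every non-isolated vertex is a source or a sink. Within either class the permutation is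
increasing, and the order of the positions is strong (`exists_isStrongKey`).

Correctness. In a strong ordering of a graph without isolated vertices, neighbourhoods are intervals
and last neighbours move monotonically. Hence what remains after some blocks is a pair of final
intervals, every `K` is a pair of intervals inducing a complete bipartite graph, and `J` follows `K`
directly and meets only one part (`IsBlock.adj`, `IsBlock.j_part`). A path through `K` that ends in
its last vertex of `X` dominates the block if `J` misses `X` (`dominates_of_endX`). An `XY`-edge to
the next block exists exactly if the last vertex of `K` in `X` is adjacent to the first vertex of
the next block in `Y`, and then `J` misses `X`. Without such an edge, connectivity gives the same
with the parts exchanged (`linkedXY_iff`, `exists_link`). So the pieces join to one path that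
dominates everything (`DomPathLoop.exists_path`), whence the bound on `pe`.

Running time. The difficulty is to find a strong ordering from the adjacency lists. Suppose that `u`
is the first vertex of its part in some strong numbering. Then the breadth-first levels from `u` are
monotone in each part, and so are both ends of the neighbourhoods. Their sum `levelKey` is therefore
monotone in each part, and equal only for vertices with the same neighbours. Sorting by it, with the
parity of the level as colour, is strong again (`isStrongKey_levelKey`), although the numbering it
was compared with is never computed. A suitable `u` is any vertex of minimal degree in the last
level of an arbitrary breadth-first search (`IsLevels.exists_first`): its part can be reversed and
`u` exchanged with a twin so that it comes first. The keys follow from level sizes and from the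
numbers of neighbours in the two adjacent levels, and are at most twice the number of vertices, so
counting sort applies. After that the blocks come from one scan along a table of last neighbours.

Programs are verified with `Ends`, a total-correctness triple with a time bound; the loops that are
not plain counters are paid for by a potential (`Ends.loop`). -/

namespace PathEcc

/-- A colouring `c` and a numbering `f` (constant values allowed) satisfying the defining condition
of a strong ordering. -/
structure IsStrongKey {V : Type*} (G : SimpleGraph V) (c : V → Bool) (f : V → ℕ) : Prop where
  ne : ∀ ⦃u v⦄, G.Adj u v → c u ≠ c v
  strong : ∀ ⦃u u' w w'⦄, c u = c u' → c w = c w' → f u ≤ f u' → f w ≤ f w' →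
    G.Adj u w' → G.Adj u' w → G.Adj u w ∧ G.Adj u' w'

theorem bool_eq_of_ne {a b d : Bool} (h : a ≠ d) (h' : b ≠ d) : a = b := by
  cases a <;> cases b <;> cases d <;> simp_all

/-! ### Strong numberings. -/

section Keys

variable {V : Type*} {G : SimpleGraph V} {c : V → Bool} {f : V → ℕ}

/-- Some neighbour `z` of `x` comes before or after `y`. Accordingly the edge `xz` crosses `by` or
`ay`, and the crossing forces `xy`. Without a neighbour of `x` the claim fails. -/
theorem IsStrongKey.adj_of_between (h : IsStrongKey G c f) {a x b y : V}
    (hx : ∃ z, G.Adj x z) (hax : c a = c x) (hxb : c x = c b) (h1 : f a ≤ f x) (h2 : f x ≤ f b)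
    (ha : G.Adj a y) (hb : G.Adj b y) : G.Adj x y := by
  obtain ⟨z, hz⟩ := hx
  have hzy : c z = c y :=
    bool_eq_of_ne (d := c x) (h.ne hz).symm (hxb ▸ (h.ne hb).symm)
  rcases le_total (f z) (f y) with hle | hle
  · exact (h.strong hax hzy h1 hle ha hz).2
  · exact (h.strong hxb hzy.symm h2 hle hz hb).1

theorem IsStrongKey.reverse (h : IsStrongKey G c f) {M : ℕ} (hM : ∀ v, f v ≤ M) :
    IsStrongKey G c (fun v => M - f v) where
  ne := h.ne
  strong u u' w w' hc hc' hu hw h1 h2 := by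
    have := hM u; have := hM u'; have := hM w; have := hM w'
    exact (h.strong hc.symm hc'.symm (by omega) (by omega) h2 h1).symm

/-- Two vertices with the same neighbours may be exchanged. -/
theorem IsStrongKey.swap [DecidableEq V] (h : IsStrongKey G c f) {a b : V} (hc : c a = c b)
    (hab : ∀ w, G.Adj a w ↔ G.Adj b w) : IsStrongKey G c (fun v => f (Equiv.swap a b v)) := by
  have hadj : ∀ u v, G.Adj (Equiv.swap a b u) v ↔ G.Adj u v := by
    intro u v
    by_cases hua : u = a
    · subst hua; simp [hab]
    by_cases hub : u = b
    · subst hub; simp [hab]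
    rw [Equiv.swap_apply_of_ne_of_ne hua hub]
  have hcol : ∀ u, c (Equiv.swap a b u) = c u := by
    intro u
    by_cases hua : u = a
    · subst hua; simp [hc]
    by_cases hub : u = b
    · subst hub; simp [hc]
    rw [Equiv.swap_apply_of_ne_of_ne hua hub]
  have hadj2 : ∀ u v, G.Adj (Equiv.swap a b u) (Equiv.swap a b v) ↔ G.Adj u v := by
    intro u v
    rw [hadj, G.adj_comm, hadj, G.adj_comm]
  refine ⟨h.ne, fun u u' w w' h1 h2 h3 h4 h5 h6 => ?_⟩
  have := h.strong (u := Equiv.swap a b u) (u' := Equiv.swap a b u') (w := Equiv.swap a b w)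
    (w' := Equiv.swap a b w') (by simpa [hcol] using h1) (by simpa [hcol] using h2) h3 h4
    ((hadj2 _ _).2 h5) ((hadj2 _ _).2 h6)
  simpa [hadj2] using this

/-- A bipartite permutation graph without isolated vertices has an injective strong numbering. -/
theorem exists_isStrongKey (hG : IsBipartitePermutationGraph G) (hN : ∀ v, ∃ w, G.Adj v w) :
    ∃ (c : V → Bool) (f : V → ℕ), IsStrongKey G c f ∧ Function.Injective f := by
  classical
  obtain ⟨⟨col⟩, n, e, σ, hadj⟩ := hG
  have htri : ∀ u v w, G.Adj u v → G.Adj v w → ¬ G.Adj u w := by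
    intro u v w h1 h2 h3
    have a1 := col.valid h1
    have a2 := col.valid h2
    have a3 := col.valid h3
    omega
  -- Inversions compose: `u`, `v`, `w` from left to right would form a triangle.
  have hno : ∀ u v w, G.Adj u v → G.Adj v w → e u < e v → e v < e w → False := by
    intro u v w h1 h2 h3 h4
    refine htri u v w h1 h2 ?_
    rw [hadj] at h1 h2 ⊢
    rcases h1 with h1 | h1
    · rcases h2 with h2 | h2
      · exact Or.inl ⟨h3.trans h4, h2.2.trans h1.2⟩
      · exact absurd h2.1 (not_lt.2 h4.le)
    · exact absurd h1.1 (not_lt.2 h3.le)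
  have hlt : ∀ u v, G.Adj u v → e u < e v ∨ e v < e u := fun u v h => by
    rw [hadj] at h; tauto
  -- The colour records whether `v` is a source. The given colouring `col` does not serve, because
  -- it may be flipped on single components and then need not agree with the orientation.
  let c : V → Bool := fun v => decide (∃ w, G.Adj v w ∧ e v < e w)
  have hc : ∀ v, c v = true ↔ ∃ w, G.Adj v w ∧ e v < e w := fun v => by simp [c]
  have hc' : ∀ v, c v = false → ∃ w, G.Adj v w ∧ e w < e v := by
    intro v hv
    obtain ⟨w, hw⟩ := hN v
    rcases hlt v w hw with h | h
    · exact absurd ((hc v).2 ⟨w, hw, h⟩) (by simp [hv])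
    · exact ⟨w, hw, h⟩
  have hct : ∀ u v, G.Adj u v → e u < e v → c u = true ∧ c v = false := by
    intro u v h hl
    refine ⟨(hc u).2 ⟨v, h, hl⟩, ?_⟩
    by_contra hcv
    obtain ⟨w, hw, hl'⟩ := (hc v).1 (by simpa using hcv)
    exact hno u v w h hw hl hl'
  have hne : ∀ u v, G.Adj u v → c u ≠ c v := by
    intro u v h
    rcases hlt u v h with hl | hl
    · have := hct u v h hl; simp [this.1, this.2]
    · have := hct v u h.symm hl; simp [this.1, this.2]
  have hedge : ∀ u v, c u = true → c v = false → (G.Adj u v ↔ e u < e v ∧ σ (e v) < σ (e u)) := by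
    intro u v hu hv
    refine ⟨fun h => ?_, fun h => (hadj u v).2 (Or.inl h)⟩
    rcases (hadj u v).1 h with h' | h'
    · exact h'
    · have := hct v u h.symm h'.1
      simp [hu] at this
  -- Vertices of the same colour are not adjacent, hence not inverted.
  have hmono : ∀ u v, c u = c v → e u ≤ e v → σ (e u) ≤ σ (e v) := by
    intro u v h hl
    by_contra! hlt'
    have : e u < e v := lt_of_le_of_ne hl (by rintro h; simp [h] at hlt')
    exact hne u v ((hadj u v).2 (Or.inl ⟨this, hlt'⟩)) h
  refine ⟨c, fun v => e v, ⟨fun u v h => hne u v h, ?_⟩, fun u v h => e.injective (Fin.ext h)⟩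
  intro u u' w w' h1 h2 h3 h4 h5 h6
  have h3' : e u ≤ e u' := h3
  have h4' : e w ≤ e w' := h4
  have hs := hmono u u' h1 h3'
  have hs' := hmono w w' h2 h4'
  rcases hcu : c u with _ | _
  · have hw' : c w' = true := by
      have := hne u w' h5
      rw [hcu] at this
      simpa using this.symm
    have hw : c w = true := h2 ▸ hw'
    have hu' : c u' = false := h1 ▸ hcu
    have e5 := (hedge w' u hw' hcu).1 h5.symm
    have e6 := (hedge w u' hw hu').1 h6.symm
    refine ⟨((hedge w u hw hcu).2 ⟨h4'.trans_lt e5.1, ?_⟩).symm,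
      ((hedge w' u' hw' hu').2 ⟨e5.1.trans_le h3', ?_⟩).symm⟩
    · exact hs.trans_lt e6.2
    · exact e6.2.trans_le hs'
  · have hw' : c w' = false := by
      have := hne u w' h5
      rw [hcu] at this
      simpa using this.symm
    have hw : c w = false := h2 ▸ hw'
    have hu' : c u' = true := h1 ▸ hcu
    have e5 := (hedge u w' hcu hw').1 h5
    have e6 := (hedge u' w hu' hw).1 h6
    refine ⟨(hedge u w hcu hw).2 ⟨h3'.trans_lt e6.1, ?_⟩,
      (hedge u' w' hu' hw').2 ⟨e6.1.trans_le h4', ?_⟩⟩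
    · exact hs'.trans_lt e5.2
    · exact e5.2.trans_le hs

/-! ### Orderings from lists -/

/-- The bipartition given by a colouring, both parts being ordered by a list of all vertices. -/
def Ordering.ofList (l : List V) (hl : l.Nodup) (hmem : ∀ v, v ∈ l) (c : V → Bool)
    (hc : ∀ u v, G.Adj u v → c u ≠ c v) : Ordering G where
  p := (l.filter c).length
  q := (l.filter (fun v => !c v)).length
  x := (l.filter c).get
  y := (l.filter (fun v => !c v)).get
  bij := by
    constructor
    · refine (List.nodup_iff_injective_get.1 (hl.filter _)).sumElim
        (List.nodup_iff_injective_get.1 (hl.filter _)) fun i j h => ?_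
      have h1 := (List.mem_filter.1 (List.get_mem (l.filter c) i)).2
      have h2 := (List.mem_filter.1 (List.get_mem (l.filter (fun v => !c v)) j)).2
      rw [h] at h1
      simp_all
    · intro v
      rcases h : c v with _ | _
      · obtain ⟨j, hj⟩ := List.get_of_mem (List.mem_filter.2 ⟨hmem v, by simpa using h⟩ :
          v ∈ l.filter (fun v => !c v))
        exact ⟨.inr j, hj⟩
      · obtain ⟨j, hj⟩ := List.get_of_mem (List.mem_filter.2 ⟨hmem v, h⟩ : v ∈ l.filter c)
        exact ⟨.inl j, hj⟩
  not_adj_x i k h := by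
    have h1 := (List.mem_filter.1 (List.get_mem (l.filter c) i)).2
    have h2 := (List.mem_filter.1 (List.get_mem (l.filter c) k)).2
    exact hc _ _ h (h1.trans h2.symm)
  not_adj_y i k h := by
    have h1 := (List.mem_filter.1 (List.get_mem (l.filter (fun v => !c v)) i)).2
    have h2 := (List.mem_filter.1 (List.get_mem (l.filter (fun v => !c v)) k)).2
    refine hc _ _ h ?_
    simp_all

/-- A strong key satisfies the crossing condition for weak inequalities, so ties may be broken
arbitrarily. -/
theorem Ordering.ofList_isStrong (l : List V) (hl : l.Nodup) (hmem : ∀ v, v ∈ l)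
    (h : IsStrongKey G c f) (hs : l.Pairwise (fun u v => f u ≤ f v)) :
    (Ordering.ofList l hl hmem c (fun u v => @IsStrongKey.ne V G c f h u v)).IsStrong := by
  intro i k a b hik hab h1 h2
  have hmono : ∀ (d : V → Bool) (i k : Fin (l.filter d).length), i ≤ k →
      f ((l.filter d).get i) ≤ f ((l.filter d).get k) := by
    intro d i k hik
    rcases hik.eq_or_lt with rfl | hlt
    · exact le_rfl
    · exact List.pairwise_iff_get.1 (hs.filter d) i k hlt
  have hx : ∀ i k : Fin (l.filter c).length,
      c ((l.filter c).get i) = c ((l.filter c).get k) := fun i k =>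
    ((List.mem_filter.1 (List.get_mem (l.filter c) i)).2).trans
      ((List.mem_filter.1 (List.get_mem (l.filter c) k)).2).symm
  have hy : ∀ i k : Fin (l.filter (fun v => !c v)).length,
      c ((l.filter (fun v => !c v)).get i) = c ((l.filter (fun v => !c v)).get k) := by
    intro i k
    have h1 := (List.mem_filter.1 (List.get_mem (l.filter (fun v => !c v)) i)).2
    have h2 := (List.mem_filter.1 (List.get_mem (l.filter (fun v => !c v)) k)).2
    simp_all
  exact h.strong (hx i k) (hy a b) (hmono _ _ _ hik) (hmono _ _ _ hab) h1 h2

theorem exists_isStrong [Finite V] (hG : IsBipartitePermutationGraph G)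
    (hN : ∀ v, ∃ w, G.Adj v w) : ∃ O : Ordering G, O.IsStrong := by
  classical
  have := Fintype.ofFinite V
  obtain ⟨c, f, h, -⟩ := exists_isStrongKey hG hN
  let l := (Finset.univ : Finset V).toList.insertionSort (fun u v => f u ≤ f v)
  have hp : l.Perm (Finset.univ : Finset V).toList := List.perm_insertionSort _ _
  have : Std.Total (fun u v : V => f u ≤ f v) := ⟨fun u v => le_total _ _⟩
  have : IsTrans V (fun u v : V => f u ≤ f v) := ⟨fun _ _ _ => le_trans⟩
  exact ⟨_, Ordering.ofList_isStrong l (hp.nodup_iff.2 (Finset.nodup_toList _))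
    (fun v => hp.mem_iff.2 (by simp)) h (List.pairwise_insertionSort _ _)⟩

/-! ### Breadth-first levels -/

/-- `lev v` is the distance of `v` from `u`. -/
structure IsLevels (G : SimpleGraph V) (u : V) (lev : V → ℕ) : Prop where
  root : lev u = 0
  eq_root : ∀ ⦃v⦄, lev v = 0 → v = u
  step : ∀ ⦃v w⦄, G.Adj v w → lev w ≤ lev v + 1
  parent : ∀ ⦃v⦄, lev v ≠ 0 → ∃ w, G.Adj v w ∧ lev v = lev w + 1

variable {u : V} {lev : V → ℕ}

theorem IsLevels.parity (hl : IsLevels G u lev) (hc : ∀ ⦃u v⦄, G.Adj u v → c u ≠ c v) (v : V) :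
    c v = c u ↔ lev v % 2 = 0 := by
  induction h : lev v using Nat.strong_induction_on generalizing v with
  | _ k ih =>
    by_cases h0 : lev v = 0
    · simp [hl.eq_root h0, ← h, hl.root]
    · obtain ⟨w, hw, hlw⟩ := hl.parent h0
      have ih' := ih (lev w) (by omega) w rfl
      have hne := hc hw
      have hiff : c v = c u ↔ ¬ c w = c u :=
        ⟨fun h h' => hne (h.trans h'.symm), fun h => bool_eq_of_ne hne (Ne.symm h)⟩
      rw [hiff, ih']
      omega

theorem IsLevels.color_eq_iff (hl : IsLevels G u lev) (hc : ∀ ⦃u v⦄, G.Adj u v → c u ≠ c v)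
    (v w : V) : c v = c w ↔ lev v % 2 = lev w % 2 := by
  have hiff : c v = c w ↔ (c v = c u ↔ c w = c u) := by
    cases c v <;> cases c w <;> cases c u <;> decide
  rw [hiff, hl.parity hc v, hl.parity hc w]
  omega

theorem IsLevels.adj (hl : IsLevels G u lev) (hc : ∀ ⦃u v⦄, G.Adj u v → c u ≠ c v) {v w : V}
    (h : G.Adj v w) : lev w = lev v + 1 ∨ lev v = lev w + 1 := by
  have h1 := hl.step h
  have h2 := hl.step h.symm
  have h3 := hc h
  rw [Ne, hl.color_eq_iff hc] at h3
  omega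

/-- If the root is the first vertex of its part, then the levels are monotone. -/
theorem IsLevels.mono (hl : IsLevels G u lev) (h : IsStrongKey G c f) (hf : Function.Injective f)
    (hN : ∀ v, ∃ w, G.Adj v w) (hu : ∀ v, c v = c u → f u ≤ f v) {x x' : V}
    (hc : c x = c x') (hx : f x ≤ f x') : lev x ≤ lev x' := by
  induction hk : lev x' using Nat.strong_induction_on generalizing x x' with
  | _ k ih =>
    subst hk
    by_cases h0 : lev x' = 0
    · have := hl.eq_root h0
      subst this
      rw [hf (le_antisymm hx (hu x hc))]
    obtain ⟨z, hz, hlz⟩ := hl.parent h0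
    -- An edge to the parent `z` of `x'` bounds the level of `x`. If the parent `w` of `z` comes
    -- after `x`, induction applies; otherwise `x` lies between the neighbours `w` and `x'` of `z`.
    suffices G.Adj x z ∨ lev x ≤ lev x' by
      rcases this with h1 | h1
      · have := hl.step h1.symm; omega
      · exact h1
    by_cases h1 : lev z = 0
    · have := hl.eq_root h1
      subst this
      obtain ⟨t, ht⟩ := hN x
      have hct : c z = c t :=
        bool_eq_of_ne (d := c x) (hc ▸ (h.ne hz).symm) (h.ne ht).symm
      exact Or.inl (h.strong hc hct hx (hu t hct.symm) ht hz).1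
    · obtain ⟨w, hw, hlw⟩ := hl.parent h1
      have hcw : c w = c x' := bool_eq_of_ne (h.ne hw).symm (h.ne hz)
      rcases le_total (f x) (f w) with h2 | h2
      · exact Or.inr ((ih (lev w) (by omega) (hc.trans hcw.symm) h2 rfl).trans (by omega))
      · exact Or.inl (h.adj_of_between (hN x) (hcw.trans hc.symm) hc h2 hx hw.symm hz)

/-- If the root is the first vertex of its part, then levels and neighbourhoods are monotone. -/
theorem IsLevels.not_adj_mono (hl : IsLevels G u lev) (h : IsStrongKey G c f)
    (hf : Function.Injective f) (hN : ∀ v, ∃ w, G.Adj v w) (hu : ∀ v, c v = c u → f u ≤ f v)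
    {x x' : V} (hc : c x = c x') (hx : f x ≤ f x') {v : V} (hv : lev v < lev x)
    (hvx : ¬ G.Adj x v) : lev v < lev x' ∧ ¬ G.Adj x' v := by
  have hle := hl.mono h hf hN hu hc hx
  refine ⟨by omega, fun hadj => hvx ?_⟩
  have h1 := hl.adj h.ne hadj
  have heq : lev x = lev x' := by
    have := (hl.color_eq_iff h.ne x x').1 hc
    omega
  obtain ⟨z, hz, hlz⟩ := hl.parent (v := x) (by omega)
  have hzv : c z = c v := bool_eq_of_ne (d := c x) (h.ne hz).symm (hc ▸ (h.ne hadj).symm)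
  rcases le_total (f v) (f z) with h2 | h2
  · exact (h.strong hc hzv.symm hx h2 hz hadj).1
  · by_cases h0 : lev v = 0
    · have hv0 := hl.eq_root h0
      have hz0 := hl.eq_root (v := z) (by omega)
      rw [hv0, ← hz0]; exact hz
    -- The parent `t` of `v` is two levels nearer to the root than `x`, hence before `x`. So `tv`
    -- and `xz` cross and force `xv`.
    · obtain ⟨t, ht, hlt⟩ := hl.parent h0
      have htx : c t = c x := bool_eq_of_ne (h.ne ht).symm (hc ▸ h.ne hadj)
      have htx' : f t ≤ f x := by
        by_contra! hcon
        have := hl.mono h hf hN hu htx.symm hcon.le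
        omega
      exact (h.strong htx hzv htx' h2 ht.symm hz).2

/-- This is the counterpart of `not_adj_mono` for the far end of the neighbourhood. A counterexample
`v` is one level further from the root than both `x` and `x'`; a parent `z` of `x'` then precedes
`v`, and the edges `xv`, `x'z` force `x'v`. -/
theorem IsLevels.adj_mono (hl : IsLevels G u lev) (h : IsStrongKey G c f)
    (hf : Function.Injective f) (hN : ∀ v, ∃ w, G.Adj v w) (hu : ∀ v, c v = c u → f u ≤ f v)
    {x x' : V} (hc : c x = c x') (hx : f x ≤ f x') {v : V} (hv : lev v ≤ lev x ∨ G.Adj x v) :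
    lev v ≤ lev x' ∨ G.Adj x' v := by
  have hle := hl.mono h hf hN hu hc hx
  rcases hv with hv | hv
  · exact Or.inl (by omega)
  by_contra! hcon
  have h1 := hl.adj h.ne hv
  have heq : lev x = lev x' := by omega
  by_cases h0 : lev x' = 0
  · rw [hl.eq_root h0, ← hl.eq_root (heq.trans h0)] at hcon
    exact hcon.2 hv
  · obtain ⟨z, hz, hlz⟩ := hl.parent h0
    have hzv : c z = c v := bool_eq_of_ne (d := c x) (hc ▸ (h.ne hz).symm) (h.ne hv).symm
    have hzv' : f z ≤ f v := by
      by_contra! hcon'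
      have := hl.mono h hf hN hu hzv.symm hcon'.le
      omega
    exact hcon.2 (h.strong hc hzv hx hzv' hv hz).2

end Keys

/-! ### The sorting key. -/

section LevelKey

variable {V : Type*} [Fintype V] {G : SimpleGraph V} {c : V → Bool} {f : V → ℕ} {u : V}
  {lev : V → ℕ}

open Classical in
/-- The sum of the two ends of the neighbourhood of `x` with respect to the levels. -/
noncomputable def levelKey (G : SimpleGraph V) (lev : V → ℕ) (x : V) : ℕ :=
  (Finset.univ.filter fun v => lev v < lev x ∧ ¬ G.Adj x v).card +
    (Finset.univ.filter fun v => lev v ≤ lev x ∨ G.Adj x v).card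

-- Both sets counted by `levelKey` grow with `x`, so equal sums mean equal sets. These determine the
-- level and, on the two adjacent levels, the neighbourhood.
open Classical in
theorem IsLevels.levelKey_mono (hl : IsLevels G u lev) (h : IsStrongKey G c f)
    (hf : Function.Injective f) (hN : ∀ v, ∃ w, G.Adj v w) (hu : ∀ v, c v = c u → f u ≤ f v)
    {x x' : V} (hc : c x = c x') (hx : f x ≤ f x') :
    levelKey G lev x ≤ levelKey G lev x' ∧
      (levelKey G lev x = levelKey G lev x' → ∀ v, G.Adj x v ↔ G.Adj x' v) := by
  have hA : (Finset.univ.filter fun v => lev v < lev x ∧ ¬ G.Adj x v) ⊆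
      Finset.univ.filter fun v => lev v < lev x' ∧ ¬ G.Adj x' v := by
    intro v
    simp only [Finset.mem_filter, Finset.mem_univ, true_and]
    exact fun hv => hl.not_adj_mono h hf hN hu hc hx hv.1 hv.2
  have hB : (Finset.univ.filter fun v => lev v ≤ lev x ∨ G.Adj x v) ⊆
      Finset.univ.filter fun v => lev v ≤ lev x' ∨ G.Adj x' v := by
    intro v
    simp only [Finset.mem_filter, Finset.mem_univ, true_and]
    exact fun hv => hl.adj_mono h hf hN hu hc hx hv
  have hA' := Finset.card_le_card hA
  have hB' := Finset.card_le_card hB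
  refine ⟨add_le_add hA' hB', fun heq v => ?_⟩
  unfold levelKey at heq
  have hA2 := Finset.eq_of_subset_of_card_le hA (by omega)
  have hB2 := Finset.eq_of_subset_of_card_le hB (by omega)
  simp only [Finset.ext_iff, Finset.mem_filter, Finset.mem_univ, true_and] at hA2 hB2
  have hle := hl.mono h hf hN hu hc hx
  have hle' : lev x' ≤ lev x := by
    rcases (hB2 x').2 (Or.inl le_rfl) with h1 | h1
    · exact h1
    · exact absurd hc (h.ne h1)
  have heq : lev x = lev x' := le_antisymm hle hle'
  have h1 := hA2 v
  have h2 := hB2 v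
  rw [← heq] at h1 h2
  by_cases h3 : lev v < lev x
  · simpa [h3, not_iff_not] using h1
  by_cases h4 : lev v = lev x
  · have a1 : ¬ G.Adj x v := fun hh => by have := hl.adj h.ne hh; omega
    have a2 : ¬ G.Adj x' v := fun hh => by have := hl.adj h.ne hh; omega
    simp [a1, a2]
  · have h5 : ¬ lev v ≤ lev x := by omega
    simpa [h5] using h2

/-- Sorting by `levelKey` gives a strong ordering if the root can be made the first vertex. -/
theorem IsLevels.isStrongKey_levelKey (hl : IsLevels G u lev) (h : IsStrongKey G c f)
    (hf : Function.Injective f) (hN : ∀ v, ∃ w, G.Adj v w) (hu : ∀ v, c v = c u → f u ≤ f v) :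
    IsStrongKey G (fun v => decide (lev v % 2 = 0)) (levelKey G lev) := by
  have hcol : ∀ v w, decide (lev v % 2 = 0) = decide (lev w % 2 = 0) ↔ c v = c w := by
    intro v w
    rw [hl.color_eq_iff h.ne, decide_eq_decide]
    omega
  -- The new key can disagree with `f` only on vertices with the same neighbours, which are
  -- interchangeable in every edge.
  have key : ∀ x x', c x = c x' → levelKey G lev x ≤ levelKey G lev x' →
      f x ≤ f x' ∨ ∀ v, G.Adj x v ↔ G.Adj x' v := by
    intro x x' hc hk
    rcases le_total (f x) (f x') with h1 | h1
    · exact Or.inl h1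
    · have := hl.levelKey_mono h hf hN hu hc.symm h1
      exact Or.inr fun v => (this.2 (le_antisymm this.1 hk) v).symm
  refine ⟨fun v w hvw => (not_congr (hcol v w)).2 (h.ne hvw), ?_⟩
  intro x x' y y' hx hy hkx hky h1 h2
  simp only [hcol] at hx hy
  rcases key x x' hx hkx with h3 | h3
  · rcases key y y' hy hky with h4 | h4
    · exact h.strong hx hy h3 h4 h1 h2
    · exact ⟨((h4 x).2 h1.symm).symm, ((h4 x').1 h2.symm).symm⟩
  · exact ⟨(h3 y).2 h2, (h3 y').1 h1⟩

end LevelKey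

/-! ### End vertices -/

section EndVertex

variable {V : Type*} {G : SimpleGraph V} {c : V → Bool} {f : V → ℕ} {s u : V} {lev : V → ℕ}

/-- The vertices of levels less than `lev u - 1` in the part of `u` lie on the same side of `u`. -/
theorem IsLevels.not_between (hl : IsLevels G s lev) (h : IsStrongKey G c f)
    (hf : Function.Injective f) (hN : ∀ v, ∃ w, G.Adj v w) {v w : V} (hv : c v = c u) (hw : c u = c w)
    (hlv : lev v + 2 ≤ lev u) (hlw : lev w + 2 ≤ lev u) : ¬ (f v ≤ f u ∧ f u ≤ f w) := by
  induction hk : lev v + lev w using Nat.strong_induction_on generalizing v w with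
  | _ k ih =>
    rintro ⟨h1, h2⟩
    have hstep : ∀ z, G.Adj u z → lev u ≤ lev z + 1 := fun z hz => hl.step hz.symm
    -- Move `v` two levels towards the root, to `b`. If this crossed `u`, then `u` would lie between
    -- two neighbours of the intermediate vertex `a` and be adjacent to it, which is too near to the
    -- root.
    by_cases h3 : 2 ≤ lev v
    · obtain ⟨a, ha, hla⟩ := hl.parent (v := v) (by omega)
      obtain ⟨b, hb, hlb⟩ := hl.parent (v := a) (by omega)
      have hcb : c b = c u := hv ▸ bool_eq_of_ne (h.ne hb).symm (h.ne ha)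
      rcases le_total (f b) (f u) with h4 | h4
      · exact ih (lev b + lev w) (by omega) hcb hw (by omega) hlw rfl ⟨h4, h2⟩
      · have := hstep a (h.adj_of_between (hN u) hv hcb.symm h1 h4 ha hb.symm)
        omega
    by_cases h3' : 2 ≤ lev w
    · obtain ⟨a, ha, hla⟩ := hl.parent (v := w) (by omega)
      obtain ⟨b, hb, hlb⟩ := hl.parent (v := a) (by omega)
      have hcb : c u = c b := hw ▸ bool_eq_of_ne (h.ne ha) (h.ne hb).symm
      rcases le_total (f u) (f b) with h4 | h4
      · exact ih (lev v + lev b) (by omega) hv hcb hlv (by omega) rfl ⟨h1, h4⟩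
      · have := hstep a (h.adj_of_between (hN u) hcb.symm hw h4 h2 hb.symm ha)
        omega
    -- Now both levels are at most one and of equal parity: either both vertices are the root, or
    -- both are adjacent to it.
    have hpar := (hl.color_eq_iff h.ne v w).1 (hv.trans hw)
    by_cases h4 : lev v = 0
    · have hvs := hl.eq_root h4
      have hws := hl.eq_root (v := w) (by omega)
      have : u = s := hf (le_antisymm (hws ▸ h2) (hvs ▸ h1))
      have := hl.root
      subst u
      omega
    · obtain ⟨a, ha, hla⟩ := hl.parent h4
      obtain ⟨b, hb, hlb⟩ := hl.parent (v := w) (by omega)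
      have ha0 := hl.eq_root (v := a) (by omega)
      have hb0 := hl.eq_root (v := b) (by omega)
      have := hstep a (h.adj_of_between (hN u) hv hw h1 h2 ha (ha0 ▸ hb0 ▸ hb))
      omega

/-- When the vertices of the part nearer to the root lie to the right of `u`, the vertex `m` on its
left belongs to the last level. A neighbour `y` of `m` has a parent `a` to the right of `u`, so `u`
lies between two neighbours of `y`. Thus all neighbours of `m` are neighbours of `u`, and minimality
gives equality. If `lev u = 1`, the root is the only possible neighbour. -/
theorem IsLevels.twin_of_left (hl : IsLevels G s lev) (h : IsStrongKey G c f)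
    (hf : Function.Injective f) (hN : ∀ v, ∃ w, G.Adj v w) (hmax : ∀ v, lev v ≤ lev u)
    (hmin : ∀ v, lev v = lev u → (∀ w, G.Adj v w → G.Adj u w) → ∀ w, G.Adj u w → G.Adj v w)
    (hu : lev u = 1 ∨ ∃ w, c u = c w ∧ lev w + 2 ≤ lev u ∧ f u ≤ f w) {m : V} (hcm : c m = c u)
    (hm : f m ≤ f u) (w : V) : G.Adj u w ↔ G.Adj m w := by
  have hpar := (hl.color_eq_iff h.ne m u).1 hcm
  have hlm : lev m = lev u := by
    by_contra hne
    have := hmax m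
    rcases hu with hu | ⟨t, hct, hlt, hft⟩
    · omega
    · exact hl.not_between h hf hN hcm hct (by omega) hlt ⟨hm, hft⟩
  have hsub : ∀ w, G.Adj m w → G.Adj u w := by
    intro y hy
    have h1 := hl.adj h.ne hy
    have h2 := hmax y
    rcases hu with hu | ⟨t, hct, hlt, hft⟩
    · obtain ⟨z, hz, hlz⟩ := hl.parent (v := u) (by omega)
      rw [hl.eq_root (v := y) (by omega), ← hl.eq_root (v := z) (by omega)]
      exact hz
    · obtain ⟨a, ha, hla⟩ := hl.parent (v := y) (by omega)
      have hca : c a = c u := hcm ▸ bool_eq_of_ne (h.ne ha).symm (h.ne hy)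
      rcases le_total (f a) (f u) with h3 | h3
      · exact absurd ⟨h3, hft⟩ (hl.not_between h hf hN hca hct (by omega) hlt)
      · exact h.adj_of_between (hN u) hcm hca.symm hm h3 hy ha.symm
  exact ⟨hmin m hlm hsub w, hsub w⟩

/-- A vertex of the last level whose neighbourhood is minimal can be made the first vertex of its
part. -/
theorem IsLevels.exists_first [Finite V] (hl : IsLevels G s lev) (h : IsStrongKey G c f)
    (hf : Function.Injective f) (hN : ∀ v, ∃ w, G.Adj v w) (hmax : ∀ v, lev v ≤ lev u)
    (hmin : ∀ v, lev v = lev u → (∀ w, G.Adj v w → G.Adj u w) → ∀ w, G.Adj u w → G.Adj v w) :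
    ∃ g : V → ℕ, IsStrongKey G c g ∧ Function.Injective g ∧ ∀ v, c v = c u → g u ≤ g v := by
  classical
  have hu0 : lev u ≠ 0 := by
    intro h0
    obtain ⟨w, hw⟩ := hN u
    have := hmax w
    exact h.ne hw ((hl.color_eq_iff h.ne _ _).2 (by omega))
  -- By reversing the numbering, one may assume that the vertices nearer to the root lie to the
  -- right of `u`.
  suffices H : ∀ f : V → ℕ, IsStrongKey G c f → Function.Injective f →
      (lev u = 1 ∨ ∃ w, c u = c w ∧ lev w + 2 ≤ lev u ∧ f u ≤ f w) →
      ∃ g : V → ℕ, IsStrongKey G c g ∧ Function.Injective g ∧ ∀ v, c v = c u → g u ≤ g v by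
    by_cases h1 : lev u = 1
    · exact H f h hf (Or.inl h1)
    obtain ⟨z, hz, hlz⟩ := hl.parent hu0
    obtain ⟨w, hw, hlw⟩ := hl.parent (v := z) (by omega)
    have hcw : c u = c w := bool_eq_of_ne (h.ne hz) (h.ne hw).symm
    rcases le_total (f u) (f w) with h2 | h2
    · exact H f h hf (Or.inr ⟨w, hcw, by omega, h2⟩)
    · obtain ⟨M, hM⟩ := (Set.finite_range f).bddAbove
      have hM' : ∀ v, f v ≤ M := fun v => hM ⟨v, rfl⟩
      refine H _ (h.reverse hM') (fun a b hab => hf ?_) (Or.inr ⟨w, hcw, by omega, ?_⟩)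
      · have := hM' a; have := hM' b
        omega
      · omega
  intro f h hf hu
  -- The first vertex `m` of the part is a twin of `u`; exchanging the two puts `u` first.
  obtain ⟨m, hcm, hm⟩ := Set.exists_min_image {v | c v = c u} f (Set.toFinite _) ⟨u, rfl⟩
  have htw := hl.twin_of_left h hf hN hmax hmin hu hcm (hm u rfl)
  refine ⟨_, h.swap hcm.symm htw, hf.comp (Equiv.injective _), fun v hv => ?_⟩
  rw [Equiv.swap_apply_left]
  refine hm _ ?_
  change c _ = _
  by_cases hvu : v = u
  · rw [hvu, Equiv.swap_apply_left, hcm]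
  by_cases hvm : v = m
  · rw [hvm, Equiv.swap_apply_right]
  · rw [Equiv.swap_apply_of_ne_of_ne hvu hvm, hv]

end EndVertex

end PathEcc

namespace PathEcc

/-! ### Blocks as pairs of intervals. -/

namespace Ordering

variable {V : Type*} {G : SimpleGraph V}

/-- The ordering with the two parts exchanged. -/
def swap (O : Ordering G) : Ordering G where
  p := O.q
  q := O.p
  x := O.y
  y := O.x
  bij := by
    have : Sum.elim O.y O.x = Sum.elim O.x O.y ∘ Sum.swap := by
      ext (i | i) <;> rfl
    rw [this]
    exact O.bij.comp (Equiv.sumComm _ _).bijective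
  not_adj_x := O.not_adj_y
  not_adj_y := O.not_adj_x

variable {O : Ordering G}

theorem IsStrong.swap (h : O.IsStrong) : O.swap.IsStrong := fun i k a c hik hac h1 h2 =>
  have := h a c i k hac hik h2.symm h1.symm
  ⟨this.1.symm, this.2.symm⟩

theorem x_injective (O : Ordering G) : Function.Injective O.x := fun i k h => by
  simpa using O.bij.1 (a₁ := .inl i) (a₂ := .inl k) h

theorem y_injective (O : Ordering G) : Function.Injective O.y := O.swap.x_injective

theorem x_ne_y (O : Ordering G) (i : Fin O.p) (j : Fin O.q) : O.x i ≠ O.y j := fun h => by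
  simpa using O.bij.1 (a₁ := .inl i) (a₂ := .inr j) h

theorem cover (O : Ordering G) (v : V) : (∃ i, v = O.x i) ∨ ∃ j, v = O.y j := by
  obtain ⟨i | j, h⟩ := O.bij.2 v
  · exact Or.inl ⟨i, h.symm⟩
  · exact Or.inr ⟨j, h.symm⟩

theorem exists_y_of_adj {i : Fin O.p} {v : V} (h : G.Adj (O.x i) v) : ∃ j, v = O.y j := by
  rcases O.cover v with ⟨k, rfl⟩ | h'
  · exact absurd h (O.not_adj_x _ _)
  · exact h'

theorem exists_x_of_adj {j : Fin O.q} {v : V} (h : G.Adj (O.y j) v) : ∃ i, v = O.x i :=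
  exists_y_of_adj (O := O.swap) h

open Classical in
/-- One plus the index of the last neighbour of `v` in `X`, and `0` if there is none. -/
noncomputable def lastX (O : Ordering G) (v : V) : ℕ :=
  Finset.univ.sup fun i : Fin O.p => if G.Adj (O.x i) v then (i : ℕ) + 1 else 0

/-- One plus the index of the last neighbour of `v` in `Y`, and `0` if there is none. -/
noncomputable def lastY (O : Ordering G) (v : V) : ℕ := O.swap.lastX v

theorem lt_lastX {i : Fin O.p} {v : V} (h : G.Adj (O.x i) v) : (i : ℕ) < O.lastX v := by
  classical
  have := Finset.le_sup (f := fun i : Fin O.p => if G.Adj (O.x i) v then (i : ℕ) + 1 else 0)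
    (Finset.mem_univ i)
  simp only [h, if_true] at this
  exact this

theorem lt_lastY {j : Fin O.q} {v : V} (h : G.Adj (O.y j) v) : (j : ℕ) < O.lastY v :=
  lt_lastX (O := O.swap) h

theorem exists_lastX {v : V} (h : 0 < O.lastX v) :
    ∃ i : Fin O.p, (i : ℕ) + 1 = O.lastX v ∧ G.Adj (O.x i) v := by
  classical
  have hne : (Finset.univ : Finset (Fin O.p)).Nonempty := by
    by_contra hne
    rw [Finset.not_nonempty_iff_eq_empty] at hne
    simp [lastX, hne] at h
  obtain ⟨i, -, hi⟩ := Finset.exists_mem_eq_sup _ hne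
    fun i : Fin O.p => if G.Adj (O.x i) v then (i : ℕ) + 1 else 0
  have hi' : O.lastX v = if G.Adj (O.x i) v then (i : ℕ) + 1 else 0 := hi
  split_ifs at hi' with hadj
  · exact ⟨i, hi'.symm, hadj⟩
  · omega

theorem exists_lastY {v : V} (h : 0 < O.lastY v) :
    ∃ j : Fin O.q, (j : ℕ) + 1 = O.lastY v ∧ G.Adj (O.y j) v := exists_lastX (O := O.swap) h

/-- Neighbourhoods are intervals: a neighbour `x k` of `y j'` lies on one side of `x i`, and its
edge crosses the edge from `x i` to its last neighbour or to `y j`. -/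
theorem IsStrong.adj_of_lt_lastY (h : O.IsStrong) (hN : ∀ v, ∃ w, G.Adj v w) {i : Fin O.p}
    {j j' : Fin O.q} (hadj : G.Adj (O.x i) (O.y j)) (hj : j ≤ j') (hj' : (j' : ℕ) < O.lastY (O.x i)) :
    G.Adj (O.x i) (O.y j') := by
  obtain ⟨l, hl, hal⟩ := exists_lastY (O := O) (v := O.x i) (by omega)
  obtain ⟨w, hw⟩ := hN (O.y j')
  obtain ⟨k, rfl⟩ := exists_x_of_adj hw
  rcases le_total i k with hik | hik
  · exact (h i k j' l hik (Fin.le_def.2 (by omega)) hal.symm hw.symm).1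
  · exact (h k i j j' hik hj hw.symm hadj).2

theorem IsStrong.adj_of_lt_lastX (h : O.IsStrong) (hN : ∀ v, ∃ w, G.Adj v w) {j : Fin O.q}
    {i i' : Fin O.p} (hadj : G.Adj (O.y j) (O.x i)) (hi : i ≤ i') (hi' : (i' : ℕ) < O.lastX (O.y j)) :
    G.Adj (O.y j) (O.x i') :=
  h.swap.adj_of_lt_lastY hN hadj hi hi'

/-- If `x k` has a neighbour before the last neighbour `y l` of `x i`, the two edges cross and `x k`
is adjacent to `y l`. -/
theorem IsStrong.lastY_mono (h : O.IsStrong) (hN : ∀ v, ∃ w, G.Adj v w) {i k : Fin O.p}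
    (hik : i ≤ k) : O.lastY (O.x i) ≤ O.lastY (O.x k) := by
  rcases Nat.eq_zero_or_pos (O.lastY (O.x i)) with h0 | h0
  · omega
  obtain ⟨l, hl, hal⟩ := exists_lastY h0
  obtain ⟨w, hw⟩ := hN (O.x k)
  obtain ⟨j, rfl⟩ := exists_y_of_adj hw
  have hj := lt_lastY hw.symm
  rcases le_total j l with hjl | hjl
  · have := lt_lastY (h i k j l hik hjl hal.symm hw).2.symm
    omega
  · have : (l : ℕ) ≤ j := hjl
    omega

theorem IsStrong.lastX_mono (h : O.IsStrong) (hN : ∀ v, ∃ w, G.Adj v w) {j l : Fin O.q}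
    (hjl : j ≤ l) : O.lastX (O.y j) ≤ O.lastX (O.y l) := h.swap.lastY_mono hN hjl

/-- The vertices of `X` and of `Y` with indices in two intervals. -/
def seg (O : Ordering G) (a a' b b' : ℕ) : Set V :=
  {v | (∃ i : Fin O.p, a ≤ i ∧ (i : ℕ) < a' ∧ v = O.x i) ∨
    ∃ j : Fin O.q, b ≤ j ∧ (j : ℕ) < b' ∧ v = O.y j}

/-- The vertices left when the first `a` of `X` and the first `b` of `Y` are deleted. -/
def tail (O : Ordering G) (a b : ℕ) : Set V := O.seg a O.p b O.q

@[simp] theorem x_mem_seg {a a' b b' : ℕ} {i : Fin O.p} :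
    O.x i ∈ O.seg a a' b b' ↔ a ≤ i ∧ (i : ℕ) < a' := by
  constructor
  · rintro (⟨k, h1, h2, h3⟩ | ⟨j, -, -, h3⟩)
    · rw [O.x_injective h3]; exact ⟨h1, h2⟩
    · exact absurd h3 (O.x_ne_y _ _)
  · exact fun h => Or.inl ⟨i, h.1, h.2, rfl⟩

theorem seg_swap {a a' b b' : ℕ} : O.swap.seg b b' a a' = O.seg a a' b b' := by
  ext v
  exact or_comm

@[simp] theorem y_mem_seg {a a' b b' : ℕ} {j : Fin O.q} :
    O.y j ∈ O.seg a a' b b' ↔ b ≤ j ∧ (j : ℕ) < b' := by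
  rw [← seg_swap]
  exact x_mem_seg (O := O.swap)

@[simp] theorem x_mem_tail {a b : ℕ} {i : Fin O.p} : O.x i ∈ O.tail a b ↔ a ≤ i := by
  simp [tail]

@[simp] theorem y_mem_tail {a b : ℕ} {j : Fin O.q} : O.y j ∈ O.tail a b ↔ b ≤ j := by
  simp [tail]

theorem tail_swap {a b : ℕ} : O.swap.tail b a = O.tail a b := seg_swap

theorem set_ext {S T : Set V} (O : Ordering G) (hx : ∀ i, O.x i ∈ S ↔ O.x i ∈ T)
    (hy : ∀ j, O.y j ∈ S ↔ O.y j ∈ T) : S = T := by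
  ext v
  rcases O.cover v with ⟨i, rfl⟩ | ⟨j, rfl⟩
  · exact hx i
  · exact hy j

theorem tail_zero : O.tail 0 0 = Set.univ := O.set_ext (by simp) (by simp)

theorem tail_end {a b : ℕ} (ha : O.p ≤ a) (hb : O.q ≤ b) : O.tail a b = ∅ :=
  O.set_ext (fun i => by simp; omega) (fun j => by simp; omega)

/-- The first vertices of `O.tail a b` have neighbours in it. -/
structure Good (O : Ordering G) (a : Fin O.p) (b : Fin O.q) : Prop where
  hx : (a : ℕ) < O.lastX (O.y b)
  hy : (b : ℕ) < O.lastY (O.x a)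

/-- The block of `O.tail a b` is `K = O.seg a (e + 1) b (g + 1)` and
`J = O.seg (e + 1) a' (g + 1) b'`. -/
structure IsBlock (O : Ordering G) (a : Fin O.p) (b : Fin O.q) (e : Fin O.p) (g : Fin O.q)
    (a' b' : ℕ) : Prop where
  he : (e : ℕ) + 1 = O.lastX (O.y b)
  hg : (g : ℕ) + 1 = O.lastY (O.x a)
  hea : (e : ℕ) + 1 ≤ a'
  hgb : (g : ℕ) + 1 ≤ b'
  hap : a' ≤ O.p
  hbq : b' ≤ O.q
  jx : ∀ k : Fin O.p, (e : ℕ) + 1 ≤ k → (k : ℕ) < a' → O.lastY (O.x k) ≤ g + 1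
  jx' : ∀ k : Fin O.p, (k : ℕ) = a' → (g : ℕ) + 1 < O.lastY (O.x k)
  jy : ∀ k : Fin O.q, (g : ℕ) + 1 ≤ k → (k : ℕ) < b' → O.lastX (O.y k) ≤ e + 1
  jy' : ∀ k : Fin O.q, (k : ℕ) = b' → (e : ℕ) + 1 < O.lastX (O.y k)

variable {a e : Fin O.p} {b g : Fin O.q} {a' b' : ℕ}

theorem Good.swap (h : O.Good a b) : O.swap.Good b a := ⟨h.hy, h.hx⟩

theorem IsBlock.swap (h : O.IsBlock a b e g a' b') : O.swap.IsBlock b a g e b' a' :=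
  ⟨h.hg, h.he, h.hgb, h.hea, h.hbq, h.hap, h.jy, h.jy', h.jx, h.jx'⟩

/-- The edges from `x a` and `y b` to their last neighbours cross. -/
theorem Good.adj (h : O.Good a b) (hO : O.IsStrong) : G.Adj (O.x a) (O.y b) := by
  have h1 := h.hx
  have h2 := h.hy
  obtain ⟨k, hk, hk'⟩ := exists_lastX (O := O) (v := O.y b) (by omega)
  obtain ⟨c, hc, hc'⟩ := exists_lastY (O := O) (v := O.x a) (by omega)
  exact (hO a k b c (Fin.le_def.2 (by omega)) (Fin.le_def.2 (by omega)) hc'.symm hk').1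

theorem IsBlock.a_le (h : O.IsBlock a b e g a' b') (hg : O.Good a b) : a ≤ e :=
  Fin.le_def.2 (by have := h.he; have := hg.hx; omega)

theorem IsBlock.b_le (h : O.IsBlock a b e g a' b') (hg : O.Good a b) : b ≤ g :=
  h.swap.a_le hg.swap

/-- In a block, `K` induces a complete bipartite graph. -/
theorem IsBlock.adj (h : O.IsBlock a b e g a' b') (hg : O.Good a b) (hO : O.IsStrong)
    (hN : ∀ v, ∃ w, G.Adj v w) {i : Fin O.p} {j : Fin O.q} (hi : a ≤ i) (hi' : i ≤ e)
    (hj : b ≤ j) (hj' : j ≤ g) : G.Adj (O.x i) (O.y j) := by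
  have h1 := hO.adj_of_lt_lastY hN (hg.adj hO) hj (by have := h.hg; have : (j : ℕ) ≤ g := hj'; omega)
  have h2 := hO.adj_of_lt_lastX hN (hg.adj hO).symm hi
    (by have := h.he; have : (i : ℕ) ≤ e := hi'; omega)
  exact (hO a i b j hi hj h1 h2.symm).2

theorem IsBlock.kPart_eq (h : O.IsBlock a b e g a' b') (hg : O.Good a b) (hO : O.IsStrong)
    (hN : ∀ v, ∃ w, G.Adj v w) :
    kPart G (O.tail a b) (O.x a) (O.y b) = O.seg a (e + 1) b (g + 1) := by
  have he := h.he
  have hg' := h.hg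
  refine O.set_ext (fun i => ?_) (fun j => ?_)
  · simp only [kPart, Set.mem_ofPred_eq, x_mem_tail, x_mem_seg, O.not_adj_x, false_or]
    refine and_congr_right fun hi => ⟨fun hadj => ?_, fun hlt => ?_⟩
    · have := lt_lastX hadj.symm; omega
    · exact (h.adj hg hO hN hi (Fin.le_def.2 (by omega)) le_rfl (h.b_le hg)).symm
  · simp only [kPart, Set.mem_ofPred_eq, y_mem_tail, y_mem_seg, O.not_adj_y, or_false]
    refine and_congr_right fun hi => ⟨fun hadj => ?_, fun hlt => ?_⟩
    · have := lt_lastY hadj.symm; omega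
    · exact h.adj hg hO hN le_rfl (h.a_le hg) hi (Fin.le_def.2 (by omega))

/-- At most one of the parts meets `J`. -/
theorem IsBlock.j_part (h : O.IsBlock a b e g a' b') (hO : O.IsStrong)
    (hN : ∀ v, ∃ w, G.Adj v w) : a' = e + 1 ∨ b' = g + 1 := by
  by_contra! hcon
  have := h.hea; have := h.hgb; have := h.hap; have := h.hbq
  have h1 := h.jx ⟨e + 1, by omega⟩ le_rfl (by simp only; omega)
  have h2 := h.jy ⟨g + 1, by omega⟩ le_rfl (by simp only; omega)
  obtain ⟨v, hv⟩ := hN (O.x ⟨e + 1, by omega⟩)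
  obtain ⟨j, rfl⟩ := exists_y_of_adj hv
  obtain ⟨w, hw⟩ := hN (O.y ⟨g + 1, by omega⟩)
  obtain ⟨i, rfl⟩ := exists_x_of_adj hw
  have h3 := lt_lastY hv.symm
  have h4 := lt_lastX hw.symm
  -- The neighbours of `x (e + 1)` have index at most `g` and those of `y (g + 1)` index at most
  -- `e`. Two such edges cross and would make these two vertices adjacent.
  have h5 := (hO i ⟨e + 1, by omega⟩ j ⟨g + 1, by omega⟩ (Fin.le_def.2 (by simp only; omega))
    (Fin.le_def.2 (by simp only; omega)) hw.symm hv).2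
  have := lt_lastY h5.symm
  simp only at this
  omega

/-- A vertex after `J` has a neighbour after `J`. -/
theorem IsBlock.lt_lastY_of_le (h : O.IsBlock a b e g a' b') (hO : O.IsStrong)
    (hN : ∀ v, ∃ w, G.Adj v w) {k : Fin O.p} (hk : a' ≤ k) : b' < O.lastY (O.x k) := by
  have h1 := h.jx' ⟨a', by omega⟩ rfl
  have h2 := hO.lastY_mono hN (i := ⟨a', by omega⟩) (k := k) hk
  rcases h.j_part hO hN with h3 | h3
  -- Here `J` misses `X`. Otherwise the last neighbour of `x k` would lie in `J ∩ Y`, whose vertices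
  -- have no neighbour after `x e`.
  · by_contra! hcon
    obtain ⟨l, hl, hal⟩ := exists_lastY (O := O) (v := O.x k) (by omega)
    have h4 := h.jy l (by omega) (by omega)
    have := lt_lastX hal.symm
    omega
  · omega

theorem IsBlock.lt_lastX_of_le (h : O.IsBlock a b e g a' b') (hO : O.IsStrong)
    (hN : ∀ v, ∃ w, G.Adj v w) {k : Fin O.q} (hk : b' ≤ k) : a' < O.lastX (O.y k) :=
  h.swap.lt_lastY_of_le hO.swap hN hk

theorem lastX_le (v : V) : O.lastX v ≤ O.p := by
  rcases Nat.eq_zero_or_pos (O.lastX v) with h | h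
  · omega
  · obtain ⟨i, hi, -⟩ := exists_lastX h
    omega

theorem lastY_le (v : V) : O.lastY v ≤ O.q := lastX_le (O := O.swap) v

/-- After a block, either both parts are exhausted or the rest is good again. -/
theorem IsBlock.next (h : O.IsBlock a b e g a' b') (hO : O.IsStrong)
    (hN : ∀ v, ∃ w, G.Adj v w) :
    (a' = O.p ∧ b' = O.q) ∨ ∃ (c : Fin O.p) (d : Fin O.q), (c : ℕ) = a' ∧ (d : ℕ) = b' ∧
      O.Good c d := by
  have := h.hap; have := h.hbq
  by_cases ha : a' < O.p
  · have h1 := h.lt_lastY_of_le hO hN (k := ⟨a', ha⟩) le_rfl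
    have h2 := lastY_le (O := O) (O.x ⟨a', ha⟩)
    exact Or.inr ⟨⟨a', ha⟩, ⟨b', by omega⟩, rfl, rfl, h.lt_lastX_of_le hO hN le_rfl, h1⟩
  · by_cases hb : b' < O.q
    · have h1 := h.lt_lastX_of_le hO hN (k := ⟨b', hb⟩) le_rfl
      have h2 := lastX_le (O := O) (O.y ⟨b', hb⟩)
      omega
    · omega

theorem IsBlock.not_adj_of_jx (h : O.IsBlock a b e g a' b') {k : Fin O.p} {j : Fin O.q}
    (h1 : (e : ℕ) + 1 ≤ k) (h2 : (k : ℕ) < a') (h3 : (g : ℕ) + 1 ≤ j) :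
    ¬ G.Adj (O.x k) (O.y j) := fun hadj => by
  have := h.jx k h1 h2
  have := lt_lastY hadj.symm
  omega

/-- `jx` and `jy` make the vertices of the two intervals isolated. Beyond `a'` and `b'` every vertex
has a neighbour in the rest, so no isolated vertex is missed. -/
theorem IsBlock.isolated_eq (h : O.IsBlock a b e g a' b') (hg : O.Good a b) (hO : O.IsStrong)
    (hN : ∀ v, ∃ w, G.Adj v w) :
    isolated G (O.tail a b \ O.seg a (e + 1) b (g + 1)) = O.seg (e + 1) a' (g + 1) b' := by
  have hae : (a : ℕ) ≤ e := h.a_le hg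
  have hbg : (b : ℕ) ≤ g := h.b_le hg
  have hea := h.hea
  have hgb := h.hgb
  refine O.set_ext (fun i => ?_) (fun j => ?_)
  · simp only [isolated, Set.mem_ofPred_eq, Set.mem_sdiff, x_mem_tail, x_mem_seg, not_and, not_lt]
    constructor
    · rintro ⟨⟨h1, h2⟩, h3⟩
      refine ⟨h2 h1, ?_⟩
      by_contra! hcon
      have h4 := h.lt_lastY_of_le hO hN hcon
      obtain ⟨l, hl, hal⟩ := exists_lastY (O := O) (v := O.x i) (by omega)
      refine h3 (O.y l) ?_ hal.symm
      simp only [y_mem_tail, y_mem_seg]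
      omega
    · rintro ⟨h1, h2⟩
      refine ⟨by omega, fun z hz hadj => ?_⟩
      obtain ⟨l, rfl⟩ := exists_y_of_adj hadj
      simp only [y_mem_tail, y_mem_seg] at hz
      exact h.not_adj_of_jx h1 h2 (by omega) hadj
  · simp only [isolated, Set.mem_ofPred_eq, Set.mem_sdiff, y_mem_tail, y_mem_seg, not_and, not_lt]
    constructor
    · rintro ⟨⟨h1, h2⟩, h3⟩
      refine ⟨h2 h1, ?_⟩
      by_contra! hcon
      have h4 := h.lt_lastX_of_le hO hN hcon
      obtain ⟨l, hl, hal⟩ := exists_lastX (O := O) (v := O.y j) (by omega)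
      refine h3 (O.x l) ?_ hal.symm
      simp only [x_mem_tail, x_mem_seg]
      omega
    · rintro ⟨h1, h2⟩
      refine ⟨by omega, fun z hz hadj => ?_⟩
      obtain ⟨l, rfl⟩ := exists_x_of_adj hadj
      simp only [x_mem_tail, x_mem_seg] at hz
      exact h.swap.not_adj_of_jx (O := O.swap) h1 h2 (k := j) (j := l) (by omega) hadj

theorem IsBlock.tail_diff (h : O.IsBlock a b e g a' b') (hg : O.Good a b) :
    O.tail a b \ (O.seg a (e + 1) b (g + 1) ∪ O.seg (e + 1) a' (g + 1) b') = O.tail a' b' := by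
  have hae : (a : ℕ) ≤ e := h.a_le hg
  have hbg : (b : ℕ) ≤ g := h.b_le hg
  have hea := h.hea
  have hgb := h.hgb
  refine O.set_ext (fun i => ?_) (fun j => ?_)
  · simp only [Set.mem_sdiff, Set.mem_union, x_mem_tail, x_mem_seg]; omega
  · simp only [Set.mem_sdiff, Set.mem_union, y_mem_tail, y_mem_seg]; omega

theorem isLX_tail (a : Fin O.p) (b : ℕ) : O.IsLX (O.tail a b) a :=
  ⟨by simp, fun k hk => Fin.le_def.2 (by simpa using hk)⟩

theorem isLY_tail (a : ℕ) (b : Fin O.q) : O.IsLY (O.tail a b) b :=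
  ⟨by simp, fun k hk => Fin.le_def.2 (by simpa using hk)⟩

theorem isLX_seg {a e : Fin O.p} (h : a ≤ e) (b b' : ℕ) : O.IsLX (O.seg a (e + 1) b b') a :=
  ⟨by simp; omega, fun k hk => Fin.le_def.2 (by simp at hk; omega)⟩

theorem isRX_seg {a e : Fin O.p} (h : a ≤ e) (b b' : ℕ) : O.IsRX (O.seg a (e + 1) b b') e :=
  ⟨by simp; omega, fun k hk => Fin.le_def.2 (by simp at hk; omega)⟩

theorem isLY_seg {b g : Fin O.q} (h : b ≤ g) (a a' : ℕ) : O.IsLY (O.seg a a' b (g + 1)) b :=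
  ⟨by simp; omega, fun k hk => Fin.le_def.2 (by simp at hk; omega)⟩

theorem isRY_seg {b g : Fin O.q} (h : b ≤ g) (a a' : ℕ) : O.IsRY (O.seg a a' b (g + 1)) g :=
  ⟨by simp; omega, fun k hk => Fin.le_def.2 (by simp at hk; omega)⟩

/-- The index `a'` is the first one from `e` on at which `F` exceeds `m`, that is, the end of `J`.
The last clause is vacuous if there is none and `a' = O.p`. -/
theorem exists_jx_end (O : Ordering G) (e m : ℕ) (he : e ≤ O.p) (F : Fin O.p → ℕ) :
    ∃ a', e ≤ a' ∧ a' ≤ O.p ∧ (∀ k : Fin O.p, e ≤ k → (k : ℕ) < a' → F k ≤ m) ∧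
      ∀ k : Fin O.p, (k : ℕ) = a' → m < F k := by
  induction hd : O.p - e generalizing e with
  | zero => exact ⟨e, le_rfl, he, fun k h1 h2 => by omega, fun k hk => by omega⟩
  | succ d ih =>
    by_cases h : F ⟨e, by omega⟩ ≤ m
    · obtain ⟨a', h1, h2, h3, h4⟩ := ih (e + 1) (by omega) (by omega)
      refine ⟨a', by omega, h2, fun k hk hk' => ?_, h4⟩
      by_cases hke : (k : ℕ) = e
      · have : k = ⟨e, by omega⟩ := Fin.ext hke
        rw [this]; exact h
      · exact h3 k (by omega) hk'
    · refine ⟨e, le_rfl, he, fun k h1 h2 => by omega, fun k hk => ?_⟩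
      have : k = ⟨e, by omega⟩ := Fin.ext hk
      rw [this]; omega

theorem Good.exists_isBlock (h : O.Good a b) : ∃ e g a' b', O.IsBlock a b e g a' b' := by
  have h1 := h.hx
  have h2 := h.hy
  obtain ⟨e, he, -⟩ := exists_lastX (O := O) (v := O.y b) (by omega)
  obtain ⟨g, hg, -⟩ := exists_lastY (O := O) (v := O.x a) (by omega)
  obtain ⟨a', a1, a2, a3, a4⟩ :=
    O.exists_jx_end (e + 1) (g + 1) (by omega) (fun k => O.lastY (O.x k))
  obtain ⟨b', b1, b2, b3, b4⟩ :=
    O.swap.exists_jx_end (g + 1) (e + 1) (by change _ ≤ O.q; omega) (fun k => O.lastX (O.y k))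
  exact ⟨e, g, a', b', he, hg, a1, b1, a2, b2, a3, a4, b3, b4⟩

theorem Good.zero [Nontrivial V] (hG : G.Connected) (O : Ordering G) :
    ∃ (a : Fin O.p) (b : Fin O.q), (a : ℕ) = 0 ∧ (b : ℕ) = 0 ∧ O.Good a b := by
  have hN := hG.preconnected.exists_adj_of_nontrivial
  have hpos : 0 < O.p ∧ 0 < O.q := by
    obtain ⟨v⟩ : Nonempty V := inferInstance
    obtain ⟨w, hw⟩ := hN v
    rcases O.cover v with ⟨i, rfl⟩ | ⟨j, rfl⟩
    · obtain ⟨j, rfl⟩ := exists_y_of_adj hw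
      exact ⟨i.pos, j.pos⟩
    · obtain ⟨i, rfl⟩ := exists_x_of_adj hw
      exact ⟨i.pos, j.pos⟩
  refine ⟨⟨0, hpos.1⟩, ⟨0, hpos.2⟩, rfl, rfl, ?_, ?_⟩
  · obtain ⟨w, hw⟩ := hN (O.y ⟨0, hpos.2⟩)
    obtain ⟨i, rfl⟩ := exists_x_of_adj hw
    exact (Nat.zero_le _).trans_lt (lt_lastX hw.symm)
  · obtain ⟨w, hw⟩ := hN (O.x ⟨0, hpos.1⟩)
    obtain ⟨i, rfl⟩ := exists_y_of_adj hw
    exact (Nat.zero_le _).trans_lt (lt_lastY hw.symm)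

end Ordering

end PathEcc

/-! ### Decompositions into blocks, and the path through them. -/

namespace PathEcc

open PathEcc.Ordering

variable {V : Type*} {G : SimpleGraph V} {O : Ordering G}

/-- The block with the given ends. -/
def Ordering.block (O : Ordering G) (a : Fin O.p) (b : Fin O.q) (e : Fin O.p) (g : Fin O.q)
    (a' b' : ℕ) : Block V :=
  ⟨O.seg a (e + 1) b (g + 1), O.seg (e + 1) a' (g + 1) b'⟩

variable {a e : Fin O.p} {b g : Fin O.q} {a' b' : ℕ} {L : List (Block V)}

theorem Decomposes.cons_block (h : O.IsBlock a b e g a' b') (hg : O.Good a b) (hO : O.IsStrong)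
    (hN : ∀ v, ∃ w, G.Adj v w) (hL : Decomposes O (O.tail a' b') L) :
    Decomposes O (O.tail a b) (O.block a b e g a' b' :: L) := by
  refine .cons (isLX_tail a b) (isLY_tail a b) (h.kPart_eq hg hO hN).symm ?_ ?_
  · rw [h.isolated_eq hg hO hN]
  · rwa [h.tail_diff hg]

/-- The decomposition is deterministic. Correctness concerns an arbitrary list satisfying
`Decomposes`, and this identifies its first entry. -/
theorem Decomposes.of_good (h : O.IsBlock a b e g a' b') (hg : O.Good a b) (hO : O.IsStrong)
    (hN : ∀ v, ∃ w, G.Adj v w) (hL : Decomposes O (O.tail a b) L) :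
    ∃ L', L = O.block a b e g a' b' :: L' ∧ Decomposes O (O.tail a' b') L' := by
  generalize hR : O.tail a b = R at hL
  cases hL with
  | nil =>
    have : O.x a ∈ O.tail a b := by simp
    rw [hR] at this
    exact this.elim
  | @cons R K J i j L' hi hj hK hJ hL =>
    subst hR
    have hia := hi.unique (isLX_tail a b)
    have hjb := hj.unique (isLY_tail a b)
    subst i j
    rw [h.kPart_eq hg hO hN] at hK
    subst hK
    rw [h.isolated_eq hg hO hN] at hJ
    subst hJ
    rw [h.tail_diff hg] at hL
    exact ⟨L', rfl, hL⟩

theorem Decomposes.eq_nil (ha : O.p ≤ a') (hb : O.q ≤ b') (hL : Decomposes O (O.tail a' b') L) :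
    L = [] := by
  rw [tail_end ha hb] at hL
  cases hL with
  | nil => rfl
  | cons hi => exact hi.1.elim

theorem Ordering.Good.exists_decomposes (hg : O.Good a b) (hO : O.IsStrong)
    (hN : ∀ v, ∃ w, G.Adj v w) : ∃ L, Decomposes O (O.tail a b) L := by
  induction hd : O.p - a using Nat.strong_induction_on generalizing a b with
  | _ d ih =>
    obtain ⟨e, g, a', b', h⟩ := hg.exists_isBlock
    have hae : (a : ℕ) ≤ e := h.a_le hg
    have hea := h.hea
    rcases h.next hO hN with ⟨h1, h2⟩ | ⟨c, d, h1, h2, hcd⟩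
    · exact ⟨_, Decomposes.cons_block h hg hO hN (L := []) (by
        rw [tail_end h1.ge h2.ge]; exact .nil)⟩
    · obtain ⟨L, hL⟩ := ih (O.p - c) (by omega) hcd rfl
      rw [h1, h2] at hL
      exact ⟨_, Decomposes.cons_block h hg hO hN hL⟩

/-! ### Links between consecutive blocks -/

/-- By monotonicity of the last neighbours `x e` reaches furthest among the vertices of `K ∩ X`, and
as neighbourhoods are intervals, reaching beyond `b'` means being adjacent to the first vertex `y d`
of the next block. -/
theorem Ordering.linkedXY_iff (h : O.IsBlock a b e g a' b') (hg : O.Good a b) (hO : O.IsStrong)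
    (hN : ∀ v, ∃ w, G.Adj v w) {c e' : Fin O.p} {d g' : Fin O.q} {c' d' : ℕ}
    (hd : (d : ℕ) = b') (h' : O.IsBlock c d e' g' c' d')
    (hg' : O.Good c d) :
    LinkedXY O (O.block a b e g a' b').K (O.block c d e' g' c' d').K ↔
      b' < O.lastY (O.x e) := by
  have hae : (a : ℕ) ≤ e := h.a_le hg
  have hbg : b ≤ g := h.b_le hg
  have hgb := h.hgb
  have hdg : (d : ℕ) ≤ g' := h'.b_le hg'
  constructor
  · rintro ⟨i, j, hi, hj, hadj⟩
    simp only [block, x_mem_seg, y_mem_seg] at hi hj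
    have h1 := lt_lastY hadj.symm
    have h2 := hO.lastY_mono hN (i := i) (k := e) (Fin.le_def.2 (by omega))
    omega
  · intro hlt
    refine ⟨e, d, ?_, ?_, ?_⟩
    · simp only [block, x_mem_seg]; omega
    · simp only [block, y_mem_seg]; omega
    · exact hO.adj_of_lt_lastY hN (h.adj hg hO hN (h.a_le hg) le_rfl le_rfl hbg)
        (Fin.le_def.2 (by have : (b : ℕ) ≤ g := hbg; omega)) (by omega)

/-- By connectivity some edge enters the rest from outside. Its outer end is not in `J`, so it
precedes or equals `x e` or `y g`, and that vertex reaches at least as far. -/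
theorem Ordering.IsBlock.exists_link (h : O.IsBlock a b e g a' b') (hG : G.Connected)
    (hO : O.IsStrong) (hN : ∀ v, ∃ w, G.Adj v w) (c : Fin O.p) (hc : (c : ℕ) = a') :
    b' < O.lastY (O.x e) ∨ a' < O.lastX (O.y g) := by
  have hea := h.hea
  have hgb := h.hgb
  obtain ⟨v, hv, w, hw, hadj⟩ : ∃ v ∈ O.tail a' b', ∃ w, w ∉ O.tail a' b' ∧ G.Adj w v := by
    have hcv : O.x c ∈ O.tail a' b' := by simp [hc]
    have hev : O.x e ∉ O.tail a' b' := by simp; omega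
    obtain ⟨p⟩ := hG.preconnected (O.x e) (O.x c)
    obtain ⟨d, -, h1, h2⟩ := p.exists_boundary_dart (O.tail a' b')ᶜ hev (by simpa using hcv)
    exact ⟨d.snd, by simpa using h2, d.fst, h1, d.adj⟩
  rcases O.cover v with ⟨i, rfl⟩ | ⟨j, rfl⟩
  · obtain ⟨j, rfl⟩ := exists_y_of_adj hadj.symm
    simp only [x_mem_tail, y_mem_tail, not_le] at hv hw
    have h1 := lt_lastX hadj.symm
    right
    rcases Nat.lt_or_ge g j with h2 | h2
    · have := h.jy j h2 hw; omega
    · have := hO.lastX_mono hN (j := j) (l := g) (Fin.le_def.2 h2); omega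
  · obtain ⟨i, rfl⟩ := exists_x_of_adj hadj.symm
    simp only [x_mem_tail, y_mem_tail, not_le] at hv hw
    have h1 := lt_lastY hadj.symm
    left
    rcases Nat.lt_or_ge e i with h2 | h2
    · have := h.jx i h2 hw; omega
    · have := hO.lastY_mono hN (i := i) (k := e) (Fin.le_def.2 h2); omega

/-! ### Paths in a block -/

theorem isPathIn_single {K : Set V} {u : V} (hu : u ∈ K) : IsPathIn G K u u [u] :=
  ⟨.nil, .nil, rfl, by simpa using hu⟩

theorem isPathIn_pair {K : Set V} {u v : V} (hu : u ∈ K) (hv : v ∈ K) (h : G.Adj u v) :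
    IsPathIn G K u v [u, v] :=
  ⟨.cons h .nil, by simp [h.ne], by simp, by simp [hu, hv]⟩

theorem isPathIn_triple {K : Set V} {u v w : V} (hu : u ∈ K) (hv : v ∈ K) (hw : w ∈ K)
    (h : G.Adj u v) (h' : G.Adj v w) (hne : u ≠ w) : IsPathIn G K u w [u, v, w] :=
  ⟨.cons h (.cons h' .nil), by simp [h.ne, h'.ne, hne], by simp, by simp [hu, hv, hw]⟩

/-- The sequence appended in a block when it is left through `X`. -/
def partX {V : Type*} [DecidableEq V] (v u w t : V) : List V :=
  if v = u then if u = t then [u] else [u, w, t] else [v, t]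

theorem Ordering.IsBlock.isPathIn_partX [DecidableEq V] (h : O.IsBlock a b e g a' b')
    (hg : O.Good a b) (hO : O.IsStrong) (hN : ∀ v, ∃ w, G.Adj v w) {v : V}
    (hv : v = O.x a ∨ v = O.y b) :
    IsPathIn G (O.block a b e g a' b').K v (O.x e) (partX v (O.x a) (O.y b) (O.x e)) := by
  have hae : a ≤ e := h.a_le hg
  have hbg : b ≤ g := h.b_le hg
  have hae' : (a : ℕ) ≤ e := hae
  have hbg' : (b : ℕ) ≤ g := hbg
  have h1 := h.adj hg hO hN le_rfl hae le_rfl hbg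
  have h2 := h.adj hg hO hN hae le_rfl le_rfl hbg
  have ka : O.x a ∈ (O.block a b e g a' b').K := by simp only [block, x_mem_seg]; omega
  have ke : O.x e ∈ (O.block a b e g a' b').K := by simp only [block, x_mem_seg]; omega
  have kb : O.y b ∈ (O.block a b e g a' b').K := by simp only [block, y_mem_seg]; omega
  unfold partX
  split_ifs with h3 h4
  · rw [h3, ← h4]; exact isPathIn_single ka
  · rw [h3]; exact isPathIn_triple ka kb ke h1 h2.symm h4
  · obtain rfl := hv.resolve_left h3
    exact isPathIn_pair kb ke h2.symm

theorem Ordering.IsBlock.isPathIn_partY [DecidableEq V] (h : O.IsBlock a b e g a' b')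
    (hg : O.Good a b) (hO : O.IsStrong) (hN : ∀ v, ∃ w, G.Adj v w) {v : V}
    (hv : v = O.x a ∨ v = O.y b) :
    IsPathIn G (O.block a b e g a' b').K v (O.y g) (partX v (O.y b) (O.x a) (O.y g)) := by
  have := h.swap.isPathIn_partX hg.swap hO.swap hN (v := v) hv.symm
  simp only [block, seg_swap] at this ⊢
  exact this

/-- A path through a block that ends in the last vertex of `X` dominates the block
if `J` does not meet `X`. -/
theorem Ordering.IsBlock.dominates_of_endX (h : O.IsBlock a b e g a' b')
    (hg : O.Good a b) (hO : O.IsStrong) (hN : ∀ v, ∃ w, G.Adj v w) {v : V}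
    (hv : v = O.x a ∨ v = O.y b) {P : List V} (ha : a' = e + 1)
    (hP : IsPathIn G (O.block a b e g a' b').K v (O.x e) P) {z : V} (hz : z ∈ O.tail a b)
    (hz' : z ∉ O.tail a' b') : ∃ y ∈ P, z = y ∨ G.Adj z y := by
  have hae : a ≤ e := h.a_le hg
  have hbg : b ≤ g := h.b_le hg
  obtain ⟨p, hp, rfl, hK⟩ := hP
  rcases O.cover z with ⟨i, rfl⟩ | ⟨j, rfl⟩
  · simp only [x_mem_tail] at hz hz'
    -- A vertex of `Y` on the path is adjacent to all of `K ∩ X`. The path avoids `Y` only if it is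
    -- the single vertex `x a = x e`, and then this is all of `K ∩ X`.
    suffices (∃ j, O.y j ∈ p.support) ∨ (a = e ∧ v = O.x a) by
      rcases this with ⟨j, hj⟩ | ⟨h1, h2⟩
      · have h1 := hK _ hj
        simp only [block, y_mem_seg] at h1
        exact ⟨_, hj, Or.inr (h.adj hg hO hN hz (Fin.le_def.2 (by omega)) h1.1
          (Fin.le_def.2 (by omega)))⟩
      · refine ⟨v, p.start_mem_support, Or.inl ?_⟩
        rw [h2]
        congr 1
        have : (a : ℕ) = e := by rw [h1]
        exact Fin.ext (by omega)
    rcases hv with rfl | rfl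
    · by_cases hae' : a = e
      · exact Or.inr ⟨hae', rfl⟩
      · have hnil : ¬ p.Nil := p.not_nil_of_ne fun hh => hae' (O.x_injective hh)
        obtain ⟨j, hj⟩ := exists_y_of_adj (p.adj_snd hnil)
        exact Or.inl ⟨j, hj ▸ p.getVert_mem_support 1⟩
    · exact Or.inl ⟨b, p.start_mem_support⟩
  · refine ⟨O.x e, p.end_mem_support, Or.inr ?_⟩
    simp only [y_mem_tail, not_le] at hz hz'
    rcases Nat.lt_or_ge g j with h1 | h1
    · obtain ⟨w, hw⟩ := hN (O.y j)
      obtain ⟨i, rfl⟩ := exists_x_of_adj hw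
      have h2 := h.jy j h1 hz'
      have h3 := lt_lastX hw.symm
      -- A vertex `y j` of `J` has a neighbour `x i` with `i ≤ e`; this edge and the edge from `x e`
      -- to `y b` force `x e` to be adjacent to `y j`.
      have := (hO i e b j (Fin.le_def.2 (by omega)) hz hw.symm
        (h.adj hg hO hN hae le_rfl le_rfl hbg)).2
      exact this.symm
    · exact (h.adj hg hO hN hae le_rfl hz (Fin.le_def.2 h1)).symm

theorem Ordering.IsBlock.dominates_of_endY (h : O.IsBlock a b e g a' b')
    (hg : O.Good a b) (hO : O.IsStrong) (hN : ∀ v, ∃ w, G.Adj v w) {v : V}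
    (hv : v = O.x a ∨ v = O.y b) {P : List V} (hb : b' = g + 1)
    (hP : IsPathIn G (O.block a b e g a' b').K v (O.y g) P) {z : V} (hz : z ∈ O.tail a b)
    (hz' : z ∉ O.tail a' b') : ∃ y ∈ P, z = y ∨ G.Adj z y := by
  rw [← tail_swap] at hz hz'
  refine h.swap.dominates_of_endX hg.swap hO.swap hN hv.symm hb ?_ hz hz'
  simp only [block, seg_swap] at hP ⊢
  exact hP

theorem Ordering.IsBlock.j_subset (h : O.IsBlock a b e g a' b') :
    (O.block a b e g a' b').J ⊆ Set.range O.y ↔ a' = e + 1 := by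
  have := h.hea
  have := h.hap
  constructor
  · intro hJ
    by_contra hne
    obtain ⟨j, hj⟩ := hJ (show O.x ⟨e + 1, by omega⟩ ∈ (O.block a b e g a' b').J by
      simp only [block, x_mem_seg]; omega)
    exact O.x_ne_y _ _ hj.symm
  · intro ha v hv
    rcases O.cover v with ⟨i, rfl⟩ | ⟨j, rfl⟩
    · simp only [block, x_mem_seg] at hv; omega
    · exact ⟨j, rfl⟩

theorem exists_append_path {u v w t : V} {p : G.Walk u v} {q : G.Walk w t} (hp : p.IsPath)
    (hq : q.IsPath) (hadj : G.Adj v w) (hd : ∀ z ∈ p.support, z ∉ q.support) :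
    ∃ r : G.Walk u t, r.IsPath ∧ r.support = p.support ++ q.support := by
  refine ⟨p.append (.cons hadj q), ?_, ?_⟩
  · rw [SimpleGraph.Walk.isPath_def, SimpleGraph.Walk.support_append]
    simp only [SimpleGraph.Walk.support_cons, List.tail_cons]
    exact List.nodup_append'.2 ⟨hp.support_nodup, hq.support_nodup, hd⟩
  · rw [SimpleGraph.Walk.support_append]
    simp

/-- Whatever paths the algorithm chooses, it returns a dominating path. -/
theorem DomPathLoop.exists_path (hG : G.Connected) (hO : O.IsStrong)
    (hN : ∀ v, ∃ w, G.Adj v w) (hg : O.Good a b) (hL : Decomposes O (O.tail a b) L) {v : V}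
    (hv : v = O.x a ∨ v = O.y b) {P : List V} (hP : DomPathLoop O L v P) :
    ∃ (w : V) (p : G.Walk v w), p.IsPath ∧ p.support = P ∧ (∀ z ∈ P, z ∈ O.tail a b) ∧
      ∀ z ∈ O.tail a b, ∃ y ∈ P, z = y ∨ G.Adj z y := by
  -- Each piece stays in its own `K`, outside the rest, so the pieces are disjoint and can be
  -- joined.
  have hKtail : ∀ {a b e g a' b'}, O.Good a b → O.IsBlock a b e g a' b' →
      (O.block a b e g a' b').K ⊆ O.tail a b \ O.tail a' b' := by
    intro a b e g a' b' hg h z hz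
    rw [← h.tail_diff hg]
    refine ⟨?_, fun hh => hh.2 (Or.inl hz)⟩
    have := h.hea; have := h.hgb
    rcases O.cover z with ⟨i, rfl⟩ | ⟨j, rfl⟩
    · simp only [block, x_mem_seg, x_mem_tail] at hz ⊢; omega
    · simp only [block, y_mem_seg, y_mem_tail] at hz ⊢; omega
  have htail : ∀ {a b e g a' b'}, O.Good a b → O.IsBlock a b e g a' b' →
      O.tail a' b' ⊆ O.tail a b := by
    intro a b e g a' b' hg h z hz
    rw [← h.tail_diff hg] at hz
    exact hz.1
  induction hP generalizing a b with
  | @lastX B v i P hJ hi hPi =>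
    obtain ⟨e, g, a', b', h⟩ := hg.exists_isBlock
    obtain ⟨L', hL', hL''⟩ := hL.of_good h hg hO hN
    obtain ⟨rfl, rfl⟩ := List.cons.inj hL'
    obtain rfl := hi.unique (isRX_seg (h.a_le hg) _ _)
    rcases h.next hO hN with ⟨h1, h2⟩ | ⟨c, d, h1, h2, hcd⟩
    · obtain ⟨p, hp, hs, hK⟩ := hPi
      refine ⟨_, p, hp, hs, fun z hz => (hKtail hg h (hK z hz)).1, fun z hz => ?_⟩
      exact h.dominates_of_endX hg hO hN hv (h.j_subset.1 hJ) ⟨p, hp, hs, hK⟩ hz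
        (by rw [tail_end h1.ge h2.ge]; exact id)
    · rw [← h1, ← h2] at hL''
      obtain ⟨_, _, _, _, h'⟩ := hcd.exists_isBlock
      obtain ⟨_, h3, -⟩ := hL''.of_good h' hcd hO hN
      simp at h3
  | @lastY B v i P hJ hi hPi =>
    obtain ⟨e, g, a', b', h⟩ := hg.exists_isBlock
    obtain ⟨L', hL', hL''⟩ := hL.of_good h hg hO hN
    obtain ⟨rfl, rfl⟩ := List.cons.inj hL'
    obtain rfl := hi.unique (isRY_seg (h.b_le hg) _ _)
    rcases h.next hO hN with ⟨h1, h2⟩ | ⟨c, d, h1, h2, hcd⟩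
    · obtain ⟨p, hp, hs, hK⟩ := hPi
      refine ⟨_, p, hp, hs, fun z hz => (hKtail hg h (hK z hz)).1, fun z hz => ?_⟩
      -- If `J` is not contained in `Y`, then it meets `X` and therefore misses `Y`.
      exact h.dominates_of_endY hg hO hN hv
        ((h.j_part hO hN).resolve_left (mt h.j_subset.2 hJ)) ⟨p, hp, hs, hK⟩ hz
        (by rw [tail_end h1.ge h2.ge]; exact id)
    · rw [← h1, ← h2] at hL''
      obtain ⟨_, _, _, _, h'⟩ := hcd.exists_isBlock
      obtain ⟨_, h3, -⟩ := hL''.of_good h' hcd hO hN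
      simp at h3
  | @stepXY B B' L v i j P Q hlink hi hPi hj hQ ih =>
    obtain ⟨e, g, a', b', h⟩ := hg.exists_isBlock
    obtain ⟨L', hL', hL''⟩ := hL.of_good h hg hO hN
    obtain ⟨rfl, rfl⟩ := List.cons.inj hL'
    obtain rfl := hi.unique (isRX_seg (h.a_le hg) _ _)
    rcases h.next hO hN with ⟨h1, h2⟩ | ⟨c, d, h1, h2, hcd⟩
    · have := hL''.eq_nil h1.ge h2.ge
      simp at this
    · rw [← h1, ← h2] at hL''
      obtain ⟨_, _, _, _, h'⟩ := hcd.exists_isBlock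
      obtain ⟨_, h3, -⟩ := hL''.of_good h' hcd hO hN
      obtain ⟨rfl, rfl⟩ := List.cons.inj h3
      obtain rfl := hj.unique (isLY_seg (h'.b_le hcd) _ _)
      have hlt := (linkedXY_iff h hg hO hN h2 h' hcd).1 hlink
      -- A vertex of `J ∩ X` would come after `x i` and reach at least as far, beyond `b'`; but its
      -- neighbours have index at most `g`.
      have ha : a' = i + 1 := by
        by_contra hne
        have := h.hea; have := h.hap; have := h.hgb
        have h4 := h.jx ⟨i + 1, by omega⟩ le_rfl (by simp only; omega)
        have := hO.lastY_mono hN (i := i) (k := ⟨i + 1, by omega⟩)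
          (Fin.le_def.2 (by simp only; omega))
        omega
      obtain ⟨w, q, hq, hqs, hq1, hq2⟩ := ih hcd hL'' (Or.inr rfl)
      obtain ⟨p, hp, hs, hK⟩ := hPi
      rw [h1, h2] at hq1 hq2
      have hadj : G.Adj (O.x i) (O.y j) :=
        hO.adj_of_lt_lastY hN (h.adj hg hO hN (h.a_le hg) le_rfl le_rfl (h.b_le hg))
          (Fin.le_def.2 (by
            have := h.hgb; have : (b : ℕ) ≤ g := h.b_le hg; omega)) (by omega)
      obtain ⟨r, hr, hrs⟩ := exists_append_path hp hq hadj (by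
        rw [hs, hqs]; exact fun z hz hz' => (hKtail hg h (hK z hz)).2 (hq1 z hz'))
      refine ⟨_, r, hr, by rw [hrs, hs, hqs], fun z hz => ?_, fun z hz => ?_⟩
      · rcases List.mem_append.1 hz with hz | hz
        · exact (hKtail hg h (hK z hz)).1
        · exact htail hg h (hq1 z hz)
      · by_cases hz' : z ∈ O.tail a' b'
        · obtain ⟨y, hy, hy'⟩ := hq2 z hz'
          exact ⟨y, List.mem_append_right _ hy, hy'⟩
        · obtain ⟨y, hy, hy'⟩ := h.dominates_of_endX hg hO hN hv ha ⟨p, hp, hs, hK⟩ hz hz'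
          exact ⟨y, List.mem_append_left _ hy, hy'⟩
  | @stepYX B B' L v j i P Q hlink hi hPi hj hQ ih =>
    obtain ⟨e, g, a', b', h⟩ := hg.exists_isBlock
    obtain ⟨L', hL', hL''⟩ := hL.of_good h hg hO hN
    obtain ⟨rfl, rfl⟩ := List.cons.inj hL'
    obtain rfl := hi.unique (isRY_seg (h.b_le hg) _ _)
    rcases h.next hO hN with ⟨h1, h2⟩ | ⟨c, d, h1, h2, hcd⟩
    · have := hL''.eq_nil h1.ge h2.ge
      simp at this
    · rw [← h1, ← h2] at hL''
      obtain ⟨_, _, _, _, h'⟩ := hcd.exists_isBlock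
      obtain ⟨_, h3, -⟩ := hL''.of_good h' hcd hO hN
      obtain ⟨rfl, rfl⟩ := List.cons.inj h3
      obtain rfl := hj.unique (isLX_seg (h'.a_le hcd) _ _)
      -- Without an `XY`-edge, connectivity leaves a link through `Y`; the rest mirrors the previous
      -- case.
      have hlt := (h.exists_link hG hO hN j h1).resolve_left
        (mt (linkedXY_iff h hg hO hN h2 h' hcd).2 hlink)
      have hb : b' = i + 1 := by
        by_contra hne
        have := h.hgb; have := h.hbq; have := h.hea
        have h4 := h.jy ⟨i + 1, by omega⟩ le_rfl (by simp only; omega)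
        have := hO.lastX_mono hN (j := i) (l := ⟨i + 1, by omega⟩)
          (Fin.le_def.2 (by simp only; omega))
        omega
      obtain ⟨w, q, hq, hqs, hq1, hq2⟩ := ih hcd hL'' (Or.inl rfl)
      obtain ⟨p, hp, hs, hK⟩ := hPi
      rw [h1, h2] at hq1 hq2
      have hadj : G.Adj (O.y i) (O.x j) :=
        hO.adj_of_lt_lastX hN (h.adj hg hO hN le_rfl (h.a_le hg) (h.b_le hg) le_rfl).symm
          (Fin.le_def.2 (by
            have := h.hea; have : (a : ℕ) ≤ e := h.a_le hg; omega)) (by omega)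
      obtain ⟨r, hr, hrs⟩ := exists_append_path hp hq hadj (by
        rw [hs, hqs]; exact fun z hz hz' => (hKtail hg h (hK z hz)).2 (hq1 z hz'))
      refine ⟨_, r, hr, by rw [hrs, hs, hqs], fun z hz => ?_, fun z hz => ?_⟩
      · rcases List.mem_append.1 hz with hz | hz
        · exact (hKtail hg h (hK z hz)).1
        · exact htail hg h (hq1 z hz)
      · by_cases hz' : z ∈ O.tail a' b'
        · obtain ⟨y, hy, hy'⟩ := hq2 z hz'
          exact ⟨y, List.mem_append_right _ hy, hy'⟩
        · obtain ⟨y, hy, hy'⟩ := h.dominates_of_endY hg hO hN hv hb ⟨p, hp, hs, hK⟩ hz hz'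
          exact ⟨y, List.mem_append_left _ hy, hy'⟩

/-- The algorithm can be carried out. -/
theorem Ordering.Good.exists_domPathLoop (hO : O.IsStrong)
    (hN : ∀ v, ∃ w, G.Adj v w) (hg : O.Good a b) (hL : Decomposes O (O.tail a b) L) {v : V}
    (hv : v = O.x a ∨ v = O.y b) : ∃ P, DomPathLoop O L v P := by
  classical
  induction L generalizing a b v with
  | nil =>
    obtain ⟨e, g, a', b', h⟩ := hg.exists_isBlock
    obtain ⟨L', hL', hL''⟩ := hL.of_good h hg hO hN
    simp at hL'
  | cons B L ih =>
    obtain ⟨e, g, a', b', h⟩ := hg.exists_isBlock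
    obtain ⟨L', hL', hL''⟩ := hL.of_good h hg hO hN
    obtain ⟨rfl, rfl⟩ := List.cons.inj hL'
    have hX := h.isPathIn_partX hg hO hN hv
    have hY := h.isPathIn_partY hg hO hN hv
    have rX : O.IsRX (O.block a b e g a' b').K e := isRX_seg (h.a_le hg) _ _
    have rY : O.IsRY (O.block a b e g a' b').K g := isRY_seg (h.b_le hg) _ _
    rcases h.next hO hN with ⟨h1, h2⟩ | ⟨c, d, h1, h2, hcd⟩
    · obtain rfl := hL''.eq_nil h1.ge h2.ge
      by_cases hJ : (O.block a b e g a' b').J ⊆ Set.range O.y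
      · exact ⟨_, .lastX hJ rX hX⟩
      · exact ⟨_, .lastY hJ rY hY⟩
    · rw [← h1, ← h2] at hL''
      obtain ⟨e', g', c', d', h'⟩ := hcd.exists_isBlock
      obtain ⟨L'', rfl, -⟩ := hL''.of_good h' hcd hO hN
      by_cases hlink : LinkedXY O (O.block a b e g a' b').K (O.block c d e' g' c' d').K
      · obtain ⟨Q, hQ⟩ := ih hcd hL'' (Or.inr rfl)
        exact ⟨_, .stepXY hlink rX hX (isLY_seg (h'.b_le hcd) _ _) hQ⟩
      · obtain ⟨Q, hQ⟩ := ih hcd hL'' (Or.inl rfl)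
        exact ⟨_, .stepYX hlink rY hY (isLX_seg (h'.a_le hcd) _ _) hQ⟩

theorem ecc_le_one {S : Set V} [Nonempty V] (h : ∀ z, ∃ y ∈ S, z = y ∨ G.Adj z y) :
    ecc G S ≤ 1 := by
  refine ciSup_le fun z => ?_
  obtain ⟨y, hy, hzy⟩ := h z
  have hle : distSet G z S ≤ G.dist z y := Nat.sInf_le ⟨y, hy, rfl⟩
  refine hle.trans ?_
  rcases hzy with rfl | hzy
  · simp
  · exact (SimpleGraph.dist_eq_one_iff_adj.2 hzy).le

theorem correctness [Nontrivial V] (hG : G.Connected) (hO : O.IsStrong) :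
    (∃ L, IsCompleteBipartiteDecomposition O L) ∧
      ∀ L, IsCompleteBipartiteDecomposition O L →
        (∃ P, DomPathReturns O L P) ∧ ∀ P, DomPathReturns O L P → IsDominatingPath G P := by
  have hN := hG.preconnected.exists_adj_of_nontrivial
  obtain ⟨a, b, ha, hb, hg⟩ := Good.zero hG O
  have htail : O.tail a b = Set.univ := by rw [ha, hb, tail_zero]
  unfold IsCompleteBipartiteDecomposition
  rw [← htail]
  refine ⟨hg.exists_decomposes hO hN, fun L hL => ?_⟩
  obtain ⟨e, g, a', b', h⟩ := hg.exists_isBlock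
  obtain ⟨L', hL', -⟩ := hL.of_good h hg hO hN
  have hLX : O.IsLX (O.block a b e g a' b').K a := isLX_seg (h.a_le hg) _ _
  constructor
  · obtain ⟨P, hP⟩ := hg.exists_domPathLoop hO hN hL (Or.inl rfl)
    exact ⟨P, _, _, a, hL', hLX, hP⟩
  · rintro P ⟨B, L'', i, h1, h2, h3⟩
    rw [hL'] at h1
    obtain ⟨rfl, rfl⟩ := List.cons.inj h1
    obtain rfl := h2.unique hLX
    obtain ⟨w, p, hp, hs, -, hd⟩ := h3.exists_path hG hO hN hg hL (Or.inl rfl)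
    refine ⟨_, w, p, hp, hs, ecc_le_one fun z => hd z ?_⟩
    rw [htail]; trivial

theorem isDominatingPath_single [Subsingleton V] (v : V) : IsDominatingPath G [v] :=
  have : Nonempty V := ⟨v⟩
  ⟨v, v, .nil, .nil, rfl, ecc_le_one fun z => ⟨v, by simp, Or.inl (Subsingleton.elim _ _)⟩⟩

theorem pe_le_one [Finite V] (hG : G.Connected) (hB : IsBipartitePermutationGraph G) :
    pe G ≤ 1 := by
  obtain ⟨P, u, w, p, hp, hs, he⟩ : ∃ P, IsDominatingPath G P := by
    rcases subsingleton_or_nontrivial V with h | h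
    · obtain ⟨v⟩ := hG.nonempty
      exact ⟨[v], isDominatingPath_single v⟩
    · obtain ⟨O, hO⟩ := exists_isStrong hB hG.preconnected.exists_adj_of_nontrivial
      obtain ⟨⟨L, hL⟩, h'⟩ := correctness hG hO
      obtain ⟨⟨P, hP⟩, h''⟩ := h' L hL
      exact ⟨P, h'' P hP⟩
  have hle : pe G ≤ ecc G {v | v ∈ p.support} := Nat.sInf_le ⟨u, w, p, hp, rfl⟩
  rw [hs] at hle
  exact hle.trans he

end PathEcc

/-! ### A program logic with time bounds. -/

namespace RAM

namespace State

@[simp] theorem setReg_reg (s : State) (r k r' : ℕ) :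
    (s.setReg r k).reg r' = if r' = r then k else s.reg r' := by
  simp [setReg, Function.update_apply]

@[simp] theorem setReg_arr (s : State) (r k : ℕ) : (s.setReg r k).arr = s.arr := rfl

@[simp] theorem setArr_reg (s : State) (a i k : ℕ) : (s.setArr a i k).reg = s.reg := rfl

theorem setArr_arr (s : State) (a i k a' : ℕ) :
    (s.setArr a i k).arr a' = if a' = a then Function.update (s.arr a) i k else s.arr a' := by
  by_cases h : a' = a
  · subst h; simp [setArr]
  · simp [setArr, h]

@[simp] theorem setArr_arr_apply (s : State) (a i k a' i' : ℕ) :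
    (s.setArr a i k).arr a' i' = if a' = a ∧ i' = i then k else s.arr a' i' := by
  rw [setArr_arr]
  by_cases h : a' = a
  · subst h; simp [Function.update_apply]
  · simp [h]

end State

namespace Program

/-- The registers that a program may change. -/
def regs : Program → List ℕ
  | skip => []
  | set r _ => [r]
  | write _ _ _ => []
  | seq c d => c.regs ++ d.regs
  | ite _ c d => c.regs ++ d.regs
  | loop _ c => c.regs

/-- The arrays that a program may change. -/
def arrs : Program → List ℕ
  | skip => []
  | set _ _ => []
  | write a _ _ => [a]
  | seq c d => c.arrs ++ d.arrs
  | ite _ c d => c.arrs ++ d.arrs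
  | loop _ c => c.arrs

def loopFree : Program → Bool
  | skip => true
  | set _ _ => true
  | write _ _ _ => true
  | seq c d => c.loopFree && d.loopFree
  | ite _ c d => c.loopFree && d.loopFree
  | loop _ _ => false

/-- The final state of a program without loops. -/
def exec : Program → State → State
  | skip, s => s
  | set r e, s => s.setReg r (e.eval s)
  | write a i e, s => s.setArr a (i.eval s) (e.eval s)
  | seq c d, s => d.exec (c.exec s)
  | ite e c d, s => if e.eval s = 0 then d.exec s else c.exec s
  | loop _ _, s => s

/-- A bound for the running time of a program without loops. -/
def cost : Program → ℕ
  | skip => 1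
  | set _ e => e.cost + 1
  | write _ i e => i.cost + e.cost + 1
  | seq c d => c.cost + d.cost
  | ite e c d => e.cost + 1 + max c.cost d.cost
  | loop _ _ => 0

end Program

/-- `s'` differs from `s` only in registers and arrays that `c` may change. -/
structure Agree (c : Program) (s s' : State) : Prop where
  reg : ∀ r, r ∉ c.regs → s'.reg r = s.reg r
  arr : ∀ a, a ∉ c.arrs → s'.arr a = s.arr a

theorem Agree.refl (c : Program) (s : State) : Agree c s s := ⟨fun _ _ => rfl, fun _ _ => rfl⟩

theorem Agree.trans {c : Program} {s s' s'' : State} (h : Agree c s s') (h' : Agree c s' s'') :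
    Agree c s s'' :=
  ⟨fun r hr => (h'.reg r hr).trans (h.reg r hr), fun a ha => (h'.arr a ha).trans (h.arr a ha)⟩

theorem Agree.weaken {c d : Program} {s s' : State} (h : Agree c s s') (hr : c.regs ⊆ d.regs)
    (ha : c.arrs ⊆ d.arrs) : Agree d s s' :=
  ⟨fun r h' => h.reg r fun hh => h' (hr hh), fun a h' => h.arr a fun hh => h' (ha hh)⟩

/-- This is the frame rule. For concrete programs, membership in `regs` and `arrs` is settled by
`decide`. -/
theorem Runs.agree {c : Program} {s s' : State} {t : ℕ} (h : Runs c s s' t) : Agree c s s' := by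
  induction h with
  | skip s => exact .refl _ _
  | set s r e => exact ⟨fun r' hr => by simp [Program.regs] at hr; simp [hr], fun _ _ => rfl⟩
  | write s a i e =>
    exact ⟨fun _ _ => rfl, fun a' ha => by
      simp [Program.arrs] at ha; simp [State.setArr_arr, ha]⟩
  | seq _ _ ih ih' =>
    exact (ih.weaken (List.subset_append_left _ _) (List.subset_append_left _ _)).trans
      (ih'.weaken (List.subset_append_right _ _) (List.subset_append_right _ _))
  | iteTrue _ _ ih =>
    exact ih.weaken (List.subset_append_left _ _) (List.subset_append_left _ _)
  | iteFalse _ _ ih =>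
    exact ih.weaken (List.subset_append_right _ _) (List.subset_append_right _ _)
  | loopDone _ => exact .refl _ _
  | loopStep _ _ _ ih ih' =>
    exact Agree.trans ⟨ih.reg, ih.arr⟩ ih'

/-- Started in `s`, the program halts after at most `T` steps in a state satisfying `Q`. -/
def Ends (c : Program) (s : State) (T : ℕ) (Q : State → Prop) : Prop :=
  ∃ s' t, Runs c s s' t ∧ t ≤ T ∧ Q s'

variable {c d : Program} {s : State} {T T' : ℕ} {Q Q' : State → Prop}

/-- Besides weakening the bound and the postcondition, this supplies `Agree c s s'`, by which the
data that `c` does not touch are carried along. -/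
theorem Ends.mono (h : Ends c s T Q) (hT : T ≤ T') (hQ : ∀ s', Agree c s s' → Q s' → Q' s') :
    Ends c s T' Q' := by
  obtain ⟨s', t, h1, h2, h3⟩ := h
  exact ⟨s', t, h1, h2.trans hT, hQ s' h1.agree h3⟩

theorem Ends.seq (h : Ends c s T fun s' => Ends d s' T' Q) : Ends (.seq c d) s (T + T') Q := by
  obtain ⟨s', t, h1, h2, s'', t', h3, h4, h5⟩ := h
  exact ⟨s'', t + t', .seq h1 h3, by omega, h5⟩

/-- A program without loops has its final state given by a function, so its effect can be computed
by `simp`. -/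
theorem Program.runs_exec : ∀ (c : Program) (s : State), c.loopFree = true →
    ∃ t ≤ c.cost, Runs c s (c.exec s) t
  | .skip, s, _ => ⟨1, le_rfl, .skip s⟩
  | .set r e, s, _ => ⟨_, le_rfl, .set s r e⟩
  | .write a i e, s, _ => ⟨_, le_rfl, .write s a i e⟩
  | .seq c d, s, h => by
    simp only [loopFree, Bool.and_eq_true] at h
    obtain ⟨t, h1, h2⟩ := c.runs_exec s h.1
    obtain ⟨t', h3, h4⟩ := d.runs_exec (c.exec s) h.2
    exact ⟨_, Nat.add_le_add h1 h3, .seq h2 h4⟩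
  | .ite e c d, s, h => by
    simp only [loopFree, Bool.and_eq_true] at h
    by_cases he : e.eval s = 0
    · obtain ⟨t, h1, h2⟩ := d.runs_exec s h.2
      refine ⟨e.cost + 1 + t, by simp only [cost]; omega, ?_⟩
      simpa only [exec, he, if_true] using .iteFalse he h2
    · obtain ⟨t, h1, h2⟩ := c.runs_exec s h.1
      refine ⟨e.cost + 1 + t, by simp only [cost]; omega, ?_⟩
      simpa only [exec, he, if_false] using .iteTrue he h2
  | .loop _ _, _, h => by simp [loopFree] at h

theorem Ends.exec (hc : c.loopFree = true) (hQ : Q (c.exec s)) : Ends c s c.cost Q := by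
  obtain ⟨t, h1, h2⟩ := c.runs_exec s hc
  exact ⟨_, t, h2, h1, hQ⟩

theorem Ends.ite {e : Expr} (h1 : e.eval s ≠ 0 → Ends c s T Q) (h2 : e.eval s = 0 → Ends d s T Q) :
    Ends (.ite e c d) s (e.cost + 1 + T) Q := by
  by_cases he : e.eval s = 0
  · obtain ⟨s', t, h3, h4, h5⟩ := h2 he
    exact ⟨s', _, .iteFalse he h3, by omega, h5⟩
  · obtain ⟨s', t, h3, h4, h5⟩ := h1 he
    exact ⟨s', _, .iteTrue he h3, by omega, h5⟩

/-- The rule for loops: `I φ s` is an invariant with a potential `φ` that pays for the steps. -/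
theorem Ends.loop {e : Expr} (I : ℕ → State → Prop) {φ : ℕ} (h0 : I φ s)
    (step : ∀ φ s', Agree c s s' → I φ s' → e.eval s' ≠ 0 →
      ∃ B, Ends c s' B fun s'' => ∃ φ', φ' + B + (e.cost + 1) ≤ φ ∧ I φ' s'') :
    Ends (.loop e c) s (φ + (e.cost + 1)) fun s' => e.eval s' = 0 ∧ ∃ φ', I φ' s' := by
  suffices H : ∀ φ s', Agree c s s' → I φ s' →
      Ends (.loop e c) s' (φ + (e.cost + 1)) fun s' => e.eval s' = 0 ∧ ∃ φ', I φ' s' from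
    H φ s (.refl _ _) h0
  intro φ
  induction φ using Nat.strong_induction_on with
  | _ φ ih =>
    intro s' ha hI
    by_cases he : e.eval s' = 0
    · exact ⟨s', _, .loopDone he, by omega, he, φ, hI⟩
    · obtain ⟨B, s'', t, h1, h2, φ', h3, h4⟩ := step φ s' ha hI he
      obtain ⟨s3, t', h5, h6, h7⟩ := ih φ' (by omega) s'' (ha.trans h1.agree) h4
      exact ⟨s3, _, .loopStep he h1 h5, by omega, h7⟩

/-- Run `c` for the values of register `i` up to, and not including, that of register `N`. -/
def rangeLoop (i N : ℕ) (c : Program) : Program :=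
  .loop (.lt (.reg i) (.reg N)) (.seq c (.set i (.add (.reg i) (.const 1))))

/-- Each round costs eight steps besides `c`: four for the test and four for the increment. The
final test costs four more. By `hI` the invariant is insensitive to the counter, which changes after
`c`. -/
theorem Ends.rangeLoop {i N lo hi : ℕ} (hlo : s.reg i = lo) (hhi : s.reg N = hi) (hle : lo ≤ hi)
    (hiN : N ≠ i) (hic : i ∉ c.regs) (hNc : N ∉ c.regs) (I : ℕ → State → Prop)
    (hI : ∀ k s m, I k s → I k (s.setReg i m)) (B : ℕ → ℕ) (h0 : I lo s)
    (step : ∀ k, lo ≤ k → k < hi → ∀ s', Agree (RAM.rangeLoop i N c) s s' → s'.reg i = k →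
      I k s' → Ends c s' (B k) (I (k + 1))) :
    Ends (RAM.rangeLoop i N c) s ((∑ k ∈ Finset.Ico lo hi, (B k + 8)) + 4) (I hi) := by
  have hcost : (Expr.lt (.reg i) (.reg N)).cost + 1 = 4 := rfl
  refine (Ends.loop (φ := ∑ k ∈ Finset.Ico lo hi, (B k + 8))
    (fun φ s' => ∃ k, lo ≤ k ∧ k ≤ hi ∧ s'.reg i = k ∧ I k s' ∧
      φ = ∑ k ∈ Finset.Ico k hi, (B k + 8)) ⟨lo, le_rfl, hle, hlo, h0, rfl⟩ ?_).mono
    (by rw [hcost]) ?_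
  · rintro φ s' ha ⟨k, h1, h2, h3, h4, rfl⟩ he
    have hN : s'.reg N = hi := by
      rw [ha.reg N (by simp [Program.regs, hNc, hiN]), hhi]
    have hk : k < hi := by
      by_contra hk
      simp [Expr.eval, h3, hN, hk] at he
    refine ⟨B k + 4, ((step k h1 hk s' ⟨ha.reg, ha.arr⟩ h3 h4).mono le_rfl ?_).seq⟩
    intro s'' ha' hI'
    refine Ends.exec rfl ⟨_, ?_, k + 1, by omega, by omega, ?_, hI _ _ _ hI', rfl⟩
    · rw [hcost, Finset.sum_eq_sum_Ico_succ_bot hk]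
      omega
    · simp [Program.exec, Expr.eval, ha'.reg i hic, h3]
  · rintro s' ha ⟨he, φ, k, h1, h2, h3, h4, -⟩
    have hN : s'.reg N = hi := by
      rw [ha.reg N (by simp [Program.regs, hNc, hiN]), hhi]
    have : k = hi := by
      by_contra hk
      have : k < hi := by omega
      simp [Expr.eval, h3, hN, this] at he
    rw [← this]
    exact h4

/-- Run `c` for the values of register `i` from `0` up to, and not including, that of `N`. -/
def forLoop (i N : ℕ) (c : Program) : Program := .seq (.set i (.const 0)) (rangeLoop i N c)

theorem Ends.forLoop {i N m : ℕ} (hm : s.reg N = m) (hiN : N ≠ i) (hic : i ∉ c.regs)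
    (hNc : N ∉ c.regs) (I : ℕ → State → Prop) (hI : ∀ k s m, I k s → I k (s.setReg i m))
    (B : ℕ → ℕ) (h0 : I 0 s)
    (step : ∀ k < m, ∀ s', Agree (RAM.forLoop i N c) s s' → s'.reg i = k →
      I k s' → Ends c s' (B k) (I (k + 1))) :
    Ends (RAM.forLoop i N c) s ((∑ k ∈ Finset.range m, (B k + 8)) + 6) (I m) := by
  have h : Ends (.set i (.const 0)) s 2 fun s' =>
      Ends (RAM.rangeLoop i N c) s' ((∑ k ∈ Finset.range m, (B k + 8)) + 4) (I m) := by
    refine Ends.exec rfl ?_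
    rw [Finset.range_eq_Ico]
    refine Ends.rangeLoop (by simp [Program.exec, Expr.eval]) (by simp [Program.exec, hiN, hm])
      (Nat.zero_le _) hiN hic hNc I hI B (hI _ _ _ h0) fun k _ hk s' ha => step k hk s' ?_
    refine Agree.trans (s' := Program.exec (.set i (.const 0)) s) ⟨fun r hr => ?_, fun a _ => rfl⟩
      (ha.weaken (List.subset_append_right _ _) (List.subset_append_right _ _))
    have : r ≠ i := by
      rintro rfl
      simp [RAM.forLoop, Program.regs] at hr
    simp [Program.exec, this]
  exact (h.seq).mono (by omega) fun _ _ h => h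

theorem Ends.forLoop_const {i N m : ℕ} (hm : s.reg N = m) (hiN : N ≠ i) (hic : i ∉ c.regs)
    (hNc : N ∉ c.regs) (I : ℕ → State → Prop) (hI : ∀ k s m, I k s → I k (s.setReg i m))
    (B : ℕ) (h0 : I 0 s)
    (step : ∀ k < m, ∀ s', Agree (RAM.forLoop i N c) s s' → s'.reg i = k →
      I k s' → Ends c s' B (I (k + 1))) :
    Ends (RAM.forLoop i N c) s (m * (B + 8) + 6) (I m) :=
  (Ends.forLoop hm hiN hic hNc I hI (fun _ => B) h0 step).mono (by simp) fun _ _ h => h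

/-! ### Scanning adjacency lists -/

/-- The graph given by `adj` is stored in register `0` and in arrays `0` and `1`. -/
structure Input {n : ℕ} (adj : Fin n → List (Fin n)) (s : State) : Prop where
  size : s.reg 0 = n
  off : ∀ v : Fin n, s.arr 0 (v + 1) = s.arr 0 v + (adj v).length
  nbr : ∀ (v : Fin n) (i : ℕ) (h : i < (adj v).length), s.arr 1 (s.arr 0 v + i) = (adj v)[i]

theorem Input.congr {n : ℕ} {adj : Fin n → List (Fin n)} {s s' : State} (h : Input adj s)
    (h0 : s'.reg 0 = s.reg 0) (h1 : s'.arr 0 = s.arr 0) (h2 : s'.arr 1 = s.arr 1) :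
    Input adj s' := by
  obtain ⟨a, b, c⟩ := h
  exact ⟨h0 ▸ a, h1 ▸ b, h2 ▸ h1 ▸ c⟩

theorem Input.agree {n : ℕ} {adj : Fin n → List (Fin n)} {s s' : State} (h : Input adj s)
    (ha : Agree c s s') (h0 : 0 ∉ c.regs) (h1 : 0 ∉ c.arrs) (h2 : 1 ∉ c.arrs) : Input adj s' :=
  h.congr (ha.reg 0 h0) (ha.arr 0 h1) (ha.arr 1 h2)

theorem flatten_getElem?_take {α : Type*} (L : List (List α)) (k : ℕ) (hk : k < L.length) (i : ℕ)
    (hi : i < L[k].length) : L.flatten[(L.take k).flatten.length + i]? = some L[k][i] := by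
  induction L generalizing k with
  | nil => simp at hk
  | cons l L ih =>
    cases k with
    | zero => simp at hi ⊢; rw [List.getElem?_append_left hi]; simp
    | succ k =>
      simp only [List.take_succ_cons, List.flatten_cons, List.length_append, List.getElem_cons_succ]
        at hi ⊢
      rw [List.getElem?_append_right (by omega)]
      rw [show l.length + (L.take k).flatten.length + i - l.length =
        (L.take k).flatten.length + i by omega]
      exact ih k (by simpa using hk) hi

theorem input_inputState {n : ℕ} (adj : Fin n → List (Fin n)) : Input adj (inputState adj) where
  size := by simp [inputState]
  off v := by
    have h1 : (v : ℕ) + 1 ≤ n := v.2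
    have h2 : (v : ℕ) ≤ n := v.2.le
    simp only [inputState, if_true, h1, h2]
    rw [List.take_add_one]
    simp
  nbr v i h := by
    have h2 : (v : ℕ) ≤ n := v.2.le
    simp only [inputState, if_true, h2, one_ne_zero, if_false]
    rw [flatten_getElem?_take _ v (by simp) i (by simpa using h)]
    simp

/-- Run `c` for all neighbours of the vertex in register `20`; register `23` holds the current
neighbour. -/
def edgeLoop (c : Program) : Program :=
  .seq (.set 21 (.read 0 (.reg 20)))
    (.seq (.set 22 (.read 0 (.add (.reg 20) (.const 1))))
      (rangeLoop 21 22 (.seq (.set 23 (.read 1 (.reg 21))) c)))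

/-- The argument of `I` is the list of neighbours already visited. To the eight steps of a round,
three are added for fetching the neighbour; the constant 12 is for reading the two offsets and the
final test. -/
theorem Ends.edgeLoop {n : ℕ} {adj : Fin n → List (Fin n)} (hin : Input adj s) {v : Fin n}
    (hv : s.reg 20 = v) (h21 : 21 ∉ c.regs) (h22 : 22 ∉ c.regs)
    (ha1 : 1 ∉ c.arrs) (I : List (Fin n) → State → Prop)
    (hI : ∀ l s s', s'.arr = s.arr → (∀ r, r ≠ 21 → r ≠ 22 → r ≠ 23 → s'.reg r = s.reg r) →
      I l s → I l s') (B : ℕ) (h0 : I [] s)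
    (step : ∀ l w, w ∈ adj v → ∀ s', Agree (RAM.edgeLoop c) s s' →
      s'.reg 23 = w → I l s' → Ends c s' B (I (l ++ [w]))) :
    Ends (RAM.edgeLoop c) s ((adj v).length * (B + 11) + 12) (I (adj v)) := by
  have hoff := hin.off v
  have hset : ∀ r m, (r = 21 ∨ r = 22 ∨ r = 23) → ∀ l s, I l s → I l (s.setReg r m) := by
    intro r m hr l s h
    refine hI l s _ rfl (fun r' h1 h2 h3 => ?_) h
    have : r' ≠ r := by omega
    simp [this]
  let s2 := (s.setReg 21 (s.arr 0 v)).setReg 22 (s.arr 0 (v + 1))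
  have hs2 : ∀ r, r ≠ 21 → r ≠ 22 → s2.reg r = s.reg r := fun r h1 h2 => by simp [s2, h1, h2]
  have key : Ends (RAM.rangeLoop 21 22 (.seq (.set 23 (.read 1 (.reg 21))) c)) s2
      ((adj v).length * (B + 11) + 4) (I (adj v)) := by
    refine (Ends.rangeLoop (lo := s.arr 0 v) (hi := s.arr 0 (v + 1)) (by simp [s2]) (by simp [s2])
      (by omega) (by decide) (by simpa [Program.regs] using h21)
      (by simpa [Program.regs] using h22)
      (fun k s' => I ((adj v).take (k - s.arr 0 v)) s')
      (fun k s m h => hset 21 m (by simp) _ _ h) (fun _ => 3 + B) ?_ ?_).mono ?_ ?_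
    · simp only [Nat.sub_self, List.take_zero]
      exact hset _ _ (by simp) _ _ (hset _ _ (by simp) _ _ h0)
    · intro k h1 h2 s' ha h3 h4
      have hk : k - s.arr 0 v < (adj v).length := by omega
      have hA : Agree (RAM.edgeLoop c) s s' := by
        refine Agree.trans (s' := s2) ⟨fun r hr => hs2 r ?_ ?_, fun a _ => rfl⟩
          (ha.weaken ?_ ?_)
        · rintro rfl; simp [RAM.edgeLoop, Program.regs] at hr
        · rintro rfl; simp [RAM.edgeLoop, Program.regs] at hr
        · intro r hr; exact List.mem_append_right _ (List.mem_append_right _ hr)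
        · intro r hr; exact List.mem_append_right _ (List.mem_append_right _ hr)
      refine Ends.seq (T := 3) (Ends.exec rfl ?_)
      have hw : s'.arr 1 k = (adj v)[k - s.arr 0 v] := by
        have := hin.nbr v (k - s.arr 0 v) hk
        rw [Nat.add_sub_cancel' h1] at this
        rw [← this, hA.arr 1 (by simpa [RAM.edgeLoop, RAM.rangeLoop, Program.arrs] using ha1)]
      have hreg : (Program.exec (.set 23 (.read 1 (.reg 21))) s') = s'.setReg 23 (s'.arr 1 k) := by
        simp [Program.exec, Expr.eval, h3]
      rw [hreg]
      refine (step ((adj v).take (k - s.arr 0 v)) (adj v)[k - s.arr 0 v] (List.getElem_mem _) _ ?_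
        (by simp [hw]) (hset 23 _ (by simp) _ _ h4)).mono le_rfl ?_
      · refine hA.trans ⟨fun r hr => ?_, fun _ _ => rfl⟩
        have : r ≠ 23 := by
          rintro rfl; simp [RAM.edgeLoop, RAM.rangeLoop, Program.regs] at hr
        simp [this]
      · intro s'' _ h
        rw [show k + 1 - s.arr 0 v = k - s.arr 0 v + 1 by omega, List.take_add_one]
        simpa [hk] using h
    · have : s.arr 0 (v + 1) - s.arr 0 v = (adj v).length := by omega
      simp only [Finset.sum_const, Nat.card_Ico, this, smul_eq_mul]
      exact le_of_eq (by ring)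
    · intro s' _ h
      have : s.arr 0 (v + 1) - s.arr 0 v = (adj v).length := by omega
      simpa [this] using h
  have h2 : Ends (.set 22 (.read 0 (.add (.reg 20) (.const 1)))) (s.setReg 21 (s.arr 0 v)) 5
      fun s' => Ends (RAM.rangeLoop 21 22 (.seq (.set 23 (.read 1 (.reg 21))) c)) s'
        ((adj v).length * (B + 11) + 4) (I (adj v)) := by
    refine Ends.exec rfl ?_
    simpa [Program.exec, Expr.eval, hv] using key
  have h1 : Ends (.set 21 (.read 0 (.reg 20))) s 3 fun s' => Ends (.seq
      (.set 22 (.read 0 (.add (.reg 20) (.const 1))))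
      (RAM.rangeLoop 21 22 (.seq (.set 23 (.read 1 (.reg 21))) c))) s'
      (5 + ((adj v).length * (B + 11) + 4)) (I (adj v)) := by
    refine Ends.exec rfl ?_
    simpa [Program.exec, Expr.eval, hv] using h2.seq
  exact h1.seq.mono (by omega) fun _ _ h => h

end RAM

namespace RAM

open PathEcc

theorem HoldsList.push {n : ℕ} {s s' : State} {r a : ℕ} {P : List (Fin n)} {w : Fin n}
    (h : HoldsList s r a P) (hr : s'.reg r = s.reg r + 1)
    (ha : ∀ i, s'.arr a i = if i = s.reg r then (w : ℕ) else s.arr a i) :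
    HoldsList s' r a (P ++ [w]) := by
  refine ⟨by simp [hr, h.1], fun i hi => ?_⟩
  rw [ha, h.1]
  simp only [List.length_append, List.length_singleton] at hi
  rw [List.getElem_append]
  split_ifs with h1 h2 h2
  · omega
  · simp
  · exact h.2 i h2
  · omega

theorem HoldsList.congr {n : ℕ} {s s' : State} {r a : ℕ} {P : List (Fin n)}
    (h : HoldsList s r a P) (hr : s'.reg r = s.reg r) (ha : s'.arr a = s.arr a) :
    HoldsList s' r a P := by
  unfold HoldsList at h ⊢
  rwa [hr, ha]

/-! ### Breadth-first search -/

section BFS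

variable {n : ℕ} {G : SimpleGraph (Fin n)} {src : Fin n}

/-- The invariant of breadth-first search: `Q` is the queue, its first `h` vertices have been
processed, and `D` is one plus the level of the vertices seen so far. -/
structure BFSInv (G : SimpleGraph (Fin n)) (src : Fin n) (h : ℕ) (Q : List (Fin n))
    (D : Fin n → ℕ) : Prop where
  nodup : Q.Nodup
  mem : ∀ v, D v ≠ 0 ↔ v ∈ Q
  root : D src = 1
  eq_root : ∀ v, D v = 1 → v = src
  parent : ∀ v ∈ Q, v ≠ src → ∃ u, G.Adj v u ∧ D v = D u + 1
  sorted : Q.Pairwise fun u v => D u ≤ D v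
  spread : ∀ hh : h < Q.length, ∀ u ∈ Q, D u ≤ D Q[h] + 1
  done : ∀ u ∈ Q.take h, ∀ w, G.Adj u w → D w ≠ 0 ∧ D w ≤ D u + 1

theorem BFSInv.init (src : Fin n) {D : Fin n → ℕ} (hD : ∀ v, D v = if v = src then 1 else 0) :
    BFSInv G src 0 [src] D where
  nodup := by simp
  mem v := by rw [hD]; split_ifs with h <;> simp [h]
  root := by simp [hD]
  eq_root v h := by
    rw [hD] at h; by_contra h'; simp [h'] at h
  parent v h h' := by simp at h; exact absurd h h'
  sorted := by simp
  spread hh u hu := by simp at hu; simp [hu]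
  done := by simp

/-- The new label is the largest one that `spread` permits, so the queue stays sorted. -/
theorem BFSInv.push {h : ℕ} {Q : List (Fin n)} {D D' : Fin n → ℕ} (H : BFSInv G src h Q D)
    (hh : h < Q.length) {w : Fin n} (hadj : G.Adj Q[h] w) (hw : D w = 0)
    (hD : ∀ v, D' v = if v = w then D Q[h] + 1 else D v) : BFSInv G src h (Q ++ [w]) D' := by
  have hwQ : w ∉ Q := fun hc => (H.mem w).2 hc hw
  have hDQ : ∀ v ∈ Q, D' v = D v := fun v hv => by
    rw [hD, if_neg]; rintro rfl; exact hwQ hv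
  have hDw : D' w = D Q[h] + 1 := by simp [hD]
  have hpos : D Q[h] ≠ 0 := (H.mem _).2 (List.getElem_mem _)
  refine ⟨?_, ?_, ?_, ?_, ?_, ?_, ?_, ?_⟩
  · exact List.nodup_append'.2 ⟨H.nodup, by simp, by simpa using hwQ⟩
  · intro v
    by_cases hvw : v = w
    · simp [hvw, hDw]
    · simp [hD, hvw, H.mem]
  · rw [hDQ _ ((H.mem _).1 (by simp [H.root])), H.root]
  · intro v hv
    rw [hD] at hv
    split_ifs at hv with hvw
    · omega
    · exact H.eq_root v hv
  · intro v hv hvs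
    rcases List.mem_append.1 hv with hv | hv
    · obtain ⟨u, h1, h2⟩ := H.parent v hv hvs
      refine ⟨u, h1, ?_⟩
      rw [hDQ v hv, h2, hDQ u]
      refine (H.mem u).1 fun h0 => hvs (H.eq_root v (by omega))
    · simp only [List.mem_singleton] at hv
      subst hv
      exact ⟨Q[h], hadj.symm, by rw [hDw, hDQ _ (List.getElem_mem _)]⟩
  · rw [List.pairwise_append]
    refine ⟨H.sorted.imp_of_mem fun h1 h2 h3 => by rwa [hDQ _ h1, hDQ _ h2], by simp, ?_⟩
    intro u hu v hv
    simp only [List.mem_singleton] at hv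
    rw [hv, hDw, hDQ u hu]
    exact H.spread hh u hu
  · intro hh' u hu
    rw [List.getElem_append_left hh, hDQ _ (List.getElem_mem _)]
    rcases List.mem_append.1 hu with hu | hu
    · rw [hDQ u hu]; exact H.spread hh u hu
    · simp only [List.mem_singleton] at hu
      rw [hu, hDw]
  · intro u hu v huv
    rw [List.take_append_of_le_length hh.le] at hu
    obtain ⟨h1, h2⟩ := H.done u hu v huv
    rw [hDQ v ((H.mem v).1 h1), hDQ u (List.mem_of_mem_take hu)]
    exact ⟨h1, h2⟩

theorem BFSInv.next {h : ℕ} {Q : List (Fin n)} {D : Fin n → ℕ} (H : BFSInv G src h Q D)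
    (hh : h < Q.length) (hd : ∀ w, G.Adj Q[h] w → D w ≠ 0) : BFSInv G src (h + 1) Q D := by
  refine ⟨H.nodup, H.mem, H.root, H.eq_root, H.parent, H.sorted, ?_, ?_⟩
  · intro hh' u hu
    have h1 := List.pairwise_iff_getElem.1 H.sorted h (h + 1) hh hh' (by omega)
    have h2 := H.spread hh u hu
    omega
  · intro u hu w huw
    rw [List.take_add_one, List.getElem?_eq_getElem hh] at hu
    rcases List.mem_append.1 hu with hu | hu
    · exact H.done u hu w huw
    · simp only [Option.toList_some, List.mem_singleton] at hu
      subst hu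
      exact ⟨hd w huw, H.spread hh w ((H.mem w).1 (hd w huw))⟩

/-- Once the queue is exhausted, the set of seen vertices is closed under adjacency, hence is
everything by connectivity. -/
theorem BFSInv.isLevels {Q : List (Fin n)} {D : Fin n → ℕ} (H : BFSInv G src Q.length Q D)
    (hG : G.Connected) : (∀ v, D v ≠ 0) ∧ IsLevels G src fun v => D v - 1 := by
  have hd : ∀ u ∈ Q, ∀ w, G.Adj u w → D w ≠ 0 ∧ D w ≤ D u + 1 := by simpa using H.done
  have hall : ∀ v, D v ≠ 0 := by
    intro v
    obtain ⟨p⟩ := hG.preconnected src v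
    by_contra hv
    obtain ⟨d, -, h1, h2⟩ := p.exists_boundary_dart {v | D v ≠ 0} (by simp [H.root])
      (by simpa using hv)
    exact h2 (hd d.fst ((H.mem _).1 h1) d.snd d.adj).1
  refine ⟨hall, ?_, ?_, ?_, ?_⟩
  · simp [H.root]
  · intro v hv
    have := hall v
    exact H.eq_root v (by omega)
  · intro v w hvw
    have := (hd v ((H.mem _).1 (hall v)) w hvw).2
    have := hall v
    omega
  · intro v hv
    obtain ⟨u, h1, h2⟩ := H.parent v ((H.mem v).1 (hall v)) (by
      rintro rfl; simp [H.root] at hv)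
    have := hall u
    exact ⟨u, h1, by omega⟩

/-- The body of the loop over the neighbours. -/
def bfsEdge (q d : ℕ) : Program :=
  .ite (.read d (.reg 23)) .skip
    (.seq (.write d (.reg 23) (.reg 27))
      (.seq (.write q (.reg 26) (.reg 23)) (.set 26 (.add (.reg 26) (.const 1)))))

def bfsBody (q d : ℕ) : Program :=
  .seq (.seq (.set 20 (.read q (.reg 25))) (.set 27 (.add (.read d (.reg 20)) (.const 1))))
    (.seq (edgeLoop (bfsEdge q d)) (.set 25 (.add (.reg 25) (.const 1))))

def bfsInit (q d : ℕ) : Program :=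
  .seq (.write q (.const 0) (.reg 24)) (.seq (.write d (.reg 24) (.const 1))
    (.seq (.set 25 (.const 0)) (.set 26 (.const 1))))

/-- Breadth-first search from the vertex in register `24`: array `q` is the queue, and array `d`
receives one plus the levels of the vertices. -/
def bfs (q d : ℕ) : Program :=
  .seq (bfsInit q d) (.loop (.lt (.reg 25) (.reg 26)) (bfsBody q d))

theorem ends_bfsEdge {q d : ℕ} (hqd : q ≠ d) {s : State} {Q : List (Fin n)} {h : ℕ}
    (hQ : HoldsList s 26 q Q) (H : BFSInv G src h Q fun v => s.arr d v) (hh : h < Q.length)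
    {w : Fin n} (hadj : G.Adj Q[h] w) (hw : s.reg 23 = w) (h27 : s.reg 27 = s.arr d Q[h] + 1) :
    Ends (bfsEdge q d) s 14 fun s' => ∃ Q', Q <+: Q' ∧ HoldsList s' 26 q Q' ∧
      (BFSInv G src h Q' fun v => s'.arr d v) ∧ s'.arr d w ≠ 0 ∧
      ∀ v ∈ Q, s'.arr d v = s.arr d v := by
  have hlen := hQ.1
  refine (Ends.exec (by rfl) ?_).mono (T := (bfsEdge q d).cost) (by simp [bfsEdge, Program.cost, Expr.cost]) fun _ _ h => h
  by_cases h0 : s.arr d w = 0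
  · refine ⟨Q ++ [w], List.prefix_append _ _, hQ.push ?_ ?_, H.push hh hadj h0 ?_, ?_, ?_⟩
    · simp [bfsEdge, Program.exec, Expr.eval, hw, h0]
    · intro i
      simp [bfsEdge, Program.exec, Expr.eval, hw, h0, hqd]
    · intro v
      simp [bfsEdge, Program.exec, Expr.eval, hw, h0, hqd.symm, h27, Fin.ext_iff]
    · simp [bfsEdge, Program.exec, Expr.eval, hw, h0, hqd.symm, h27]
    · intro v hv
      have : v ≠ w := by
        rintro rfl
        exact (H.mem v).2 hv h0
      have : (v : ℕ) ≠ w := fun h => this (Fin.ext h)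
      simp [bfsEdge, Program.exec, Expr.eval, hw, h0, hqd.symm, this]
  · refine ⟨Q, List.prefix_rfl, ?_⟩
    simpa [bfsEdge, Program.exec, Expr.eval, hw, h0] using ⟨hQ, H⟩

theorem ends_bfsBody {adj : Fin n → List (Fin n)} (hadj : IsAdjacencyLists G adj) {q d : ℕ}
    (hqd : q ≠ d) (hq1 : q ≠ 1) (hd1 : d ≠ 1) {s : State} (hin : Input adj s)
    {Q : List (Fin n)} {h : ℕ} (hQ : HoldsList s 26 q Q)
    (H : BFSInv G src h Q fun v => s.arr d v) (hh : h < Q.length) (h25 : s.reg 25 = h) :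
    Ends (bfsBody q d) s ((adj Q[h]).length * 25 + 24) fun s' => ∃ Q', Q <+: Q' ∧
      HoldsList s' 26 q Q' ∧ (BFSInv G src (h + 1) Q' fun v => s'.arr d v) ∧
      s'.reg 25 = h + 1 := by
  have hlen := hQ.1
  have hv : s.arr q h = Q[h] := hQ.2 h hh
  have hedge : ∀ s2, s2.arr = s.arr → s2.reg 20 = (Q[h] : Fin n).val → s2.reg 27 = s.arr d Q[h] + 1 →
      s2.reg 0 = s.reg 0 → s2.reg 26 = s.reg 26 → s2.reg 25 = h →
      Ends (edgeLoop (bfsEdge q d)) s2 ((adj Q[h]).length * (14 + 11) + 12) fun s' => ∃ Q',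
        Q <+: Q' ∧ HoldsList s' 26 q Q' ∧ (BFSInv G src h Q' fun v => s'.arr d v) ∧
        s'.arr d Q[h] = s.arr d Q[h] ∧ ∀ w ∈ adj Q[h], s'.arr d w ≠ 0 := by
    intro s2 harr h20 h27 hr0 hr26 h25
    refine Ends.edgeLoop (hin.congr hr0 (by rw [harr]) (by rw [harr])) h20
      (by simp [bfsEdge, Program.regs]) (by simp [bfsEdge, Program.regs])
      (by simp [bfsEdge, Program.arrs, hq1.symm, hd1.symm])
      (fun l s' => ∃ Q', Q <+: Q' ∧ HoldsList s' 26 q Q' ∧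
        (BFSInv G src h Q' fun v => s'.arr d v) ∧ s'.arr d Q[h] = s.arr d Q[h] ∧
        ∀ w ∈ l, s'.arr d w ≠ 0) ?_ 14 ?_ ?_
    · rintro l s' s'' ha hr ⟨Q', h1, h2, h3, h4, h5⟩
      refine ⟨Q', h1, h2.congr (hr 26 (by decide) (by decide) (by decide)) (by rw [ha]), ?_⟩
      rw [ha]
      exact ⟨h3, h4, h5⟩
    · refine ⟨Q, List.prefix_rfl, hQ.congr hr26 (by rw [harr]), ?_⟩
      rw [harr]
      exact ⟨H, rfl, by simp⟩
    · rintro l w hw s' ha h23 ⟨Q', h1, h2, h3, h4, h5⟩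
      have hh' : h < Q'.length := hh.trans_le h1.length_le
      have hQ' : Q'[h] = Q[h] := (h1.getElem hh).symm
      refine (ends_bfsEdge hqd h2 h3 hh' (w := w) ?_ h23 ?_).mono le_rfl ?_
      · rw [hQ']; exact ((hadj _).2 w).1 hw
      · rw [hQ', ha.reg 27 (by simp [edgeLoop, rangeLoop, bfsEdge, Program.regs]), h27, h4]
      · rintro s'' - ⟨Q'', k1, k2, k3, k4, k5⟩
        refine ⟨Q'', h1.trans k1, k2, k3, ?_, ?_⟩
        · rw [k5 _ (hQ' ▸ List.getElem_mem _), h4]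
        · intro x hx
          rcases List.mem_append.1 hx with hx | hx
          · rw [k5 x ((h3.mem x).1 (h5 x hx))]; exact h5 x hx
          · simp only [List.mem_singleton] at hx
            rw [hx]; exact k4
  unfold bfsBody
  refine (Ends.seq (T := 8) (T' := ((adj Q[h]).length * (14 + 11) + 12) + 4)
    (Ends.exec rfl (Ends.seq (T' := 4)
    ((hedge _ ?_ ?_ ?_ ?_ ?_ ?_).mono le_rfl ?_)))).mono (by omega) fun _ _ h => h
  · rfl
  · simp [Program.exec, Expr.eval, h25, hv]
  · simp [Program.exec, Expr.eval, h25, hv]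
  · simp [Program.exec]
  · simp [Program.exec]
  · simp [Program.exec, h25]
  · rintro s' ha ⟨Q', k1, k2, k3, k4, k5⟩
    have hr25 : s'.reg 25 = h := by
      rw [ha.reg 25 (by simp [edgeLoop, rangeLoop, bfsEdge, Program.regs])]
      simp [Program.exec, h25]
    refine Ends.exec rfl ⟨Q', k1, k2.congr ?_ rfl, ?_, ?_⟩
    · simp [Program.exec]
    · have hh' : h < Q'.length := hh.trans_le k1.length_le
      refine k3.next hh' fun w hw => k5 w ?_
      rw [← k1.getElem hh] at hw
      exact ((hadj _).2 w).2 hw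
    · simp [Program.exec, Expr.eval, hr25]

/-- A zero in array `d` means that the vertex is unseen, so the array must be clean at the start;
each search gets its own. -/
theorem ends_bfs {adj : Fin n → List (Fin n)} (hadj : IsAdjacencyLists G adj) (hG : G.Connected)
    {q d : ℕ} (hqd : q ≠ d) (hq0 : q ≠ 0) (hd0 : d ≠ 0) (hq1 : q ≠ 1) (hd1 : d ≠ 1) {s : State}
    (hin : Input adj s) (h24 : s.reg 24 = src) (hd : ∀ v, s.arr d v = 0) :
    Ends (bfs q d) s ((∑ v, ((adj v).length * 25 + 28)) + 14) fun s' =>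
      (∀ v : Fin n, s'.arr d v ≠ 0) ∧ IsLevels G src fun v => s'.arr d v - 1 := by
  have hinit : ∀ s2, s2 = (bfsInit q d).exec s →
      Ends (.loop (.lt (.reg 25) (.reg 26)) (bfsBody q d)) s2
        ((∑ v, ((adj v).length * 25 + 28)) + 4) fun s' =>
      (∀ v : Fin n, s'.arr d v ≠ 0) ∧ IsLevels G src fun v => s'.arr d v - 1 := by
    intro s2 hs2
    have hin2 : Input adj s2 := by
      refine hin.congr ?_ ?_ ?_
      · simp [hs2, bfsInit, Program.exec]
      · simp [hs2, bfsInit, Program.exec, State.setArr_arr, hq0.symm, hd0.symm]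
      · simp [hs2, bfsInit, Program.exec, State.setArr_arr, hq1.symm, hd1.symm]
    -- The potential is the cost of all vertices not yet processed: 25 per neighbour and 24 per
    -- vertex for the body, and 4 for the test.
    refine (Ends.loop (fun φ s' => ∃ h Q, HoldsList s' 26 q Q ∧
      (BFSInv G src h Q fun v => s'.arr d v) ∧ h ≤ Q.length ∧ s'.reg 25 = h ∧
      φ = ∑ v ∈ Finset.univ.filter (· ∉ Q.take h), ((adj v).length * 25 + 28))
      (φ := ∑ v, ((adj v).length * 25 + 28)) ?_ ?_).mono (by rfl) ?_
    · refine ⟨0, [src], ?_, .init src ?_, by simp, ?_, by simp⟩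
      · refine ⟨by simp [hs2, bfsInit, Program.exec, Expr.eval], fun i hi => ?_⟩
        simp only [List.length_singleton, Nat.lt_one_iff] at hi
        subst hi
        simp [hs2, bfsInit, Program.exec, Expr.eval, h24, hqd]
      · intro v
        simp [hs2, bfsInit, Program.exec, Expr.eval, h24, hqd.symm, hd, Fin.ext_iff]
      · simp [hs2, bfsInit, Program.exec, Expr.eval]
    · rintro φ s' ha ⟨h, Q, h1, h2, h3, h4, rfl⟩ he
      have hlt : h < Q.length := by
        by_contra hc
        simp [Expr.eval, h4, h1.1, hc] at he
      have hin' : Input adj s' := by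
        refine hin2.agree ha ?_ ?_ ?_ <;>
          simp [bfsBody, bfsEdge, edgeLoop, rangeLoop, Program.regs, Program.arrs, hq0.symm,
            hd0.symm, hq1.symm, hd1.symm]
      refine ⟨_, (ends_bfsBody hadj hqd hq1 hd1 hin' h1 h2 hlt h4).mono le_rfl ?_⟩
      rintro s'' - ⟨Q', k1, k2, k3, k4⟩
      have hle := k1.length_le
      refine ⟨_, ?_, h + 1, Q', k2, k3, by omega, k4, rfl⟩
      have htake : Q'.take (h + 1) = Q.take h ++ [Q[h]] := by
        obtain ⟨R, rfl⟩ := k1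
        rw [List.take_append_of_le_length (by omega), List.take_add_one,
          List.getElem?_eq_getElem hlt]
        rfl
      have hnot : Q[h] ∉ Q.take h := by
        intro hc
        rw [List.mem_take_iff_getElem] at hc
        obtain ⟨i, hi, hi'⟩ := hc
        have := (h2.nodup.getElem_inj_iff).1 hi'
        omega
      have hset : Finset.univ.filter (· ∉ Q.take h) =
          insert Q[h] (Finset.univ.filter (· ∉ Q'.take (h + 1))) := by
        ext v
        simp only [htake, Finset.mem_filter, Finset.mem_univ, true_and, Finset.mem_insert,
          List.mem_append, List.mem_singleton]
        by_cases hv : v = Q[h]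
        · simp [hv, hnot]
        · simp [hv]
      have hmem : Q[h] ∈ Q'.take (h + 1) := by
        rw [htake]; exact List.mem_append_right _ (List.mem_singleton_self _)
      rw [hset, Finset.sum_insert (by simp only [Finset.mem_filter, hmem]; simp)]
      have hc : (Expr.lt (.reg 25) (.reg 26)).cost + 1 = 4 := rfl
      rw [hc]
      omega
    · rintro s' - ⟨he, φ, h, Q, h1, h2, h3, h4, -⟩
      have : h = Q.length := by
        by_contra hc
        have : h < Q.length := by omega
        simp [Expr.eval, h4, h1.1, this] at he
      subst this
      exact h2.isLevels hG
  exact (Ends.seq (T := 10) (Ends.exec (by rfl) (hinit _ rfl))).mono (by omega) fun _ _ h => h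

end BFS

end RAM

namespace RAM

open PathEcc

/-! ### Counting -/

section Count

variable {n : ℕ}

theorem card_filter_lt_succ (k : ℕ) (hk : k < n) (p : Fin n → Prop) [DecidablePred p] :
    (Finset.univ.filter fun v : Fin n => (v : ℕ) < k + 1 ∧ p v).card =
      (Finset.univ.filter fun v : Fin n => (v : ℕ) < k ∧ p v).card +
        if p ⟨k, hk⟩ then 1 else 0 := by
  have h : ∀ v : Fin n, (v : ℕ) < k + 1 ↔ v = ⟨k, hk⟩ ∨ (v : ℕ) < k := by
    intro v
    rw [Fin.ext_iff]
    simp only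
    omega
  split_ifs with hp
  · rw [← Finset.card_insert_of_notMem (a := ⟨k, hk⟩) (by simp)]
    congr 1
    ext v
    simp only [Finset.mem_filter, Finset.mem_univ, true_and, Finset.mem_insert, h]
    constructor
    · rintro ⟨h1 | h1, h2⟩
      · exact Or.inl h1
      · exact Or.inr ⟨h1, h2⟩
    · rintro (h1 | ⟨h1, h2⟩)
      · exact ⟨Or.inl h1, h1 ▸ hp⟩
      · exact ⟨Or.inr h1, h2⟩
  · rw [add_zero]
    congr 1
    ext v
    simp only [Finset.mem_filter, Finset.mem_univ, true_and, h]
    refine and_congr_left fun hv => ⟨fun hh => hh.resolve_left ?_, Or.inr⟩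
    rintro rfl
    exact hp hv

/-- Count the vertices with each value of `key`. -/
def countLoop (key cnt : ℕ) : Program :=
  forLoop 28 0 (.seq (.set 30 (.add (.read key (.reg 28)) (.const 1)))
    (.write cnt (.reg 30) (.add (.read cnt (.reg 30)) (.const 1))))

def sumLoop (cnt N : ℕ) : Program :=
  forLoop 28 N (.write cnt (.add (.reg 28) (.const 1))
    (.add (.read cnt (.add (.reg 28) (.const 1))) (.read cnt (.reg 28))))

/-- For all `j` up to register `N`, cell `j` of array `cnt` receives the number of vertices with
`key` less than `j`. -/
def countBelow (key cnt N : ℕ) : Program := .seq (countLoop key cnt) (sumLoop cnt N)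

/-- The first pass counts the vertices with key `j - 1` in cell `j`. This shift makes the prefix
sums count strictly smaller keys. -/
theorem ends_countBelow {key cnt N M : ℕ} (hkc : key ≠ cnt) (hN28 : N ≠ 28) (hN30 : N ≠ 30)
    {s : State} (hn : s.reg 0 = n) (hM : s.reg N = M) {K : Fin n → ℕ}
    (hK : ∀ v : Fin n, s.arr key v = K v) (h0 : ∀ j, s.arr cnt j = 0) :
    Ends (countBelow key cnt N) s (n * 20 + M * 20 + 12) fun s' =>
      ∀ j ≤ M, s'.arr cnt j = (Finset.univ.filter fun v => K v < j).card := by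
  have h1 : Ends (countLoop key cnt) s (n * (12 + 8) + 6) fun s' =>
      ∀ j, s'.arr cnt j = (Finset.univ.filter fun v : Fin n => (v : ℕ) < n ∧ K v + 1 = j).card := by
    refine Ends.forLoop_const hn (by decide) (by simp [Program.regs]) (by simp [Program.regs])
      (fun k s' => ∀ j, s'.arr cnt j =
        (Finset.univ.filter fun v : Fin n => (v : ℕ) < k ∧ K v + 1 = j).card)
      (fun k s m h => h) 12 (by simp [h0]) ?_
    intro k hk s' ha h28 hI
    refine (Ends.exec (by rfl) fun j => ?_).mono (by simp [Program.cost, Expr.cost])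
      fun _ _ h => h
    rw [card_filter_lt_succ k hk]
    have hkey : s'.arr key k = K ⟨k, hk⟩ := by
      rw [ha.arr key (by simp [forLoop, rangeLoop, Program.arrs, hkc])]
      exact hK ⟨k, hk⟩
    simp only [Program.exec, Expr.eval, h28, State.setReg_reg, State.setReg_arr, if_true, hkey,
      State.setArr_arr_apply, true_and, hI]
    by_cases hj : j = K ⟨k, hk⟩ + 1
    · simp [hj]
    · simp [hj, Ne.symm hj]
  have h2 : ∀ s', (∀ j, s'.arr cnt j =
      (Finset.univ.filter fun v : Fin n => (v : ℕ) < n ∧ K v + 1 = j).card) → s'.reg N = M →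
      Ends (sumLoop cnt N) s' (M * (12 + 8) + 6) fun s' =>
        ∀ j ≤ M, s'.arr cnt j = (Finset.univ.filter fun v => K v < j).card := by
    intro s2 hs2 hM2
    refine (Ends.forLoop_const hM2 hN28 (by simp [Program.regs])
      (by simp [Program.regs])
      (fun k s' => ∀ j, s'.arr cnt j = if j ≤ k then (Finset.univ.filter fun v => K v < j).card
        else (Finset.univ.filter fun v => K v + 1 = j).card)
      (fun k s m h => h) 12 ?_ ?_).mono le_rfl ?_
    · intro j
      rw [hs2]
      split_ifs with hj
      · obtain rfl : j = 0 := by omega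
        simp
      · simp
    · intro k hk s' ha h28 hI
      refine (Ends.exec (by rfl) fun j => ?_).mono (by simp [Program.cost, Expr.cost])
        fun _ _ h => h
      simp only [Program.exec, Expr.eval, h28, State.setArr_arr_apply, true_and, hI]
      rcases Nat.lt_trichotomy j (k + 1) with hj | hj | hj
      · simp [hj.ne, Nat.lt_succ_iff.1 hj, hj.le]
      · subst hj
        simp only [if_true, le_refl]
        rw [if_neg (by omega), ← Finset.card_union_of_disjoint]
        · congr 1
          ext v
          simp only [Finset.mem_union, Finset.mem_filter, Finset.mem_univ, true_and]
          omega
        · rw [Finset.disjoint_filter]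
          intro v _ h1 h2
          omega
      · have h1 : ¬ j ≤ k := by omega
        have h2 : ¬ j ≤ k + 1 := by omega
        simp [hj.ne', h1, h2]
    · intro s' _ h j hj
      rw [h j, if_pos hj]
  refine (Ends.seq (T' := M * (12 + 8) + 6) (h1.mono le_rfl fun s' ha h => h2 s' h ?_)).mono
    (by omega) fun _ _ h => h
  rw [ha.reg N (by simp [countLoop, forLoop, rangeLoop, Program.regs, hN28, hN30]), hM]

/-! ### Counting sort -/

/-- The position of `v` when the vertices are sorted by `K`. -/
def rank (K : Fin n → ℕ) (v : Fin n) : ℕ :=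
  (Finset.univ.filter fun u => K u < K v).card +
    (Finset.univ.filter fun u : Fin n => (u : ℕ) < v ∧ K u = K v).card

theorem rank_eq (K : Fin n → ℕ) (v : Fin n) : rank K v =
    (Finset.univ.filter fun u => K u < K v ∨ u < v ∧ K u = K v).card := by
  rw [rank, ← Finset.card_union_of_disjoint]
  · congr 1
    ext u
    simp only [Finset.mem_union, Finset.mem_filter, Finset.mem_univ, true_and, Fin.lt_def]
  · rw [Finset.disjoint_filter]
    intro v _ h1 h2
    omega

theorem rank_lt (K : Fin n → ℕ) {u v : Fin n} (h : K u < K v ∨ u < v ∧ K u = K v) :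
    rank K u < rank K v := by
  rw [rank_eq, rank_eq]
  refine Finset.card_lt_card ⟨fun w hw => ?_, fun hsub => ?_⟩
  · simp only [Finset.mem_filter, Finset.mem_univ, true_and] at hw ⊢
    omega
  · have := hsub (x := u) (by simpa using h)
    simp at this

theorem rank_injective (K : Fin n → ℕ) : Function.Injective (rank K) := by
  intro u v h
  by_contra hne
  rcases Nat.lt_trichotomy (K u) (K v) with h1 | h1 | h1
  · exact (rank_lt K (Or.inl h1)).ne h
  · rcases lt_or_gt_of_ne hne with h2 | h2
    · exact (rank_lt K (Or.inr ⟨h2, h1⟩)).ne h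
    · exact (rank_lt K (Or.inr ⟨h2, h1.symm⟩)).ne h.symm
  · exact (rank_lt K (Or.inl h1)).ne h.symm

theorem rank_lt_n (K : Fin n → ℕ) (v : Fin n) : rank K v < n := by
  rw [rank_eq]
  have : (Finset.univ.filter fun u => K u < K v ∨ u < v ∧ K u = K v).card <
      (Finset.univ : Finset (Fin n)).card :=
    Finset.card_lt_card ⟨Finset.subset_univ _, fun h => by
      simpa using h (Finset.mem_univ v)⟩
  simpa using this

/-- `rank` is injective with values below `n`, hence a bijection, and its inverse lists the vertices
in order. -/
theorem exists_sorted (K : Fin n → ℕ) : ∃ l : List (Fin n), l.Nodup ∧ l.length = n ∧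
    (∀ v, v ∈ l) ∧ l.Pairwise (fun u v => K u ≤ K v) ∧
    ∀ i (h : i < l.length), rank K l[i] = i := by
  let f : Fin n → Fin n := fun v => ⟨rank K v, rank_lt_n K v⟩
  have hf : Function.Injective f := fun u v h => rank_injective K (Fin.ext_iff.1 h)
  let e : Fin n ≃ Fin n := Equiv.ofBijective f (Finite.injective_iff_bijective.1 hf)
  have he : ∀ i, rank K (e.symm i) = i := fun i => by
    have := e.apply_symm_apply i
    exact Fin.ext_iff.1 this
  refine ⟨List.ofFn e.symm, List.nodup_ofFn.2 e.symm.injective, by simp, fun v => ?_, ?_, ?_⟩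
  · rw [List.mem_ofFn]
    exact ⟨e v, by simp⟩
  · rw [List.pairwise_ofFn]
    intro i j hij
    by_contra! hlt
    have := rank_lt K (Or.inl hlt)
    rw [he, he] at this
    exact absurd hij (not_lt.2 (Fin.le_def.2 this.le))
  · intro i h
    simp [he]

/-- Place the vertices in the order of their keys. -/
def placeLoop (key cnt A : ℕ) : Program :=
  forLoop 28 0 (.seq (.set 30 (.read key (.reg 28)))
    (.seq (.write A (.read cnt (.reg 30)) (.reg 28))
      (.write cnt (.reg 30) (.add (.read cnt (.reg 30)) (.const 1)))))

theorem ends_placeLoop {key cnt A M : ℕ} (hkc : key ≠ cnt) (hkA : key ≠ A) (hcA : cnt ≠ A)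
    {s : State} (hn : s.reg 0 = n) {K : Fin n → ℕ}
    (hK : ∀ v : Fin n, s.arr key v = K v) (hKM : ∀ v, K v ≤ M)
    (hc : ∀ j ≤ M, s.arr cnt j = (Finset.univ.filter fun v => K v < j).card) :
    Ends (placeLoop key cnt A) s (n * 30 + 6) fun s' => ∀ v : Fin n, s'.arr A (rank K v) = v := by
  refine (Ends.forLoop_const (m := n) hn (by decide) (by simp [Program.regs])
    (by simp [Program.regs])
    -- Cell `j` of `cnt` is the next free position for key `j`. When vertex `k` is treated, the cell
    -- of its key holds exactly its rank.
    (fun k s' => (∀ j ≤ M, s'.arr cnt j = (Finset.univ.filter fun v => K v < j).card +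
      (Finset.univ.filter fun v : Fin n => (v : ℕ) < k ∧ K v = j).card) ∧
      ∀ v : Fin n, (v : ℕ) < k → s'.arr A (rank K v) = v)
    (fun k s m h => h) 22 ⟨by simpa using hc, by simp⟩ ?_).mono (by omega) ?_
  · rintro k hk s' ha h28 ⟨h1, h2⟩
    have hkey : s'.arr key k = K ⟨k, hk⟩ := by
      rw [ha.arr key (by simp [forLoop, rangeLoop, Program.arrs, hkc, hkA])]
      exact hK ⟨k, hk⟩
    have hcnt : s'.arr cnt (K ⟨k, hk⟩) = rank K ⟨k, hk⟩ := h1 _ (hKM _)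
    refine (Ends.exec (by rfl) ⟨fun j hj => ?_, fun v hv => ?_⟩).mono
      (by simp [Program.cost, Expr.cost]) fun _ _ h => h
    · rw [card_filter_lt_succ k hk, ← add_assoc, ← h1 j hj]
      simp only [Program.exec, Expr.eval, h28, State.setReg_reg, State.setReg_arr, if_true, hkey,
        State.setArr_arr_apply, true_and, State.setArr_reg, hcA, false_and, if_false]
      by_cases hjK : j = K ⟨k, hk⟩
      · simp [hjK]
      · simp [hjK, Ne.symm hjK]
    · simp only [Program.exec, Expr.eval, h28, State.setReg_reg, State.setReg_arr, if_true, hkey,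
        State.setArr_arr_apply, true_and, State.setArr_reg, hcA.symm, false_and, if_false, hcnt]
      by_cases hvk : v = ⟨k, hk⟩
      · simp [hvk]
      · have : rank K v ≠ rank K ⟨k, hk⟩ := fun h => hvk (rank_injective K h)
        rw [if_neg this]
        refine h2 v ?_
        have : (v : ℕ) ≠ k := fun h => hvk (Fin.ext h)
        omega
  · intro s' _ h v
    exact h.2 v v.2

end Count

/-! ### The last vertex -/

section Select

variable {n : ℕ} {adj : Fin n → List (Fin n)}

/-- The degree of the vertex in register `r`. -/
def degExpr (r : ℕ) : Expr := .sub (.read 0 (.add (.reg r) (.const 1))) (.read 0 (.reg r))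

theorem eval_degExpr {s : State} (hin : Input adj s) {r : ℕ} {v : Fin n} (hr : s.reg r = v) :
    (degExpr r).eval s = (adj v).length := by
  simp [degExpr, Expr.eval, hr, hin.off v]

/-- Register `24` receives a vertex of the last level, of minimal degree. -/
def selectLoop : Program :=
  .seq (.set 24 (.const 0)) (forLoop 28 0
    (.ite (.lt (.read 8 (.reg 24)) (.read 8 (.reg 28))) (.set 24 (.reg 28))
      (.ite (.eq (.read 8 (.reg 24)) (.read 8 (.reg 28)))
        (.ite (.lt (degExpr 28) (degExpr 24)) (.set 24 (.reg 28)) .skip) .skip)))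

/-- Minimal degree within the last level stands in for the minimal neighbourhood required by
`IsLevels.exists_first`. -/
theorem ends_selectLoop {s : State} (hin : Input adj s) (hn : 0 < n) {D : Fin n → ℕ}
    (hD : ∀ v : Fin n, s.arr 8 v = D v) :
    Ends selectLoop s (n * 48 + 8) fun s' => ∃ u : Fin n, s'.reg 24 = u ∧
      ∀ v, D v < D u ∨ D v = D u ∧ (adj u).length ≤ (adj v).length := by
  refine (Ends.seq (T := 2) (T' := n * (40 + 8) + 6) (Ends.exec rfl ?_)).mono (by omega)
    fun _ _ h => h
  refine (Ends.forLoop_const (m := n) (by simpa [Program.exec] using hin.size)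
    (by decide) (by decide) (by decide) (fun k s' => ∃ u : Fin n, s'.reg 24 = u ∧
      ∀ v : Fin n, (v : ℕ) < k → D v < D u ∨ D v = D u ∧ (adj u).length ≤ (adj v).length)
    ?_ 40 ?_ ?_).mono le_rfl ?_
  · rintro k s m ⟨u, h1, h2⟩
    exact ⟨u, by simpa using h1, h2⟩
  · exact ⟨⟨0, hn⟩, by simp [Program.exec, Expr.eval], by simp⟩
  · rintro k hk s' ha h28 ⟨u, h1, h2⟩
    have h28' : s'.reg 28 = (⟨k, hk⟩ : Fin n) := h28
    have hin' : Input adj s' := by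
      refine Input.agree (hin.congr (s' := Program.exec (.set 24 (.const 0)) s) ?_ rfl rfl) ha
        (by decide) (by decide) (by decide)
      simp [Program.exec]
    have hD' : ∀ v : Fin n, s'.arr 8 v = D v := fun v => by
      rw [ha.arr 8 (by decide)]; exact hD v
    have e1 := eval_degExpr hin' h1
    have e2 := eval_degExpr hin' h28'
    have hDk := hD' ⟨k, hk⟩
    simp only at hDk
    have hnew : ∀ w : Fin n, (∀ v : Fin n, (v : ℕ) < k →
        D v < D w ∨ D v = D w ∧ (adj w).length ≤ (adj v).length) →
        (D ⟨k, hk⟩ < D w ∨ D ⟨k, hk⟩ = D w ∧ (adj w).length ≤ (adj ⟨k, hk⟩).length) →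
        ∀ v : Fin n, (v : ℕ) < k + 1 →
          D v < D w ∨ D v = D w ∧ (adj w).length ≤ (adj v).length := by
      intro w a1 a2 v hv
      by_cases hvk : v = ⟨k, hk⟩
      · rw [hvk]; exact a2
      · exact a1 v (by have : (v : ℕ) ≠ k := fun h => hvk (Fin.ext h)
                       omega)
    refine (Ends.exec (by rfl) ?_).mono (by decide) fun _ _ h => h
    simp only [Program.exec, Expr.eval, h28, h1, hD', hDk, e1, e2]
    by_cases c1 : D u < D ⟨k, hk⟩
    · refine ⟨⟨k, hk⟩, by simp [c1], hnew _ (fun v hv => ?_) (by omega)⟩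
      have := h2 v hv
      omega
    by_cases c2 : D u = D ⟨k, hk⟩
    · by_cases c3 : (adj ⟨k, hk⟩).length < (adj u).length
      · refine ⟨⟨k, hk⟩, by simp [c2, c3], hnew _ (fun v hv => ?_) (by omega)⟩
        have := h2 v hv
        omega
      · exact ⟨u, by simp [c2, c3, h1], hnew _ h2 (by omega)⟩
    · exact ⟨u, by simp [c1, c2, h1], hnew _ h2 (by omega)⟩
  · rintro s' - ⟨u, h1, h2⟩
    exact ⟨u, h1, fun v => h2 v v.2⟩

end Select

/-! ### The keys of the vertices -/

section Key

variable {n : ℕ} {adj : Fin n → List (Fin n)} {G : SimpleGraph (Fin n)}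

/-- Registers `31` and `32` accumulate the two cardinalities in `levelKey`: the number of vertices
up to the level of the vertex plus its neighbours one level further, and the number below that level
minus its neighbours one level nearer. -/
def keyLoop : Program :=
  forLoop 28 0 (.seq (.seq (.set 20 (.reg 28))
      (.seq (.set 31 (.read 11 (.add (.read 10 (.reg 20)) (.const 1))))
        (.set 32 (.read 11 (.read 10 (.reg 20))))))
    (.seq (edgeLoop (.ite (.lt (.read 10 (.reg 20)) (.read 10 (.reg 23)))
        (.set 31 (.add (.reg 31) (.const 1))) (.set 32 (.sub (.reg 32) (.const 1)))))
      (.write 12 (.reg 28) (.add (.reg 31) (.reg 32)))))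

theorem ends_keyLoop {s : State} (hin : Input adj s) {D : Fin n → ℕ} {N : ℕ → ℕ}
    (hD : ∀ v : Fin n, s.arr 10 v = D v) (hN : ∀ v, s.arr 11 (D v) = N (D v))
    (hN' : ∀ v, s.arr 11 (D v + 1) = N (D v + 1)) :
    Ends keyLoop s ((∑ v, ((adj v).length * 24 + 40)) + 6) fun s' => ∀ v : Fin n,
      s'.arr 12 v = (N (D v + 1) + ((adj v).filter fun w => D v < D w).length) +
        (N (D v) - ((adj v).filter fun w => D w ≤ D v).length) := by
  have hsum : ∑ v, ((adj v).length * 24 + 40) =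
      ∑ k ∈ Finset.range n, ((if h : k < n then (adj ⟨k, h⟩).length * 24 + 32 else 0) + 8) := by
    rw [Finset.sum_range]
    refine Finset.sum_congr rfl fun v _ => ?_
    simp
  rw [hsum]
  refine (Ends.forLoop (m := n) hin.size (by decide) (by decide) (by decide)
    (fun k s' => ∀ v : Fin n, (v : ℕ) < k → s'.arr 12 v =
      (N (D v + 1) + ((adj v).filter fun w => D v < D w).length) +
        (N (D v) - ((adj v).filter fun w => D w ≤ D v).length))
    (fun k s m h => h) _ (by simp) ?_).mono le_rfl ?_
  · intro k hk s' ha h28 hI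
    simp only [hk, dif_pos]
    have hD' : ∀ v : Fin n, s'.arr 10 v = D v := fun v => by
      rw [ha.arr 10 (by decide)]; exact hD v
    have hDk := hD' ⟨k, hk⟩
    simp only at hDk
    have h11 := ha.arr 11 (by decide)
    have hin' : Input adj s' := hin.agree ha (by decide) (by decide) (by decide)
    set v : Fin n := ⟨k, hk⟩ with hv
    refine (Ends.seq (T := 12) (T' := (adj v).length * (13 + 11) + 12 + 7)
      (Ends.exec rfl (Ends.seq (T' := 7) ?_))).mono (by omega) fun _ _ h => h
    refine (Ends.edgeLoop (adj := adj) (v := v) ?_ ?_ (by decide) (by decide) (by decide)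
      (fun l s'' => (∀ w : Fin n, s''.arr 10 w = D w) ∧ s''.reg 20 = v ∧ s''.reg 28 = k ∧
        s''.reg 31 = N (D v + 1) + (l.filter fun w => D v < D w).length ∧
        s''.reg 32 = N (D v) - (l.filter fun w => D w ≤ D v).length) ?_ 13 ?_ ?_).mono
        (by omega) ?_
    · exact hin'.congr (by simp [Program.exec]) rfl rfl
    · simp [Program.exec, Expr.eval, h28, hv]
    · rintro l s1 s2 h1 h2 ⟨a1, a2, a3, a4, a5⟩
      rw [h1, h2 20 (by decide) (by decide) (by decide), h2 28 (by decide) (by decide) (by decide),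
        h2 31 (by decide) (by decide) (by decide), h2 32 (by decide) (by decide) (by decide)]
      exact ⟨a1, a2, a3, a4, a5⟩
    · refine ⟨hD', ?_, ?_, ?_, ?_⟩
      · simp [Program.exec, Expr.eval, h28, hv]
      · simp [Program.exec, Expr.eval, h28]
      · simp [Program.exec, Expr.eval, h28, hDk, h11, hN']
      · simp [Program.exec, Expr.eval, h28, hDk, h11, hN]
    · rintro l w hw s1 - h23 ⟨a1, a2, a3, a4, a5⟩
      refine (Ends.exec (by rfl) ⟨?_, ?_, ?_, ?_, ?_⟩).mono (by decide) fun _ _ h => h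
      all_goals
        simp only [Program.exec, Expr.eval, a1, a2, h23]
        rcases lt_or_ge (D v) (D w) with c1 | c1
      all_goals simp [c1, not_le.2, not_lt.2, a1, a2, a3, a4, a5, List.filter_append]
      all_goals omega
    · rintro s1 ha1 ⟨a1, a2, a3, a4, a5⟩
      refine (Ends.exec (by rfl) fun w hw => ?_).mono (by decide) fun _ _ h => h
      have h12 : s1.arr 12 = s'.arr 12 := ha1.arr 12 (by decide)
      simp only [Program.exec, Expr.eval, a3, a4, a5, State.setArr_arr_apply, true_and]
      by_cases hwk : w = v
      · subst hwk; simp [hv]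
      · have : (w : ℕ) ≠ k := fun h => hwk (Fin.ext h)
        rw [if_neg this, h12]
        exact hI w (by omega)
  · intro s' _ h v
    exact h v v.2

end Key

end RAM

/-! ### The key in terms of counts. -/

namespace PathEcc

/-- Following parents shows that all smaller levels are nonempty. This bounds the range of the
counting arrays. -/
theorem IsLevels.lt_card {V : Type*} [Fintype V] {G : SimpleGraph V} {u : V} {lev : V → ℕ}
    (hl : IsLevels G u lev) (v : V) : lev v < Fintype.card V := by
  classical
  suffices H : ∀ k v, lev v = k → k ≤ (Finset.univ.filter fun w => lev w < k).card by
    have h1 := H _ v rfl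
    have h2 : (Finset.univ.filter fun w => lev w < lev v).card < Finset.univ.card (α := V) :=
      Finset.card_lt_card ⟨Finset.subset_univ _, fun h => by simpa using h (Finset.mem_univ v)⟩
    rw [Finset.card_univ] at h2
    omega
  intro k
  induction k with
  | zero => simp
  | succ k ih =>
    intro v hv
    obtain ⟨w, -, hw⟩ := hl.parent (v := v) (by omega)
    have h1 := ih w (by omega)
    have h2 : insert w (Finset.univ.filter fun w => lev w < k) ⊆
        Finset.univ.filter fun w => lev w < k + 1 := by
      intro z
      simp only [Finset.mem_insert, Finset.mem_filter, Finset.mem_univ, true_and]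
      rintro (rfl | h) <;> omega
    have h3 := Finset.card_le_card h2
    rw [Finset.card_insert_of_notMem (by simp; omega)] at h3
    omega

theorem levelKey_le {V : Type*} [Fintype V] (G : SimpleGraph V) (lev : V → ℕ) (v : V) :
    levelKey G lev v ≤ 2 * Fintype.card V := by
  classical
  have h1 := Finset.card_le_univ (Finset.univ.filter fun w => lev w < lev v ∧ ¬ G.Adj v w)
  have h2 := Finset.card_le_univ (Finset.univ.filter fun w => lev w ≤ lev v ∨ G.Adj v w)
  unfold levelKey
  omega

theorem card_filter_eq_length {α : Type*} [Fintype α] (l : List α) (hl : l.Nodup) (p : α → Prop)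
    [DecidablePred p] (S : Finset α) (hS : ∀ a, a ∈ S ↔ a ∈ l ∧ p a) :
    S.card = (l.filter p).length := by
  classical
  rw [← List.toFinset_card_of_nodup (hl.filter _)]
  congr 1
  ext a
  simp [hS]

/-- Neighbours lie on the two adjacent levels only, so the first count is a disjoint union and the
second a difference of nested sets. -/
theorem IsLevels.levelKey_eq {n : ℕ} {G : SimpleGraph (Fin n)} {adj : Fin n → List (Fin n)}
    (hadj : RAM.IsAdjacencyLists G adj) {u : Fin n} {D : Fin n → ℕ} (hD : ∀ v, D v ≠ 0)
    (hl : IsLevels G u fun v => D v - 1) {c : Fin n → Bool}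
    (hc : ∀ ⦃u v⦄, G.Adj u v → c u ≠ c v) (v : Fin n) :
    levelKey G (fun v => D v - 1) v =
      ((Finset.univ.filter fun w => D w < D v + 1).card +
        ((adj v).filter fun w => D v < D w).length) +
      ((Finset.univ.filter fun w => D w < D v).card -
        ((adj v).filter fun w => D w ≤ D v).length) := by
  classical
  obtain ⟨hnd, hmem⟩ := hadj v
  have hlev : ∀ w, G.Adj v w → D w = D v + 1 ∨ D v = D w + 1 := by
    intro w hw
    have := hl.adj hc hw
    have := hD v; have := hD w
    omega
  have hlt : ∀ w, D w - 1 < D v - 1 ↔ D w < D v := fun w => by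
    have := hD v; have := hD w; omega
  have hle : ∀ w, D w - 1 ≤ D v - 1 ↔ D w ≤ D v := fun w => by
    have := hD v; have := hD w; omega
  have h1 : (Finset.univ.filter fun w => D w ≤ D v ∨ G.Adj v w).card =
      (Finset.univ.filter fun w => D w < D v + 1).card +
        ((adj v).filter fun w => D v < D w).length := by
    rw [← card_filter_eq_length (adj v) hnd _ (Finset.univ.filter fun w => G.Adj v w ∧ D v < D w)
      (by simp [hmem]), ← Finset.card_union_of_disjoint]
    · congr 1
      ext w
      simp only [Finset.mem_filter, Finset.mem_univ, true_and, Finset.mem_union]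
      by_cases hw : G.Adj v w
      · have := hlev w hw; simp [hw]; omega
      · simp [hw]
    · rw [Finset.disjoint_filter]
      intro w _ h1 h2
      omega
  have h2 : (Finset.univ.filter fun w => D w < D v ∧ ¬ G.Adj v w).card =
      (Finset.univ.filter fun w => D w < D v).card -
        ((adj v).filter fun w => D w ≤ D v).length := by
    -- No neighbour is on the level of `v`, so the weak inequality of the program amounts to the
    -- strict one.
    rw [← card_filter_eq_length (adj v) hnd _ (Finset.univ.filter fun w => G.Adj v w ∧ D w < D v)
      (fun w => by
        simp only [Finset.mem_filter, Finset.mem_univ, true_and, hmem]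
        exact and_congr_right fun hw => by have := hlev w hw; omega),
      ← Finset.card_sdiff_of_subset]
    · congr 1
      ext w
      simp only [Finset.mem_filter, Finset.mem_univ, true_and, Finset.mem_sdiff]
      tauto
    · intro w
      simp only [Finset.mem_filter, Finset.mem_univ, true_and]
      exact fun h => h.2
  unfold levelKey
  simp only [hlt, hle]
  rw [add_comm, ← h1, ← h2]

end PathEcc

namespace RAM

open PathEcc

/-- Cell `j` of array `15` receives the parity of `j`. -/
def parityLoop : Program :=
  forLoop 28 0 (.write 15 (.add (.reg 28) (.const 1)) (.sub (.const 1) (.read 15 (.reg 28))))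

/-- Parities are tabulated because the machine has no remainder operation. -/
theorem ends_parityLoop {s : State} {n : ℕ} (hn : s.reg 0 = n) (h0 : s.arr 15 0 = 0) :
    Ends parityLoop s (n * 16 + 6) fun s' => ∀ j ≤ n, s'.arr 15 j = j % 2 := by
  refine (Ends.forLoop_const (m := n) hn (by decide) (by decide) (by decide)
    (fun k s' => ∀ j ≤ k, s'.arr 15 j = j % 2) (fun k s m h => h) 8 ?_ ?_).mono le_rfl
    fun _ _ h => h
  · intro j hj
    obtain rfl : j = 0 := by omega
    exact h0
  · intro k hk s' ha h28 hI
    refine (Ends.exec (by rfl) fun j hj => ?_).mono (by decide) fun _ _ h => h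
    simp only [Program.exec, Expr.eval, h28, State.setArr_arr_apply, true_and]
    split_ifs with h
    · rw [hI k le_rfl, h]; omega
    · exact hI j (by omega)

/-! ### The ordering -/

section Split

variable {n : ℕ} {adj : Fin n → List (Fin n)} {G : SimpleGraph (Fin n)}

/-- `r` is one plus the last position of a neighbour of `w` in `L`, and `0` if there is none. -/
def IsLast (G : SimpleGraph (Fin n)) (w : Fin n) (L : List (Fin n)) (r : ℕ) : Prop :=
  (∀ (i : ℕ) (h : i < L.length), G.Adj L[i] w → i < r) ∧
    (r = 0 ∨ ∃ (i : ℕ) (h : i < L.length), G.Adj L[i] w ∧ r = i + 1)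

theorem IsLast.push_adj {w v : Fin n} (h : G.Adj v w) (L : List (Fin n)) :
    IsLast G w (L ++ [v]) (L.length + 1) := by
  refine ⟨fun i hi _ => by simpa using hi, Or.inr ⟨L.length, by simp, ?_, rfl⟩⟩
  simpa using h

theorem IsLast.push_not {w v : Fin n} (h : ¬ G.Adj v w) {L : List (Fin n)} {r : ℕ}
    (hL : IsLast G w L r) : IsLast G w (L ++ [v]) r := by
  refine ⟨fun i hi hadj => ?_, hL.2.imp_right ?_⟩
  · rw [List.getElem_append] at hadj
    split_ifs at hadj with h1
    · exact hL.1 i h1 hadj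
    · simp at hadj; exact absurd hadj h
  · rintro ⟨i, hi, hadj, hr⟩
    refine ⟨i, by simp; omega, ?_, hr⟩
    rwa [List.getElem_append_left hi]

/-- The vertices arrive in sorted order and each writes one plus its position into array `16` at all
its neighbours. The value that survives belongs to the last neighbour. -/
def splitLoop : Program :=
  forLoop 28 0 (.seq (.seq (.set 20 (.read 14 (.reg 28)))
      (.ite (.read 15 (.read 10 (.reg 20)))
        (.seq (.write 3 (.reg 2) (.reg 20))
          (.seq (.set 2 (.add (.reg 2) (.const 1))) (.set 33 (.reg 2))))
        (.seq (.write 4 (.reg 3) (.reg 20))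
          (.seq (.set 3 (.add (.reg 3) (.const 1))) (.set 33 (.reg 3))))))
    (edgeLoop (.write 16 (.reg 23) (.reg 33))))

theorem sum_getElem {l : List (Fin n)} (hl : l.Nodup) (hmem : ∀ v, v ∈ l) (f : Fin n → ℕ) :
    ∑ k ∈ Finset.range l.length, (if h : k < l.length then f l[k] else 0) = ∑ v, f v := by
  have h1 : l.toFinset = Finset.univ := by ext v; simp [hmem]
  rw [← h1, List.sum_toFinset _ hl, Finset.sum_range]
  simp

theorem ends_splitEdge {s : State} (hin : Input adj s) {v : Fin n} (hv : s.reg 20 = v) :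
    Ends (edgeLoop (.write 16 (.reg 23) (.reg 33))) s ((adj v).length * 14 + 12) fun s' =>
      ∀ w : Fin n, s'.arr 16 w = if w ∈ adj v then s.reg 33 else s.arr 16 w := by
  refine (Ends.edgeLoop hin hv (by decide) (by decide) (by decide)
    (fun l s' => s'.reg 33 = s.reg 33 ∧
      ∀ w : Fin n, s'.arr 16 w = if w ∈ l then s.reg 33 else s.arr 16 w) ?_ 3 (by simp) ?_).mono
    (by omega) fun _ _ h => h.2
  · rintro l s1 s2 h1 h2 ⟨a1, a2⟩
    rw [h1, h2 33 (by decide) (by decide) (by decide)]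
    exact ⟨a1, a2⟩
  · rintro l w hw s1 - h23 ⟨a1, a2⟩
    refine (Ends.exec (by rfl) ⟨?_, fun x => ?_⟩).mono (by decide) fun _ _ h => h
    · simp [Program.exec, a1]
    · simp only [Program.exec, Expr.eval, h23, a1, State.setArr_arr_apply, true_and, a2,
        List.mem_append, List.mem_singleton]
      by_cases hx : x = w
      · simp [hx]
      · have : (x : ℕ) ≠ w := fun h => hx (Fin.ext h)
        simp [hx, this]

theorem ends_splitLoop (hadj : IsAdjacencyLists G adj) {s : State} (hin : Input adj s)
    {l : List (Fin n)} (hl : l.Nodup) (hlen : l.length = n) (hmem : ∀ v, v ∈ l)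
    (hA : ∀ (i : ℕ) (h : i < l.length), s.arr 14 i = l[i]) {c : Fin n → Bool}
    (hc : ∀ ⦃u v⦄, G.Adj u v → c u ≠ c v)
    (hpar : ∀ v : Fin n, s.arr 15 (s.arr 10 v) = if c v then 1 else 0)
    (h2 : s.reg 2 = 0) (h3 : s.reg 3 = 0) (h16 : ∀ i, s.arr 16 i = 0) :
    Ends splitLoop s ((∑ v, ((adj v).length * 14 + 36)) + 6) fun s' =>
      HoldsList s' 2 3 (l.filter c) ∧ HoldsList s' 3 4 (l.filter fun v => !c v) ∧
      ∀ w : Fin n, (c w = false → IsLast G w (l.filter c) (s'.arr 16 w)) ∧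
        (c w = true → IsLast G w (l.filter fun v => !c v) (s'.arr 16 w)) := by
  have hsum : ∑ v, ((adj v).length * 14 + 36) = ∑ k ∈ Finset.range n,
      ((if h : k < l.length then (adj l[k]).length * 14 + 28 else 0) + 8) := by
    have h1 := sum_getElem hl hmem (fun v => (adj v).length * 14 + 28)
    have h2 : Finset.range l.length = Finset.range n := by rw [hlen]
    rw [h2] at h1
    rw [Finset.sum_add_distrib, Finset.sum_add_distrib, h1, Finset.sum_add_distrib]
    simp
    omega
  rw [hsum]
  refine (Ends.forLoop (m := n) hin.size (by decide) (by decide) (by decide)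
    (fun k s' => HoldsList s' 2 3 ((l.take k).filter c) ∧
      HoldsList s' 3 4 ((l.take k).filter fun v => !c v) ∧
      ∀ w : Fin n, (c w = false → IsLast G w ((l.take k).filter c) (s'.arr 16 w)) ∧
        (c w = true → IsLast G w ((l.take k).filter fun v => !c v) (s'.arr 16 w)))
    ?_ _ ?_ ?_).mono le_rfl ?_
  · rintro k s m ⟨a1, a2, a3⟩
    exact ⟨a1.congr (by simp) rfl, a2.congr (by simp) rfl, a3⟩
  · refine ⟨⟨by simp [h2], by simp⟩, ⟨by simp [h3], by simp⟩, fun w => ?_⟩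
    simp [IsLast, h16]
  · rintro k hk s' ha h28 ⟨a1, a2, a3⟩
    have hk' : k < l.length := by omega
    simp only [hk', dif_pos]
    have e1 : s'.arr 14 k = l[k] := by rw [ha.arr 14 (by decide)]; exact hA k hk'
    have e2 : s'.arr 15 (s'.arr 10 l[k]) = if c l[k] then 1 else 0 := by
      rw [ha.arr 15 (by decide), ha.arr 10 (by decide)]; exact hpar l[k]
    have hin' : Input adj s' := hin.agree ha (by decide) (by decide) (by decide)
    have htake : l.take (k + 1) = l.take k ++ [l[k]] := by
      rw [List.take_add_one, List.getElem?_eq_getElem hk']; rfl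
    generalize l[k] = v at *
    rw [htake]
    have hcol : ∀ w, w ∈ adj v ↔ G.Adj v w := fun w => (hadj v).2 w
    refine (Ends.seq (T := 16) (T' := (adj v).length * 14 + 12)
      (Ends.exec (Q := fun s2 => Ends _ s2 _ _) rfl ?_)).mono (by omega) fun _ _ h => h
    generalize hs2 : Program.exec _ s' = s2
    have f0 : s2.reg 0 = s'.reg 0 ∧ s2.reg 20 = v ∧ s2.arr 0 = s'.arr 0 ∧ s2.arr 1 = s'.arr 1 ∧
        s2.arr 16 = s'.arr 16 := by
      subst hs2
      cases hcv : c v <;> simp [Program.exec, Expr.eval, h28, e1, e2, hcv, State.setArr_arr]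
    refine (ends_splitEdge (v := v) (hin'.congr f0.1 f0.2.2.1 f0.2.2.2.1) f0.2.1).mono le_rfl ?_
    rintro s1 ha1 hs1
    simp only [f0.2.2.2.2] at hs1
    cases hcv : c v
    · have f1 : s2.reg 3 = s'.reg 3 + 1 ∧ s2.reg 33 = s'.reg 3 + 1 ∧ s2.reg 2 = s'.reg 2 ∧
          s2.arr 3 = s'.arr 3 ∧ ∀ i, s2.arr 4 i = if i = s'.reg 3 then (v : ℕ) else s'.arr 4 i := by
        subst hs2
        simp [Program.exec, Expr.eval, h28, e1, e2, hcv, State.setArr_arr]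
      obtain ⟨g1, g2, g3, g4, g5⟩ := f1
      simp only [List.filter_append, List.filter_singleton, hcv]
      refine ⟨?_, ?_, fun w => ⟨fun hw => ?_, fun hw => ?_⟩⟩
      · simpa using a1.congr ((ha1.reg 2 (by decide)).trans g3) ((ha1.arr 3 (by decide)).trans g4)
      · exact a2.push ((ha1.reg 3 (by decide)).trans g1)
          (fun i => by rw [ha1.arr 4 (by decide), g5])
      · have : ¬ G.Adj v w := fun h => hc h (hcv.trans hw.symm)
        simpa [hs1, mt (hcol w).1 this] using (a3 w).1 hw
      · rw [hs1]
        split_ifs with h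
        · rw [g2, a2.1]
          exact IsLast.push_adj ((hcol w).1 h) _
        · exact IsLast.push_not (mt (hcol w).2 h) ((a3 w).2 hw)
    · have f1 : s2.reg 2 = s'.reg 2 + 1 ∧ s2.reg 33 = s'.reg 2 + 1 ∧ s2.reg 3 = s'.reg 3 ∧
          s2.arr 4 = s'.arr 4 ∧ ∀ i, s2.arr 3 i = if i = s'.reg 2 then (v : ℕ) else s'.arr 3 i := by
        subst hs2
        simp [Program.exec, Expr.eval, h28, e1, e2, hcv, State.setArr_arr]
      obtain ⟨g1, g2, g3, g4, g5⟩ := f1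
      simp only [List.filter_append, List.filter_singleton, hcv]
      refine ⟨?_, ?_, fun w => ⟨fun hw => ?_, fun hw => ?_⟩⟩
      · exact a1.push ((ha1.reg 2 (by decide)).trans g1)
          (fun i => by rw [ha1.arr 3 (by decide), g5])
      · simpa using a2.congr ((ha1.reg 3 (by decide)).trans g3) ((ha1.arr 4 (by decide)).trans g4)
      · rw [hs1]
        split_ifs with h
        · rw [g2, a1.1]
          exact IsLast.push_adj ((hcol w).1 h) _
        · exact IsLast.push_not (mt (hcol w).2 h) ((a3 w).1 hw)
      · have : ¬ G.Adj v w := fun h => hc h (hcv.trans hw.symm)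
        simpa [hs1, mt (hcol w).1 this] using (a3 w).2 hw
  · rintro s' - ⟨a1, a2, a3⟩
    have htake : l.take n = l := List.take_of_length_le hlen.le
    rw [htake] at a1 a2 a3
    exact ⟨a1, a2, a3⟩

end Split

end RAM

namespace RAM

open PathEcc PathEcc.Ordering

theorem Ends.loop_done {e : Expr} {c : Program} {s : State} {Q : State → Prop}
    (he : e.eval s = 0) (hQ : Q s) : Ends (.loop e c) s (e.cost + 1) Q :=
  ⟨s, _, .loopDone he, le_rfl, hQ⟩

theorem Ends.loop_step {e : Expr} {c : Program} {s : State} {T T' : ℕ} {Q : State → Prop}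
    (he : e.eval s ≠ 0) (h : Ends c s T fun s' => Ends (.loop e c) s' T' Q) :
    Ends (.loop e c) s (e.cost + 1 + T + T') Q := by
  obtain ⟨s', t, h1, h2, s'', t', h3, h4, h5⟩ := h
  exact ⟨s'', _, .loopStep he h1 h3, by omega, h5⟩

/-! ### Marking the vertices of a block -/

/-- Mark the vertices of array `X` from register `a` on, while the index is less than register
`lim` and the entry of array `16` is at most register `m`. -/
def markLoop (X a lim m f : ℕ) : Program :=
  .loop (.sub (.lt (.reg a) (.reg lim)) (.lt (.reg m) (.read 16 (.read X (.reg a)))))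
    (.seq (.write 5 (.read X (.reg a)) (.reg 4))
      (.seq (.write 6 (.read X (.reg a)) (.const f)) (.set a (.add (.reg a) (.const 1)))))

/-- The truncated difference in the loop condition means that the first test holds and the second
fails; at the limit it vanishes whatever is read. A round costs 10 steps for the test and 12 for the
body. -/
theorem ends_markLoop {n p : ℕ} {x : Fin p → Fin n} {R : Fin n → ℕ} {X a lim m f : ℕ}
    (h5 : X ≠ 5) (h6 : X ≠ 6) (ha4 : a ≠ 4) (hal : a ≠ lim) (ham : a ≠ m) {s : State}
    (hX : ∀ i : Fin p, s.arr X i = x i) (hR : ∀ v : Fin n, s.arr 16 v = R v) {a₀ a' b d : ℕ}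
    (ha : s.reg a = a₀) (hlim : s.reg lim = b) (hm : s.reg m = d) (hle : a₀ ≤ a') (hle' : a' ≤ b)
    (hb : b ≤ p) (hlt : ∀ i : Fin p, a₀ ≤ i → (i : ℕ) < a' → R (x i) ≤ d)
    (hge : ∀ i : Fin p, (i : ℕ) = a' → a' < b → d < R (x i)) :
    Ends (markLoop X a lim m f) s ((a' - a₀) * 22 + 10) fun s' => s'.reg a = a' ∧
      (∀ i : Fin p, a₀ ≤ i → (i : ℕ) < a' → s'.arr 5 (x i) = s.reg 4 ∧ s'.arr 6 (x i) = f) ∧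
      ∀ v : Fin n, (∀ i : Fin p, a₀ ≤ i → (i : ℕ) < a' → v ≠ x i) →
        s'.arr 5 v = s.arr 5 v ∧ s'.arr 6 v = s.arr 6 v := by
  have hcond : ∀ s' : State, ∀ c, Agree (markLoop X a lim m f) s s' → a₀ ≤ c → c ≤ a' →
      s'.reg a = c → ((Expr.sub (.lt (.reg a) (.reg lim))
        (.lt (.reg m) (.read 16 (.read X (.reg a))))).eval s' ≠ 0 ↔ c < a') := by
    intro s' c hag h1 h2 h3
    have e1 : s'.reg lim = b := by
      rw [hag.reg lim (by simp [markLoop, Program.regs, hal.symm]), hlim]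
    have e2 : s'.reg m = d := by
      rw [hag.reg m (by simp [markLoop, Program.regs, ham.symm]), hm]
    have e3 : s'.arr X = s.arr X := hag.arr X (by simp [markLoop, Program.arrs, h5, h6])
    have e4 : s'.arr 16 = s.arr 16 := hag.arr 16 (by simp [markLoop, Program.arrs])
    by_cases hcb : c < b
    · have hXc := hX ⟨c, by omega⟩
      simp only at hXc
      have hRc := hR (x ⟨c, by omega⟩)
      simp only [Expr.eval, e1, e2, e3, e4, h3, hcb, if_true, hXc, hRc]
      constructor
      · intro h
        by_contra hc
        have := hge ⟨c, by omega⟩ (by simp only; omega) (by omega)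
        simp [this] at h
      · intro h
        have := hlt ⟨c, by omega⟩ h1 h
        simp [not_lt.2 this]
    · simp [Expr.eval, e1, h3, hcb]
      omega
  refine (Ends.loop (φ := (a' - a₀) * 22) (fun φ s' => ∃ c, a₀ ≤ c ∧ c ≤ a' ∧ s'.reg a = c ∧
    (∀ i : Fin p, a₀ ≤ i → (i : ℕ) < c → s'.arr 5 (x i) = s.reg 4 ∧ s'.arr 6 (x i) = f) ∧
    (∀ v : Fin n, (∀ i : Fin p, a₀ ≤ i → (i : ℕ) < c → v ≠ x i) →
        s'.arr 5 v = s.arr 5 v ∧ s'.arr 6 v = s.arr 6 v) ∧ φ = (a' - c) * 22)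
    ⟨a₀, le_rfl, hle, ha, fun i h1 h2 => by omega, fun v _ => ⟨rfl, rfl⟩, rfl⟩ ?_).mono le_rfl ?_
  · rintro φ s' hag ⟨c, h1, h2, h3, k1, k2, rfl⟩ he
    have hc := (hcond s' c ⟨hag.reg, hag.arr⟩ h1 h2 h3).1 he
    have e3 : s'.arr X c = x ⟨c, by omega⟩ := by
      rw [hag.arr X (by simp [Program.arrs, h5, h6])]; exact hX ⟨c, by omega⟩
    have e4 : s'.reg 4 = s.reg 4 := hag.reg 4 (by simp [Program.regs, ha4.symm])
    have a5 : ∀ v : Fin n, (Program.exec (.seq (.write 5 (.read X (.reg a)) (.reg 4))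
        (.seq (.write 6 (.read X (.reg a)) (.const f)) (.set a (.add (.reg a) (.const 1))))) s').arr
        5 v = if v = x ⟨c, by omega⟩ then s.reg 4 else s'.arr 5 v := by
      intro v
      simp [Program.exec, Expr.eval, h3, e3, e4, Fin.ext_iff]
    have a6 : ∀ v : Fin n, (Program.exec (.seq (.write 5 (.read X (.reg a)) (.reg 4))
        (.seq (.write 6 (.read X (.reg a)) (.const f)) (.set a (.add (.reg a) (.const 1))))) s').arr
        6 v = if v = x ⟨c, by omega⟩ then f else s'.arr 6 v := by
      intro v
      simp [Program.exec, Expr.eval, h3, e3, h5, Fin.ext_iff]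
    refine ⟨12, (Ends.exec (by rfl) ⟨(a' - (c + 1)) * 22, ?_, c + 1, by omega, by omega, ?_, ?_, ?_,
      rfl⟩).mono (by simp [Program.cost, Expr.cost]) fun _ _ h => h⟩
    · simp only [Expr.cost]; omega
    · simp [Program.exec, Expr.eval, h3]
    · intro i hi hi'
      rw [a5, a6]
      split_ifs with hx
      · exact ⟨rfl, rfl⟩
      · refine k1 i hi ?_
        by_contra hcon
        exact hx (congrArg x (Fin.ext (by simp only; omega)))
    · intro v hv
      rw [a5, a6, if_neg (hv ⟨c, by omega⟩ h1 (by simp only; omega)),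
        if_neg (hv ⟨c, by omega⟩ h1 (by simp only; omega))]
      exact k2 v fun i hi hi' => hv i hi (by omega)
  · rintro s' hag ⟨he, φ, c, h1, h2, h3, k1, k2, -⟩
    have : c = a' := by
      by_contra hne
      exact (hcond s' c ⟨hag.reg, hag.arr⟩ h1 h2 h3).2 (by omega) he
    subst this
    exact ⟨h3, k1, k2⟩

/-! ### One block -/

section Block

variable {n : ℕ} {G : SimpleGraph (Fin n)} {O : PathEcc.Ordering G}

def blockStart : Program :=
  .seq (.seq (.set 38 (.read 3 (.reg 34))) (.set 39 (.read 4 (.reg 35))))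
    (.seq (.set 36 (.read 16 (.reg 39))) (.set 37 (.read 16 (.reg 38))))

/-- The first two loops mark `K`; there the bound in register `0` is `n`, which no entry for a last
neighbour exceeds, so only the limit stops them. The other two mark `J` and stop at the first vertex
with a neighbour beyond `K`. -/
def blockMarks : Program :=
  .seq (.seq (markLoop 3 34 36 0 0) (markLoop 4 35 37 0 0))
    (.seq (markLoop 3 34 2 37 1) (markLoop 4 35 3 36 1))

def push (r : ℕ) : Program :=
  .seq (.write 2 (.reg 1) (.reg r)) (.set 1 (.add (.reg 1) (.const 1)))

/-- Decide whether the block is left through `X` or through `Y`. -/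
def blockExit : Program :=
  .seq (.set 4 (.add (.reg 4) (.const 1)))
    (.ite (.lt (.reg 34) (.reg 2))
      (.set 41 (.sub (.const 1) (.lt (.reg 35) (.read 16 (.read 3 (.sub (.reg 36) (.const 1)))))))
      (.set 41 (.lt (.reg 36) (.reg 34))))

/-- Registers `42`, `43` and `44` receive the last three arguments of `partX`, so that both exits
share the code of `blockPath`. -/
def blockEnds : Program :=
  .ite (.reg 41)
    (.seq (.set 42 (.reg 39)) (.seq (.set 43 (.reg 38))
      (.set 44 (.read 4 (.sub (.reg 37) (.const 1))))))
    (.seq (.set 42 (.reg 38)) (.seq (.set 43 (.reg 39))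
      (.set 44 (.read 3 (.sub (.reg 36) (.const 1))))))

/-- Finally register `45` receives the first vertex of the next block in the part opposite to the
exit. After the last block this value is never used. -/
def blockPath : Program :=
  .seq (push 45) (.seq
    (.ite (.eq (.reg 45) (.reg 42))
      (.ite (.eq (.reg 42) (.reg 44)) .skip (.seq (push 43) (push 44))) (push 44))
    (.ite (.reg 41) (.set 45 (.read 3 (.reg 34))) (.set 45 (.read 4 (.reg 35)))))

def blockBody : Program :=
  .seq (.seq blockStart blockMarks) (.seq blockExit (.seq blockEnds blockPath))

/-- The ordering and the indices of the last neighbours are stored. -/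
structure HoldsLast (s : State) (O : PathEcc.Ordering G) : Prop where
  size : s.reg 0 = n
  p : s.reg 2 = O.p
  q : s.reg 3 = O.q
  x : ∀ i : Fin O.p, s.arr 3 i = O.x i
  y : ∀ j : Fin O.q, s.arr 4 j = O.y j
  lastY : ∀ i, s.arr 16 (O.x i) = O.lastY (O.x i)
  lastX : ∀ j, s.arr 16 (O.y j) = O.lastX (O.y j)

theorem HoldsLast.congr {s s' : State} (h : HoldsLast s O) (h0 : s'.reg 0 = s.reg 0)
    (h2 : s'.reg 2 = s.reg 2) (h3 : s'.reg 3 = s.reg 3) (a3 : s'.arr 3 = s.arr 3)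
    (a4 : s'.arr 4 = s.arr 4) (a16 : s'.arr 16 = s.arr 16) : HoldsLast s' O := by
  obtain ⟨b0, b1, b2, b3, b4, b5, b6⟩ := h
  exact ⟨h0 ▸ b0, h2 ▸ b1, h3 ▸ b2, a3 ▸ b3, a4 ▸ b4, a16 ▸ b5, a16 ▸ b6⟩

theorem HoldsLast.agree {c : Program} {s s' : State} (h : HoldsLast s O) (ha : Agree c s s')
    (h0 : 0 ∉ c.regs := by decide) (h2 : 2 ∉ c.regs := by decide) (h3 : 3 ∉ c.regs := by decide)
    (a3 : 3 ∉ c.arrs := by decide) (a4 : 4 ∉ c.arrs := by decide)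
    (a16 : 16 ∉ c.arrs := by decide) : HoldsLast s' O :=
  h.congr (ha.reg 0 h0) (ha.reg 2 h2) (ha.reg 3 h3) (ha.arr 3 a3) (ha.arr 4 a4) (ha.arr 16 a16)

theorem p_le (O : PathEcc.Ordering G) : O.p ≤ n := by
  simpa using Fintype.card_le_of_injective _ O.x_injective

theorem q_le (O : PathEcc.Ordering G) : O.q ≤ n := p_le O.swap

/-- The state before a block is processed. -/
structure AtBlock (s : State) (O : PathEcc.Ordering G) (a b k : ℕ) (v : ℕ) (P : List (Fin n)) :
    Prop where
  last : HoldsLast s O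
  a : s.reg 34 = a
  b : s.reg 35 = b
  k : s.reg 4 = k
  v : s.reg 45 = v
  path : HoldsList s 1 2 P

/-- The arrays `5` and `6` after a block has been marked. -/
def Marked (s s' : State) (B : Block (Fin n)) (k : ℕ) : Prop :=
  (∀ v ∈ B.K, s'.arr 5 v = k ∧ s'.arr 6 v = 0) ∧ (∀ v ∈ B.J, s'.arr 5 v = k ∧ s'.arr 6 v = 1) ∧
    ∀ v : Fin n, v ∉ B.K → v ∉ B.J → s'.arr 5 v = s.arr 5 v ∧ s'.arr 6 v = s.arr 6 v

variable {a e : Fin O.p} {b g : Fin O.q} {a' b' k : ℕ} {v : Fin n} {P : List (Fin n)} {s : State}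

theorem ends_blockStart (hs : AtBlock s O a b k v P) (h : O.IsBlock a b e g a' b') :
    Ends blockStart s 12 fun s' => s'.reg 36 = e + 1 ∧ s'.reg 37 = g + 1 ∧
      s'.reg 38 = O.x a ∧ s'.reg 39 = O.y b := by
  have h1 := hs.last.x a
  have h2 := hs.last.y b
  have h3 := hs.last.lastY a
  have h4 := hs.last.lastX b
  refine (Ends.exec (by rfl) ?_).mono (by decide) fun _ _ h => h
  simp [blockStart, Program.exec, Expr.eval, hs.a, hs.b, h1, h2, h3, h4, h.he, h.hg]

theorem ends_blockMarks (hl : HoldsLast s O) (h : O.IsBlock a b e g a' b') (hg : O.Good a b)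
    (h34 : s.reg 34 = a) (h35 : s.reg 35 = b) (h36 : s.reg 36 = e + 1) (h37 : s.reg 37 = g + 1)
    (h4 : s.reg 4 = k) :
    Ends blockMarks s ((a' - a + (b' - b)) * 22 + 40) fun s' => s'.reg 34 = a' ∧ s'.reg 35 = b' ∧
      Marked s s' (O.block a b e g a' b') k := by
  have hae : (a : ℕ) ≤ e := h.a_le hg
  have hbg : (b : ℕ) ≤ g := h.b_le hg
  have hp := p_le O
  have hq := q_le O
  have hea := h.hea
  have hgb := h.hgb
  let R : State → Fin n → ℕ := fun s v => s.arr 16 v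
  refine (Ends.seq (T := (e + 1 - a) * 22 + 10 + ((g + 1 - b) * 22 + 10))
    (T' := (a' - (e + 1)) * 22 + 10 + ((b' - (g + 1)) * 22 + 10)) (Ends.seq
    ((ends_markLoop (x := O.x) (R := R s) (a₀ := a) (a' := e + 1) (b := e + 1) (d := n)
      (by decide) (by decide) (by decide) (by decide)
      (by decide) hl.x (fun _ => rfl) h34 h36 hl.size (by omega) le_rfl
      (by omega) (fun i _ _ => ?_) (fun i _ _ => by omega)).mono le_rfl ?_))).mono (by omega)
      fun _ _ h => h
  · simp only [R, hl.lastY]; exact (lastY_le _).trans hq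
  rintro s1 A1 ⟨r1, k1, m1⟩
  have hl1 := hl.agree A1
  refine (ends_markLoop (x := O.y) (R := R s1) (a₀ := b) (a' := g + 1) (b := g + 1) (d := n)
    (by decide) (by decide) (by decide) (by decide) (by decide)
    hl1.y (fun _ => rfl) ((A1.reg 35 (by decide)).trans h35) ((A1.reg 37 (by decide)).trans h37)
    hl1.size (by omega) le_rfl (by omega) (fun i _ _ => ?_)
    (fun i _ _ => by omega)).mono le_rfl ?_
  · simp only [R, hl1.lastX]; exact (lastX_le _).trans hp
  rintro s2 A2 ⟨r2, k2, m2⟩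
  have hl2 := hl1.agree A2
  refine Ends.seq ((ends_markLoop (x := O.x) (R := R s2) (a₀ := e + 1) (a' := a') (b := O.p)
    (d := g + 1) (by decide) (by decide) (by decide) (by decide) (by decide)
    hl2.x (fun _ => rfl) ((A2.reg 34 (by decide)).trans r1) hl2.p
    ((A2.reg 37 (by decide)).trans ((A1.reg 37 (by decide)).trans h37))
    hea h.hap le_rfl (fun i hi hi' => ?_) (fun i hi hi' => ?_)).mono le_rfl ?_)
  · simp only [R, hl2.lastY]; exact h.jx i hi hi'
  · simp only [R, hl2.lastY]; exact h.jx' i hi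
  rintro s3 A3 ⟨r3, k3, m3⟩
  have hl3 := hl2.agree A3
  refine (ends_markLoop (x := O.y) (R := R s3) (a₀ := g + 1) (a' := b') (b := O.q)
    (d := e + 1) (by decide) (by decide) (by decide) (by decide) (by decide)
    hl3.y (fun _ => rfl) ((A3.reg 35 (by decide)).trans r2) hl3.q
    ((A3.reg 36 (by decide)).trans ((A2.reg 36 (by decide)).trans
      ((A1.reg 36 (by decide)).trans h36)))
    hgb h.hbq le_rfl (fun i hi hi' => ?_) (fun i hi hi' => ?_)).mono le_rfl ?_
  · simp only [R, hl3.lastX]; exact h.jy i hi hi'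
  · simp only [R, hl3.lastX]; exact h.jy' i hi
  rintro s4 A4 ⟨r4, k4, m4⟩
  have f1 : s1.reg 4 = k := (A1.reg 4 (by decide)).trans h4
  have f2 : s2.reg 4 = k := (A2.reg 4 (by decide)).trans f1
  have f3 : s3.reg 4 = k := (A3.reg 4 (by decide)).trans f2
  rw [h4] at k1
  rw [f1] at k2
  rw [f2] at k3
  rw [f3] at k4
  have yx : ∀ {i j}, O.y j ≠ O.x i := fun {i j} h => O.x_ne_y i j h.symm
  have m4x : ∀ i, s4.arr 5 (O.x i) = s3.arr 5 (O.x i) ∧ s4.arr 6 (O.x i) = s3.arr 6 (O.x i) :=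
    fun i => m4 _ fun j _ _ => O.x_ne_y i j
  have m2x : ∀ i, s2.arr 5 (O.x i) = s1.arr 5 (O.x i) ∧ s2.arr 6 (O.x i) = s1.arr 6 (O.x i) :=
    fun i => m2 _ fun j _ _ => O.x_ne_y i j
  have m3y : ∀ j, s3.arr 5 (O.y j) = s2.arr 5 (O.y j) ∧ s3.arr 6 (O.y j) = s2.arr 6 (O.y j) :=
    fun j => m3 _ fun i _ _ => yx
  have m1y : ∀ j, s1.arr 5 (O.y j) = s.arr 5 (O.y j) ∧ s1.arr 6 (O.y j) = s.arr 6 (O.y j) :=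
    fun j => m1 _ fun i _ _ => yx
  have xne : ∀ {i l : Fin O.p}, (i : ℕ) ≠ l → O.x i ≠ O.x l := fun h h' =>
    h (congrArg Fin.val (O.x_injective h'))
  have yne : ∀ {i l : Fin O.q}, (i : ℕ) ≠ l → O.y i ≠ O.y l := fun h h' =>
    h (congrArg Fin.val (O.y_injective h'))
  refine ⟨(A4.reg 34 (by decide)).trans r3, r4, ?_, ?_, ?_⟩
  · intro v hv
    rcases O.cover v with ⟨i, rfl⟩ | ⟨j, rfl⟩
    · simp only [block, x_mem_seg] at hv
      have h3 := m3 (O.x i) fun l _ _ => xne (by omega)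
      rw [(m4x i).1, (m4x i).2, h3.1, h3.2, (m2x i).1, (m2x i).2]
      exact k1 i hv.1 hv.2
    · simp only [block, y_mem_seg] at hv
      have h3 := m4 (O.y j) fun l _ _ => yne (by omega)
      rw [h3.1, h3.2, (m3y j).1, (m3y j).2]
      exact k2 j hv.1 hv.2
  · intro v hv
    rcases O.cover v with ⟨i, rfl⟩ | ⟨j, rfl⟩
    · simp only [block, x_mem_seg] at hv
      rw [(m4x i).1, (m4x i).2]
      exact k3 i hv.1 hv.2
    · simp only [block, y_mem_seg] at hv
      exact k4 j hv.1 hv.2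
  · intro v hK hJ
    rcases O.cover v with ⟨i, rfl⟩ | ⟨j, rfl⟩
    · simp only [block, x_mem_seg] at hK hJ
      have h1 := m1 (O.x i) fun l _ _ => xne (by omega)
      have h3 := m3 (O.x i) fun l _ _ => xne (by omega)
      rw [(m4x i).1, (m4x i).2, h3.1, h3.2, (m2x i).1, (m2x i).2]
      exact h1
    · simp only [block, y_mem_seg] at hK hJ
      have h2 := m2 (O.y j) fun l _ _ => yne (by omega)
      have h4 := m4 (O.y j) fun l _ _ => yne (by omega)
      rw [h4.1, h4.2, (m3y j).1, (m3y j).2, h2.1, h2.2]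
      exact m1y j

/-- The block is left through `X`. -/
def ExitX (O : PathEcc.Ordering G) (e : Fin O.p) (a' b' : ℕ) : Prop :=
  (a' < O.p ∧ b' < O.lastY (O.x e)) ∨ (¬ a' < O.p ∧ ¬ (e : ℕ) + 1 < a')

open Classical in
theorem ends_blockExit (hl : HoldsLast s O) (h34 : s.reg 34 = a') (h35 : s.reg 35 = b')
    (h36 : s.reg 36 = e + 1) :
    Ends blockExit s 30 fun s' => s'.reg 4 = s.reg 4 + 1 ∧
      s'.reg 41 = if ExitX O e a' b' then 0 else 1 := by
  have h1 := hl.x e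
  have h2 := hl.lastY e
  refine (Ends.exec (by rfl) ?_).mono (by decide) fun _ _ h => h
  by_cases c1 : a' < O.p
  · by_cases c2 : b' < O.lastY (O.x e) <;>
      simp [blockExit, Program.exec, Expr.eval, ExitX, h34, h35, h36, hl.p, c1, c2, h1, h2]
  · by_cases c2 : (e : ℕ) + 1 < a' <;>
      simp [blockExit, Program.exec, Expr.eval, ExitX, h34, h36, hl.p, c1, c2]

theorem ends_push {r : ℕ} {w : Fin n} (hP : HoldsList s 1 2 P) (hr : s.reg r = w) :
    HoldsList ((push r).exec s) 1 2 (P ++ [w]) := by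
  refine hP.push (by simp [push, Program.exec, Expr.eval]) fun i => ?_
  simp [push, Program.exec, Expr.eval, hr]

theorem push_reg {r : ℕ} (r' : ℕ) (h : r' ≠ 1) : ((push r).exec s).reg r' = s.reg r' := by
  simp [push, Program.exec, h]

theorem ends_blockPath {u w t : Fin n} (hP : HoldsList s 1 2 P) (h45 : s.reg 45 = v)
    (h42 : s.reg 42 = u) (h43 : s.reg 43 = w) (h44 : s.reg 44 = t) :
    Ends blockPath s 40 fun s' => HoldsList s' 1 2 (P ++ partX v u w t) ∧
      s'.reg 45 = if s.reg 41 = 0 then s.arr 4 (s.reg 35) else s.arr 3 (s.reg 34) := by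
  refine (Ends.exec (by rfl) ?_).mono (by decide) fun _ _ h => h
  have h1 := ends_push (r := 45) hP h45
  have hvu : (v : ℕ) = u ↔ v = u := Fin.ext_iff.symm
  have hut : (u : ℕ) = t ↔ u = t := Fin.ext_iff.symm
  let mid : Program := .ite (.eq (.reg 45) (.reg 42))
      (.ite (.eq (.reg 42) (.reg 44)) .skip (.seq (push 43) (push 44))) (push 44)
  have hmid : HoldsList (mid.exec ((push 45).exec s)) 1 2 (P ++ partX v u w t) := by
    have p42 := push_reg (s := s) (r := 45) 42 (by decide)
    have p43 := push_reg (s := s) (r := 45) 43 (by decide)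
    have p44 := push_reg (s := s) (r := 45) 44 (by decide)
    have p45 := push_reg (s := s) (r := 45) 45 (by decide)
    rw [h42] at p42
    rw [h43] at p43
    rw [h44] at p44
    rw [h45] at p45
    generalize (push 45).exec s = s1 at *
    by_cases c1 : v = u
    · by_cases c2 : u = t
      · simpa [mid, Program.exec, Expr.eval, p42, p44, p45, c1, c2, partX] using c1.trans c2 ▸ h1
      · have h2 := ends_push (r := 43) h1 p43
        have h3 := ends_push (r := 44) h2 ((push_reg 44 (by decide)).trans p44)
        simpa [mid, Program.exec, Expr.eval, p42, p44, p45, c1, c2, hut, partX] using h3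
    · have h2 := ends_push (r := 44) h1 p44
      simpa [mid, Program.exec, Expr.eval, p42, p44, p45, c1, hvu, partX] using h2
  have hagree : Agree (.seq (push 45) mid) s (mid.exec ((push 45).exec s)) := by
    obtain ⟨t, -, h⟩ := Program.runs_exec (.seq (push 45) mid) s rfl
    exact h.agree
  have e41 := hagree.reg 41 (by decide)
  have e34 := hagree.reg 34 (by decide)
  have e35 := hagree.reg 35 (by decide)
  have a3 := hagree.arr 3 (by decide)
  have a4 := hagree.arr 4 (by decide)
  change HoldsList (Program.exec (.ite (.reg 41) (.set 45 (.read 3 (.reg 34)))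
    (.set 45 (.read 4 (.reg 35)))) (mid.exec ((push 45).exec s))) 1 2 _ ∧
    (Program.exec (.ite (.reg 41) (.set 45 (.read 3 (.reg 34)))
    (.set 45 (.read 4 (.reg 35)))) (mid.exec ((push 45).exec s))).reg 45 = _
  generalize mid.exec ((push 45).exec s) = s2 at *
  by_cases c : s.reg 41 = 0
  · simp only [Program.exec, Expr.eval, e41, c, if_true, e35, a4]
    exact ⟨hmid.congr (by simp) rfl, by simp⟩
  · simp only [Program.exec, Expr.eval, e41, c, if_false, e34, a3]
    exact ⟨hmid.congr (by simp) rfl, by simp⟩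

open Classical in
theorem ends_blockEnds (hl : HoldsLast s O) (h36 : s.reg 36 = e + 1) (h37 : s.reg 37 = g + 1)
    (h38 : s.reg 38 = O.x a) (h39 : s.reg 39 = O.y b) {X : Prop}
    (h41 : s.reg 41 = if X then 0 else 1) :
    Ends blockEnds s 30 fun s' => s'.reg 42 = (if X then O.x a else O.y b : Fin n) ∧
      s'.reg 43 = (if X then O.y b else O.x a : Fin n) ∧
      s'.reg 44 = (if X then O.x e else O.y g : Fin n) := by
  have h1 := hl.x e
  have h2 := hl.y g
  refine (Ends.exec (by rfl) ?_).mono (by decide) fun _ _ h => h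
  by_cases c : X <;>
    simp [blockEnds, Program.exec, Expr.eval, h36, h37, h38, h39, h41, c, h1, h2]

open Classical in
/-- The sequence appended in a block. -/
noncomputable def blockPart (O : PathEcc.Ordering G) (a e : Fin O.p) (b g : Fin O.q) (X : Prop)
    (v : Fin n) : List (Fin n) :=
  if X then partX v (O.x a) (O.y b) (O.x e) else partX v (O.y b) (O.x a) (O.y g)

-- The constant 152 is the sum 12 + 40 + 30 + 30 + 40 over the five stages. The current vertex of
-- the new state is left as the number `s'.reg 45`, since after the last block it is not claimed to
-- be a vertex.
open Classical in
theorem ends_blockBody (hs : AtBlock s O a b k v P) (h : O.IsBlock a b e g a' b')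
    (hg : O.Good a b) :
    Ends blockBody s ((a' - a + (b' - b)) * 22 + 152) fun s' =>
      AtBlock s' O a' b' (k + 1) (s'.reg 45) (P ++ blockPart O a e b g (ExitX O e a' b') v) ∧
      Marked s s' (O.block a b e g a' b') k ∧
      s'.reg 45 = if ExitX O e a' b' then s.arr 4 b' else s.arr 3 a' := by
  refine (Ends.seq (T := 12 + ((a' - a + (b' - b)) * 22 + 40)) (T' := 30 + (30 + 40)) (Ends.seq
    ((ends_blockStart hs h).mono le_rfl ?_))).mono (by omega) fun _ _ h => h
  rintro s1 A1 ⟨r36, r37, r38, r39⟩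
  have hl1 := hs.last.agree A1
  refine (ends_blockMarks hl1 h hg ((A1.reg 34 (by decide)).trans hs.a)
    ((A1.reg 35 (by decide)).trans hs.b) r36 r37 ((A1.reg 4 (by decide)).trans hs.k)).mono le_rfl ?_
  rintro s2 A2 ⟨r34, r35, hm⟩
  have hl2 := hl1.agree A2
  have t36 := (A2.reg 36 (by decide)).trans r36
  have t37 := (A2.reg 37 (by decide)).trans r37
  have t38 := (A2.reg 38 (by decide)).trans r38
  have t39 := (A2.reg 39 (by decide)).trans r39
  refine Ends.seq ((ends_blockExit hl2 r34 r35 t36).mono le_rfl ?_)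
  rintro s3 A3 ⟨r4, r41⟩
  have hl3 := hl2.agree A3
  refine Ends.seq ((ends_blockEnds (a := a) (b := b) hl3 ((A3.reg 36 (by decide)).trans t36)
    ((A3.reg 37 (by decide)).trans t37) ((A3.reg 38 (by decide)).trans t38)
    ((A3.reg 39 (by decide)).trans t39) r41).mono le_rfl ?_)
  rintro s4 A4 ⟨r42, r43, r44⟩
  have hl4 := hl3.agree A4
  have hP : HoldsList s4 1 2 P := by
    refine hs.path.congr ?_ ?_
    · rw [A4.reg 1 (by decide), A3.reg 1 (by decide), A2.reg 1 (by decide), A1.reg 1 (by decide)]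
    · rw [A4.arr 2 (by decide), A3.arr 2 (by decide), A2.arr 2 (by decide), A1.arr 2 (by decide)]
  have h45 : s4.reg 45 = v := by
    rw [A4.reg 45 (by decide), A3.reg 45 (by decide), A2.reg 45 (by decide),
      A1.reg 45 (by decide), hs.v]
  refine (ends_blockPath hP h45 r42 r43 r44).mono le_rfl ?_
  rintro s5 A5 ⟨hP5, r45⟩
  have q34 : s4.reg 34 = a' := by rw [A4.reg 34 (by decide), A3.reg 34 (by decide), r34]
  have q35 : s4.reg 35 = b' := by rw [A4.reg 35 (by decide), A3.reg 35 (by decide), r35]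
  have b3 : s4.arr 3 = s.arr 3 := by
    rw [A4.arr 3 (by decide), A3.arr 3 (by decide), A2.arr 3 (by decide), A1.arr 3 (by decide)]
  have b4 : s4.arr 4 = s.arr 4 := by
    rw [A4.arr 4 (by decide), A3.arr 4 (by decide), A2.arr 4 (by decide), A1.arr 4 (by decide)]
  refine ⟨⟨hl4.agree A5, ?_, ?_, ?_, rfl, ?_⟩, ?_, ?_⟩
  · rw [A5.reg 34 (by decide), q34]
  · rw [A5.reg 35 (by decide), q35]
  · rw [A5.reg 4 (by decide), A4.reg 4 (by decide), r4, A2.reg 4 (by decide),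
      A1.reg 4 (by decide), hs.k]
  · have : blockPart O a e b g (ExitX O e a' b') v = partX v
        (if ExitX O e a' b' then O.x a else O.y b) (if ExitX O e a' b' then O.y b else O.x a)
        (if ExitX O e a' b' then O.x e else O.y g) := by
      unfold blockPart; split_ifs <;> rfl
    rw [this]
    exact hP5
  · have c5 : s5.arr 5 = s2.arr 5 := by
      rw [A5.arr 5 (by decide), A4.arr 5 (by decide), A3.arr 5 (by decide)]
    have c6 : s5.arr 6 = s2.arr 6 := by
      rw [A5.arr 6 (by decide), A4.arr 6 (by decide), A3.arr 6 (by decide)]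
    have d5 : s1.arr 5 = s.arr 5 := A1.arr 5 (by decide)
    have d6 : s1.arr 6 = s.arr 6 := A1.arr 6 (by decide)
    unfold Marked at hm ⊢
    rwa [c5, c6, ← d5, ← d6]
  · rw [r45, q34, q35, b3, b4, A4.reg 41 (by decide), r41]
    split_ifs <;> simp_all

end Block

end RAM

namespace PathEcc

theorem Decomposes.subset {V : Type*} {G : SimpleGraph V} {O : Ordering G} {R : Set V}
    {L : List (Block V)} (h : Decomposes O R L) {B : Block V} (hB : B ∈ L) :
    B.K ⊆ R ∧ B.J ⊆ R := by
  induction h with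
  | nil => simp at hB
  | cons hi hj hK hJ hL ih =>
    rcases List.mem_cons.1 hB with rfl | hB
    · exact ⟨hK ▸ fun w hw => hw.1, hJ ▸ fun w hw => hw.1.1⟩
    · exact ⟨(ih hB).1.trans Set.sdiff_subset, (ih hB).2.trans Set.sdiff_subset⟩

end PathEcc

/-! ### The loop over the blocks. -/

namespace RAM

open PathEcc PathEcc.Ordering

variable {n : ℕ} {G : SimpleGraph (Fin n)} {O : PathEcc.Ordering G}

/-- The blocks of the list `L`, numbered from `k` on, are marked in the arrays `5` and `6` on the
set `R`. -/
def MarksBlocks (s : State) (k : ℕ) (R : Set (Fin n)) (L : List (Block (Fin n))) : Prop :=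
  ∀ z ∈ R, k ≤ s.arr 5 z ∧ ∀ (i : ℕ) (h : i < L.length),
    (z ∈ L[i].K ↔ s.arr 5 z = k + i ∧ s.arr 6 z = 0) ∧
    (z ∈ L[i].J ↔ s.arr 5 z = k + i ∧ s.arr 6 z = 1)

/-- Later blocks lie in `R`, carry numbers above `k` there, and leave the marks outside `R`
untouched, so they do not interfere with the marks of `B`. The lower bound in `MarksBlocks` serves
this purpose. -/
theorem MarksBlocks.cons {s s' s'' : State} {k : ℕ} {R : Set (Fin n)} {B : Block (Fin n)}
    {L : List (Block (Fin n))} (hL : Decomposes O R L) (hm : Marked s s' B k)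
    (h : MarksBlocks s'' (k + 1) R L) (hBJ : ∀ z ∈ B.K, z ∉ B.J) (hK : ∀ z ∈ B.K, z ∉ R)
    (hJ : ∀ z ∈ B.J, z ∉ R)
    (hR : ∀ z ∉ R, s''.arr 5 z = s'.arr 5 z ∧ s''.arr 6 z = s'.arr 6 z) :
    MarksBlocks s'' k (B.K ∪ B.J ∪ R) (B :: L) := by
  rintro z ((hz | hz) | hz)
  · obtain ⟨h5, h6⟩ := hR z (hK z hz)
    obtain ⟨k5, k6⟩ := hm.1 z hz
    rw [h5, h6, k5, k6]
    refine ⟨le_rfl, ?_⟩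
    rintro (_ | i) hi
    · simp [hz, hBJ z hz]
    · have := hL.subset (List.getElem_mem (by simpa using hi : i < L.length))
      simpa using ⟨fun h' => hK z hz (this.1 h'), fun h' => hK z hz (this.2 h')⟩
  · obtain ⟨h5, h6⟩ := hR z (hJ z hz)
    obtain ⟨k5, k6⟩ := hm.2.1 z hz
    rw [h5, h6, k5, k6]
    refine ⟨le_rfl, ?_⟩
    rintro (_ | i) hi
    · simpa [hz] using fun h' => hBJ z h' hz
    · have := hL.subset (List.getElem_mem (by simpa using hi : i < L.length))
      simpa using ⟨fun h' => hJ z hz (this.1 h'), fun h' => hJ z hz (this.2 h')⟩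
  · obtain ⟨h1, h2⟩ := h z hz
    refine ⟨by omega, ?_⟩
    rintro (_ | i) hi
    · have h3 : s''.arr 5 z ≠ k := by omega
      simpa [h3] using ⟨fun h' => hK z h' hz, fun h' => hJ z h' hz⟩
    · have := h2 i (by simpa using hi)
      rw [add_assoc, add_comm 1 i] at this
      simpa using this

def blockLoop : Program := .loop (.lt (.reg 34) (.reg 2)) blockBody

theorem ends_blockLoop (hG : ∀ v, ∃ w, G.Adj v w) (hO : O.IsStrong) {L : List (Block (Fin n))}
    {a : Fin O.p} {b : Fin O.q} (hg : O.Good a b) (hL : Decomposes O (O.tail a b) L) {v : Fin n}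
    (hv : v = O.x a ∨ v = O.y b) {s : State} {k : ℕ} {P : List (Fin n)}
    (hs : AtBlock s O a b k v P) :
    Ends blockLoop s ((O.p - a + (O.q - b)) * 100 + 4) fun s' => ∃ Q, DomPathLoop O L v Q ∧
      HoldsList s' 1 2 (P ++ Q) ∧ s'.reg 4 = k + L.length ∧
      (∀ z ∉ O.tail a b, s'.arr 5 z = s.arr 5 z ∧ s'.arr 6 z = s.arr 6 z) ∧
      MarksBlocks s' k (O.tail a b) L := by
  classical
  induction L generalizing a b v s k P with
  | nil =>
    obtain ⟨e, g, a', b', h⟩ := hg.exists_isBlock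
    obtain ⟨L', hL', hL''⟩ := hL.of_good h hg hO hG
    simp at hL'
  | cons B L ih =>
    obtain ⟨e, g, a', b', h⟩ := hg.exists_isBlock
    obtain ⟨L', hL', hL''⟩ := hL.of_good h hg hO hG
    obtain ⟨rfl, rfl⟩ := List.cons.inj hL'
    have hX := h.isPathIn_partX hg hO hG hv
    have hY := h.isPathIn_partY hg hO hG hv
    have rX : O.IsRX (O.block a b e g a' b').K e := isRX_seg (h.a_le hg) _ _
    have rY : O.IsRY (O.block a b e g a' b').K g := isRY_seg (h.b_le hg) _ _
    have hae : (a : ℕ) ≤ e := h.a_le hg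
    have hbg : (b : ℕ) ≤ g := h.b_le hg
    have hea := h.hea
    have hgb := h.hgb
    have hap := h.hap
    have hbq := h.hbq
    have hunion : O.tail a b = (O.block a b e g a' b').K ∪ (O.block a b e g a' b').J ∪
        O.tail a' b' := by
      ext z
      rcases O.cover z with ⟨i, rfl⟩ | ⟨j, rfl⟩ <;>
        simp only [block, Set.mem_union, x_mem_seg, x_mem_tail, y_mem_seg, y_mem_tail] <;> omega
    have hBJ : ∀ z ∈ (O.block a b e g a' b').K, z ∉ (O.block a b e g a' b').J := by
      intro z
      rcases O.cover z with ⟨i, rfl⟩ | ⟨j, rfl⟩ <;>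
        simp only [block, x_mem_seg, y_mem_seg] <;> omega
    have hKR : ∀ z ∈ (O.block a b e g a' b').K, z ∉ O.tail a' b' := by
      intro z
      rcases O.cover z with ⟨i, rfl⟩ | ⟨j, rfl⟩ <;>
        simp only [block, x_mem_seg, y_mem_seg, x_mem_tail, y_mem_tail] <;> omega
    have hJR : ∀ z ∈ (O.block a b e g a' b').J, z ∉ O.tail a' b' := by
      intro z
      rcases O.cover z with ⟨i, rfl⟩ | ⟨j, rfl⟩ <;>
        simp only [block, x_mem_seg, y_mem_seg, x_mem_tail, y_mem_tail] <;> omega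
    have houter : ∀ z ∉ O.tail a b, z ∉ (O.block a b e g a' b').K ∧
        z ∉ (O.block a b e g a' b').J ∧ z ∉ O.tail a' b' := by
      rw [hunion]; simp only [Set.mem_union]; tauto
    have hlt : a' - a + (b' - b) + (O.p - a' + (O.q - b')) = O.p - a + (O.q - b) := by omega
    have hcond : (Expr.lt (.reg 34) (.reg 2)).eval s ≠ 0 := by
      simp [Expr.eval, hs.a, hs.last.p]
    -- A block uses up `m ≥ 2` vertices, at least one of each part. Then `22 * m + 152` and 4 for
    -- the test are at most `100 * m`, with equality for `m = 2`.
    refine (Ends.loop_step (T := (a' - a + (b' - b)) * 22 + 152)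
      (T' := (O.p - a' + (O.q - b')) * 100 + 4) hcond
      ((ends_blockBody hs h hg).mono le_rfl ?_)).mono
      (by simp only [Expr.cost]; omega) fun _ _ h => h
    rintro s1 A1 ⟨hs1, hm, h45⟩
    rcases h.next hO hG with ⟨h1, h2⟩ | ⟨c, d, h1, h2, hcd⟩
    · obtain rfl := hL''.eq_nil h1.ge h2.ge
      refine (Ends.loop_done (by simp [Expr.eval, hs1.a, hs1.last.p, h1]) ?_).mono
        (by simp [Expr.cost]) fun _ _ h => h
      have hexit : ExitX O e a' b' ↔ (O.block a b e g a' b').J ⊆ Set.range O.y := by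
        rw [h.j_subset, ExitX]; omega
      refine ⟨blockPart O a e b g (ExitX O e a' b') v, ?_, hs1.path, hs1.k,
        fun z hz => hm.2.2 z (houter z hz).1 (houter z hz).2.1, ?_⟩
      · unfold blockPart
        split_ifs with hE
        · exact .lastX (hexit.1 hE) rX hX
        · exact .lastY (mt hexit.2 hE) rY hY
      · rw [hunion]
        refine MarksBlocks.cons hL'' hm (fun z hz => ?_) hBJ hKR hJR fun z hz => ⟨rfl, rfl⟩
        rw [h1, h2, tail_end le_rfl le_rfl] at hz
        exact hz.elim
    · subst h1 h2
      obtain ⟨e', g', c', d', h'⟩ := hcd.exists_isBlock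
      obtain ⟨L'', rfl, -⟩ := hL''.of_good h' hcd hO hG
      -- As `c` is a vertex of `X` after the block, only the first alternative of `ExitX` is
      -- possible, and it is the criterion for an `XY`-edge.
      have hexit : ExitX O e c d ↔
          LinkedXY O (O.block a b e g c d).K (O.block c d e' g' c' d').K := by
        rw [linkedXY_iff h hg hO hG rfl h' hcd, ExitX]
        have := c.isLt
        omega
      have hv' : s1.reg 45 = (if ExitX O e c d then O.y d else O.x c : Fin n) := by
        rw [h45, hs.last.x, hs.last.y]
        split_ifs <;> rfl
      rw [hv'] at hs1
      refine (ih hcd hL'' (by split_ifs <;> simp) hs1).mono le_rfl ?_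
      rintro s2 - ⟨Q, hQ, hPQ, h4, hout, hmark⟩
      refine ⟨blockPart O a e b g (ExitX O e c d) v ++ Q, ?_, by rwa [← List.append_assoc],
        by rw [h4, List.length_cons (as := _ :: L'')]; omega, fun z hz => ?_, ?_⟩
      · unfold blockPart
        split_ifs at hQ ⊢ with hE
        · exact .stepXY (hexit.1 hE) rX hX (isLY_seg (h'.b_le hcd) _ _) hQ
        · exact .stepYX (mt hexit.2 hE) rY hY (isLX_seg (h'.a_le hcd) _ _) hQ
      · obtain ⟨z1, z2, z3⟩ := houter z hz
        rw [(hout z z3).1, (hout z z3).2]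
        exact hm.2.2 z z1 z2
      · rw [hunion]
        exact hmark.cons hL'' hm hBJ hKR hJR hout

end RAM

/-! ### Assembly of the linear-time program. -/

namespace RAM

open PathEcc PathEcc.Ordering

section Ordering

variable {n : ℕ} {adj : Fin n → List (Fin n)} {G : SimpleGraph (Fin n)}

theorem IsAdjacencyLists.sum_length (hadj : IsAdjacencyLists G adj) :
    ∑ v, (adj v).length = 2 * G.edgeSet.ncard := by
  classical
  rw [← SimpleGraph.coe_edgeFinset, Set.ncard_coe_finset, ← G.sum_degrees_eq_twice_card_edges]
  refine Finset.sum_congr rfl fun v _ => ?_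
  rw [← List.toFinset_card_of_nodup (hadj v).1, ← SimpleGraph.card_neighborFinset_eq_degree]
  congr 1
  ext w
  simp [(hadj v).2]

theorem IsAdjacencyLists.sum_cost (hadj : IsAdjacencyLists G adj) (i j : ℕ) :
    ∑ v, ((adj v).length * i + j) = 2 * G.edgeSet.ncard * i + n * j := by
  rw [Finset.sum_add_distrib, ← Finset.sum_mul, hadj.sum_length]
  simp

/-- Compute, in array `10`, the distances (plus one) from a vertex with which a strong ordering
may begin. -/
def levelsProgram : Program := .seq (bfs 7 8) (.seq selectLoop (bfs 9 10))

/-- The second search starts at a vertex `u` of minimal degree in the last level of the first one. A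
strong numbering in which `u` comes first exists and is used only in the proof. -/
theorem ends_levelsProgram (hadj : IsAdjacencyLists G adj) (hG : G.Connected)
    (hB : IsBipartitePermutationGraph G) (hN : ∀ v, ∃ w, G.Adj v w) :
    Ends levelsProgram (inputState adj) (G.edgeSet.ncard * 100 + n * 104 + 36) fun s' =>
      ∃ D : Fin n → ℕ, (∀ v : Fin n, s'.arr 10 v = D v) ∧ (∀ v, D v ≠ 0) ∧
        (∃ u, IsLevels G u fun v => D v - 1) ∧
        IsStrongKey G (fun v => decide ((D v - 1) % 2 = 0)) (levelKey G fun v => D v - 1) := by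
  obtain ⟨v₀⟩ := hG.nonempty
  have hpos : 0 < n := v₀.pos
  have hin := input_inputState adj
  refine (Ends.seq ((ends_bfs (src := ⟨0, hpos⟩) hadj hG (by decide) (by decide) (by decide)
    (by decide) (by decide) hin (by simp [inputState]) (by simp [inputState])).mono
    (T' := G.edgeSet.ncard * 50 + n * 28 + 14) (by rw [hadj.sum_cost]; omega) ?_)).mono
    (T := _ + (n * 48 + 8 + (G.edgeSet.ncard * 50 + n * 28 + 14))) (by omega) fun _ _ h => h
  rintro s1 A1 ⟨hD1, hl1⟩
  have hin1 := hin.agree A1 (by decide) (by decide) (by decide)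
  refine Ends.seq ((ends_selectLoop hin1 hpos (D := fun v => s1.arr 8 v) fun v => rfl).mono
    le_rfl ?_)
  rintro s2 A2 ⟨u, hu, hmax⟩
  have hin2 := hin1.agree A2 (by decide) (by decide) (by decide)
  refine (ends_bfs (src := u) hadj hG (by decide) (by decide) (by decide)
    (by decide) (by decide) hin2 hu ?_).mono (by rw [hadj.sum_cost]; omega) ?_
  · intro v
    rw [A2.arr 10 (by decide), A1.arr 10 (by decide)]
    simp [inputState]
  rintro s3 A3 ⟨hD3, hl3⟩
  obtain ⟨c, f, h, hf⟩ := exists_isStrongKey hB hN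
  obtain ⟨g, hg, hgi, hgu⟩ := hl1.exists_first (u := u) h hf hN
    (fun v => by rcases hmax v with h | h <;> omega) fun v hv hsub w hw => by
      have hv1 := hD1 v
      have hu1 := hD1 u
      rcases hmax v with h | ⟨-, h⟩
      · omega
      -- The neighbours of `v` are among those of `u`, and `u` has no larger degree, so the two
      -- lists agree up to order.
      have hs : (adj v).Subperm (adj u) := List.subperm_of_subset (hadj v).1
        fun z hz => ((hadj u).2 z).2 (hsub z (((hadj v).2 z).1 hz))
      exact ((hadj v).2 w).1 (((hs.perm_of_length_le h).mem_iff).2 (((hadj u).2 w).2 hw))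
  exact ⟨fun v => s3.arr 10 v, fun v => rfl, hD3, ⟨u, hl3⟩,
    hl3.isStrongKey_levelKey hg hgi hN hgu⟩

theorem ends_set (r : ℕ) (e : Expr) (s : State) :
    Ends (.set r e) s (e.cost + 1) fun s' => s'.reg r = e.eval s :=
  ⟨_, _, .set s r e, le_rfl, by simp⟩

/-- Array `11` counts by level and `13` by key; `12` holds the keys, `14` the sorted vertices, `15`
the parities and `16` the last neighbours. Register `29` bounds the range of the counts: first `n +
1`, as cell `D v + 1` is read with `D v ≤ n`, then `2 * n` for the keys. -/
def sortProgram : Program :=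
  .seq (.set 29 (.add (.reg 0) (.const 1))) (.seq (countBelow 10 11 29) (.seq keyLoop
    (.seq (.set 29 (.add (.reg 0) (.reg 0))) (.seq (countBelow 12 13 29)
      (.seq (placeLoop 12 13 14) (.seq parityLoop splitLoop))))))

theorem IsLast.eq_lastX {O : PathEcc.Ordering G} {w : Fin n} {r : ℕ}
    (h : IsLast G w (List.ofFn O.x) r) : r = O.lastX w := by
  apply le_antisymm
  · rcases h.2 with rfl | ⟨i, hi, hw, rfl⟩
    · exact Nat.zero_le _
    · rw [List.length_ofFn] at hi
      rw [List.getElem_ofFn] at hw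
      exact lt_lastX hw
  · by_contra! hlt
    obtain ⟨i, hi, hw⟩ := exists_lastX (O := O) (v := w) (by omega)
    have := h.1 i (by simp) (by simpa using hw)
    omega

theorem IsLast.eq_lastY {O : PathEcc.Ordering G} {w : Fin n} {r : ℕ}
    (h : IsLast G w (List.ofFn O.y) r) : r = O.lastY w :=
  IsLast.eq_lastX (O := O.swap) h

theorem HoldsOrdering.holdsLast {O : PathEcc.Ordering G} {s : State} (h : HoldsOrdering s O)
    (h0 : s.reg 0 = n) (hx : ∀ i, IsLast G (O.x i) (List.ofFn O.y) (s.arr 16 (O.x i)))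
    (hy : ∀ j, IsLast G (O.y j) (List.ofFn O.x) (s.arr 16 (O.y j))) : HoldsLast s O where
  size := h0
  p := by simpa using h.1.1
  q := by simpa using h.2.1
  x i := by simpa using h.1.2 i (by simp)
  y j := by simpa using h.2.2 j (by simp)
  lastY i := (hx i).eq_lastY
  lastX j := (hy j).eq_lastX

theorem ends_sortProgram (hadj : IsAdjacencyLists G adj) {s : State} (hin : Input adj s)
    {D : Fin n → ℕ} (hD : ∀ v : Fin n, s.arr 10 v = D v) (hD0 : ∀ v, D v ≠ 0) {u : Fin n}
    (hl : IsLevels G u fun v => D v - 1)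
    (h : IsStrongKey G (fun v => decide ((D v - 1) % 2 = 0)) (levelKey G fun v => D v - 1))
    (h0 : ∀ a, 11 ≤ a → ∀ i, s.arr a i = 0) (h2 : s.reg 2 = 0) (h3 : s.reg 3 = 0) :
    Ends sortProgram s (G.edgeSet.ncard * 76 + n * 222 + 100) fun s' =>
      ∃ O : PathEcc.Ordering G, O.IsStrong ∧ HoldsOrdering s' O ∧ HoldsLast s' O := by
  have hDle : ∀ v, D v ≤ n := fun v => by
    have := hl.lt_card v
    rw [Fintype.card_fin] at this
    omega
  have hc := h.ne
  set K : Fin n → ℕ := levelKey G fun v => D v - 1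
  have hKle : ∀ v, K v ≤ n + n := fun v => by
    have := levelKey_le G (fun v => D v - 1) v
    rwa [Fintype.card_fin, two_mul] at this
  obtain ⟨l, hln, hlen, hmem, hs, hrank⟩ := exists_sorted K
  have hO := Ordering.ofList_isStrong l hln hmem h hs
  set O := Ordering.ofList l hln hmem _ fun u v => @IsStrongKey.ne _ G _ _ h u v
  have hx : List.ofFn O.x = l.filter fun v => decide ((D v - 1) % 2 = 0) := List.ofFn_get _
  have hy : List.ofFn O.y = l.filter fun v => !decide ((D v - 1) % 2 = 0) := List.ofFn_get _
  refine (Ends.seq (T := 4) (T' := 40 * n + 32 + (G.edgeSet.ncard * 48 + n * 40 + 6 + (4 +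
    (60 * n + 12 + (n * 30 + 6 + (n * 16 + 6 + (G.edgeSet.ncard * 28 + n * 36 + 6)))))))
    ((ends_set _ _ _).mono le_rfl ?_)).mono (by omega) fun _ _ h => h
  rintro s1 A1 r29
  refine Ends.seq ((ends_countBelow (n := n) (M := n + 1) (by decide) (by decide) (by decide)
    ((A1.reg 0 (by decide)).trans hin.size) (r29.trans (by simp [Expr.eval, hin.size]))
    (fun v => (congrFun (A1.arr 10 (by decide)) v).trans (hD v))
    (fun j => (congrFun (A1.arr 11 (by decide)) j).trans (h0 11 (by omega) j))).mono
    (by omega) ?_)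
  rintro s2 A2 c11
  have hin2 := (hin.agree A1 (by decide) (by decide) (by decide)).agree A2 (by decide) (by decide)
    (by decide)
  refine Ends.seq ((ends_keyLoop hin2 (D := D)
    (N := fun j => (Finset.univ.filter fun w => D w < j).card)
    (fun v => by rw [A2.arr 10 (by decide), A1.arr 10 (by decide), hD])
    (fun v => c11 _ (by have := hDle v; omega))
    (fun v => c11 _ (by have := hDle v; omega))).mono (by rw [hadj.sum_cost]; omega) ?_)
  rintro s3 A3 c12
  have k3 : ∀ v : Fin n, s3.arr 12 v = K v := fun v =>
    (c12 v).trans (hl.levelKey_eq hadj hD0 hc v).symm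
  have hin3 := hin2.agree A3 (by decide) (by decide) (by decide)
  refine Ends.seq ((ends_set _ _ _).mono le_rfl ?_)
  rintro s4 A4 r29
  refine Ends.seq ((ends_countBelow (n := n) (M := n + n) (by decide) (by decide) (by decide)
    ((A4.reg 0 (by decide)).trans hin3.size) (r29.trans (by simp [Expr.eval, hin3.size]))
    (fun v => (congrFun (A4.arr 12 (by decide)) v).trans (k3 v))
    (fun j => by
      rw [A4.arr 13 (by decide), A3.arr 13 (by decide), A2.arr 13 (by decide),
        A1.arr 13 (by decide), h0 13 (by omega)])).mono (by omega) ?_)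
  rintro s5 A5 c13
  have hin5 := (hin3.agree A4 (by decide) (by decide) (by decide)).agree A5 (by decide) (by decide)
    (by decide)
  refine Ends.seq ((ends_placeLoop (by decide) (by decide) (by decide) hin5.size
    (fun v => by rw [A5.arr 12 (by decide), A4.arr 12 (by decide), k3])
    hKle c13).mono (by omega) ?_)
  rintro s6 A6 c14
  have hin6 := hin5.agree A6 (by decide) (by decide) (by decide)
  refine Ends.seq ((ends_parityLoop hin6.size (by
    rw [A6.arr 15 (by decide), A5.arr 15 (by decide), A4.arr 15 (by decide),
      A3.arr 15 (by decide), A2.arr 15 (by decide), A1.arr 15 (by decide),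
      h0 15 (by omega)])).mono (by omega) ?_)
  rintro s7 A7 c15
  have hin7 := hin6.agree A7 (by decide) (by decide) (by decide)
  refine (ends_splitLoop hadj hin7 hln hlen hmem (c := fun v => decide ((D v - 1) % 2 = 0))
    (fun i hi => ?_) hc (fun v => ?_) ?_ ?_ (fun i => ?_)).mono (by rw [hadj.sum_cost]; omega) ?_
  · rw [A7.arr 14 (by decide), ← c14, hrank i hi]
  · rw [A7.arr 10 (by decide), A6.arr 10 (by decide), A5.arr 10 (by decide),
      A4.arr 10 (by decide), A3.arr 10 (by decide), A2.arr 10 (by decide),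
      A1.arr 10 (by decide), hD, c15 _ (hDle v)]
    -- The table gives the parity of `D v`, which is opposite to that of the level because `D v` is
    -- nonzero.
    have := hD0 v
    simp only [decide_eq_true_eq]
    split_ifs <;> omega
  · rw [A7.reg 2 (by decide), A6.reg 2 (by decide), A5.reg 2 (by decide), A4.reg 2 (by decide),
      A3.reg 2 (by decide), A2.reg 2 (by decide), A1.reg 2 (by decide), h2]
  · rw [A7.reg 3 (by decide), A6.reg 3 (by decide), A5.reg 3 (by decide), A4.reg 3 (by decide),
      A3.reg 3 (by decide), A2.reg 3 (by decide), A1.reg 3 (by decide), h3]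
  · rw [A7.arr 16 (by decide), A6.arr 16 (by decide), A5.arr 16 (by decide),
      A4.arr 16 (by decide), A3.arr 16 (by decide), A2.arr 16 (by decide),
      A1.arr 16 (by decide), h0 16 (by omega)]
  rintro s8 A8 ⟨hX, hY, hlast⟩
  have hH : HoldsOrdering s8 O := ⟨hx ▸ hX, hy ▸ hY⟩
  refine ⟨O, hO, hH, hH.holdsLast ((A8.reg 0 (by decide)).trans hin7.size) (fun i => ?_)
    fun j => ?_⟩
  · rw [hy]
    refine (hlast _).2 ?_
    have := List.mem_filter.1 (hx ▸ List.mem_ofFn.2 ⟨i, rfl⟩)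
    exact this.2
  · rw [hx]
    refine (hlast _).1 ?_
    have := List.mem_filter.1 (hy ▸ List.mem_ofFn.2 ⟨j, rfl⟩)
    simpa using this.2

/-! ### The algorithm -/

def pathProgram : Program :=
  .seq (.seq (.set 34 (.const 0)) (.seq (.set 35 (.const 0)) (.set 45 (.read 3 (.const 0)))))
    blockLoop

theorem ends_pathProgram (hG : ∀ v, ∃ w, G.Adj v w) {O : PathEcc.Ordering G} (hO : O.IsStrong)
    {a : Fin O.p} {b : Fin O.q} (ha : (a : ℕ) = 0) (hb : (b : ℕ) = 0) (hg : O.Good a b)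
    {L : List (Block (Fin n))} (hL : IsCompleteBipartiteDecomposition O L) {s : State}
    (hl : HoldsLast s O) (h1 : s.reg 1 = 0) (h4 : s.reg 4 = 0) :
    Ends pathProgram s (n * 200 + 12) fun s' => ∃ Q, DomPathReturns O L Q ∧
      HoldsList s' 1 2 Q ∧ HoldsBlocks s' L := by
  have htail : O.tail a b = Set.univ := by rw [ha, hb, tail_zero]
  have hL' : Decomposes O (O.tail a b) L := htail ▸ hL
  have hp := p_le O
  have hq := q_le O
  refine (Ends.seq (T := 8) (T' := n * 200 + 4) ((Ends.exec (by rfl) (Q := fun s' =>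
    AtBlock s' O a b 0 (O.x a) []) ?_).mono (by decide) ?_)).mono (by omega) fun _ _ h => h
  · have hx := hl.x a
    rw [ha] at hx
    constructor
    · exact hl.congr (by simp [Program.exec]) (by simp [Program.exec]) (by simp [Program.exec])
        rfl rfl rfl
    · simp [Program.exec, Expr.eval, ha]
    · simp [Program.exec, Expr.eval, hb]
    · simp [Program.exec, h4]
    · simp [Program.exec, Expr.eval, hx]
    · exact ⟨by simp [Program.exec, h1], by simp⟩
  · rintro s1 - hs
    refine (ends_blockLoop hG hO hg hL' (Or.inl rfl) hs).mono (by omega) ?_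
    rintro s2 - ⟨Q, hQ, hPQ, h4, -, hm⟩
    rw [htail] at hm
    obtain ⟨e, g, a', b', h⟩ := hg.exists_isBlock
    obtain ⟨L', rfl, -⟩ := hL'.of_good h hg hO hG
    exact ⟨Q, ⟨_, L', a, rfl, isLX_seg (h.a_le hg) _ _, hQ⟩, hPQ, by simpa using h4,
      fun i hi v => by simpa using (hm v trivial).2 i hi⟩

/-- The whole algorithm. -/
def domPathProgram : Program :=
  .ite (.lt (.reg 0) (.const 2)) (.set 1 (.const 1))
    (.seq levelsProgram (.seq sortProgram pathProgram))

theorem ends_domPathProgram (hadj : IsAdjacencyLists G adj) (hG : G.Connected)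
    (hB : IsBipartitePermutationGraph G) :
    Ends domPathProgram (inputState adj) (1000 * (n + G.edgeSet.ncard)) fun s =>
      ∃ P : List (Fin n), HoldsList s 1 2 P ∧ IsDominatingPath G P ∧
        (2 ≤ n → ∃ (O : PathEcc.Ordering G) (L : List (Block (Fin n))), O.IsStrong ∧
          IsCompleteBipartiteDecomposition O L ∧ DomPathReturns O L P ∧ HoldsOrdering s O ∧
            HoldsBlocks s L) := by
  obtain ⟨v₀⟩ := hG.nonempty
  have hpos : 0 < n := v₀.pos
  have h0 : (inputState adj).reg 0 = n := by simp [inputState]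
  -- The bound adds up the three stages; the additive constant is absorbed because `n ≥ 1`.
  refine (Ends.ite (T := G.edgeSet.ncard * 176 + n * 526 + 148) (fun he => ?_)
    fun he => ?_).mono (by simp only [Expr.cost]; omega) fun _ _ h => h
  · have hn : n = 1 := by
      simp only [Expr.eval, h0, ne_eq, ite_eq_right_iff, one_ne_zero, imp_false, not_not] at he
      omega
    subst hn
    refine (ends_set _ _ _).mono (by simp only [Expr.cost]; omega) ?_
    intro s A hs
    -- Cell `0` of array `2` is zero from the start, so for a single vertex it is enough to set the
    -- length.
    refine ⟨[0], ⟨hs, ?_⟩, isDominatingPath_single 0, fun h => by omega⟩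
    intro i hi
    rw [A.arr 2 (by decide)]
    simp [inputState]
  · have hn : 2 ≤ n := by
      simp only [Expr.eval, h0, ite_eq_right_iff, one_ne_zero, imp_false] at he
      omega
    have : Nontrivial (Fin n) := Fin.nontrivial_iff_two_le.2 hn
    have hN := hG.preconnected.exists_adj_of_nontrivial
    refine (Ends.seq (T' := G.edgeSet.ncard * 76 + n * 222 + 100 + (n * 200 + 12))
      ((ends_levelsProgram hadj hG hB hN).mono le_rfl ?_)).mono (by omega) fun _ _ h => h
    rintro s1 A1 ⟨D, hD, hD0, ⟨u, hl⟩, hkey⟩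
    have hin1 := (input_inputState adj).agree A1 (by decide) (by decide) (by decide)
    have harr : ∀ a, 11 ≤ a → ∀ i, s1.arr a i = 0 := fun a ha i => by
      rw [A1.arr a]
      · simp [inputState, show a ≠ 0 by omega, show a ≠ 1 by omega]
      · have : ∀ a ∈ levelsProgram.arrs, a < 11 := by decide
        exact fun h => absurd (this a h) (by omega)
    have hreg : ∀ r, r = 1 ∨ r = 2 ∨ r = 3 ∨ r = 4 → s1.reg r = 0 := by
      rintro r (rfl | rfl | rfl | rfl) <;> rw [A1.reg _ (by decide)] <;> simp [inputState]
    refine Ends.seq ((ends_sortProgram hadj hin1 hD hD0 hl hkey harr (hreg 2 (by simp))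
      (hreg 3 (by simp))).mono le_rfl ?_)
    rintro s2 A2 ⟨O, hO, hH, hlast⟩
    obtain ⟨⟨L, hL⟩, hcorrect⟩ := correctness hG hO
    obtain ⟨a, b, ha, hb, hg⟩ := Good.zero hG O
    refine (ends_pathProgram hN hO ha hb hg hL hlast
      ((A2.reg 1 (by decide)).trans (hreg 1 (by simp)))
      ((A2.reg 4 (by decide)).trans (hreg 4 (by simp)))).mono le_rfl ?_
    rintro s3 A3 ⟨P, hP, hHP, hHB⟩
    exact ⟨P, hHP, (hcorrect L hL).2 P hP, fun _ => ⟨O, L, hO, hL, hP,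
      ⟨hH.1.congr (A3.reg 2 (by decide)) (A3.arr 3 (by decide)),
        hH.2.congr (A3.reg 3 (by decide)) (A3.arr 4 (by decide))⟩, hHB⟩⟩

end Ordering

end RAM

theorem mainTheorem5 :
    -- correctness: whatever choices the algorithm makes, it returns a dominating path
    (∀ (V : Type*) [Finite V] [Nontrivial V] (G : SimpleGraph V),
      G.Connected → PathEcc.IsBipartitePermutationGraph G →
        (∃ O : PathEcc.Ordering G, O.IsStrong) ∧
        ∀ O : PathEcc.Ordering G, O.IsStrong →
          (∃ L, PathEcc.IsCompleteBipartiteDecomposition O L) ∧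
          ∀ L, PathEcc.IsCompleteBipartiteDecomposition O L →
            (∃ P, PathEcc.DomPathReturns O L P) ∧
            ∀ P, PathEcc.DomPathReturns O L P → PathEcc.IsDominatingPath G P) ∧
    -- running time: the algorithm can be carried out in linear time
    (∃ (c : RAM.Program) (C : ℕ), ∀ (n : ℕ) (G : SimpleGraph (Fin n)),
      G.Connected → PathEcc.IsBipartitePermutationGraph G →
        ∀ adj : Fin n → List (Fin n), RAM.IsAdjacencyLists G adj →
          ∃ (s : RAM.State) (t : ℕ) (P : List (Fin n)),
            RAM.Runs c (RAM.inputState adj) s t ∧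
            t ≤ C * (n + G.edgeSet.ncard) ∧
            RAM.HoldsList s 1 2 P ∧
            PathEcc.IsDominatingPath G P ∧
            (2 ≤ n → ∃ (O : PathEcc.Ordering G) (L : List (PathEcc.Block (Fin n))),
              O.IsStrong ∧ PathEcc.IsCompleteBipartiteDecomposition O L ∧
              PathEcc.DomPathReturns O L P ∧
              RAM.HoldsOrdering s O ∧ RAM.HoldsBlocks s L)) ∧
    -- the bound on the path eccentricity
    (∀ (V : Type*) [Finite V] (G : SimpleGraph V),
      G.Connected → PathEcc.IsBipartitePermutationGraph G → PathEcc.pe G ≤ 1) := by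
  refine ⟨fun V _ _ G hG hB => ⟨PathEcc.exists_isStrong hB
    hG.preconnected.exists_adj_of_nontrivial, fun O hO => PathEcc.correctness hG hO⟩,
    ⟨RAM.domPathProgram, 1000, fun n G hG hB adj hadj => ?_⟩,
    fun V _ G hG hB => PathEcc.pe_le_one hG hB⟩
  obtain ⟨s, t, hr, ht, P, hP⟩ := RAM.ends_domPathProgram hadj hG hB
  exact ⟨s, t, P, hr, ht, hP⟩
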